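/- Let $\Sigma$ be a compact smooth $3$-dimensional manifold without boundary, with a Riemannian metric $h$ of regularity $C^{1,1}$; write $L^2(\Sigma)$ for the space formed with the Riemannian volume $\sqrt h\,dx$, and $\Delta_h=\frac1{\sqrt h}\partial_a(\sqrt h\,h^{ab}\partial_b)$. Let $m>0$, and let $\{\phi_j\}_{j\in\mathbb N}$ be an orthonormal basis of $L^2(\Sigma)$ of real-valued eigenfunctions of the self-adjoint operator $mI-\Delta_h$ (the closure from $C^\infty(\Sigma)$), $(mI-\Delta_h)\phi_j=\lambda_j^2\phi_j$. On $\mathbb R^2\times\Sigma^2$, with points $(t,s,x,y)$, put $\Delta=\partial_t^2+\partial_s^2+\Delta_{h_x}+\Delta_{h_y}$. Let $\mathcal S'(\mathbb R^2\times\Sigma^2)$ be the dual of $\mathcal S(\mathbb R^2)\hat\otimes_\pi C^\infty(\Sigma^2)$, in which $L^2(\mathbb R^2\times\Sigma^2)$ is embedded by integration. For $-2\le r\le 2$ let $H^r(\mathbb R^2\times\Sigma^2)\subset\mathcal S'(\mathbb R^2\times\Sigma^2)$ be the completion of $C_c^\infty(\mathbb R^2\times\Sigma^2)$ for the norm $\|(I-\Delta)^{r/2}f\|_{L^2}$.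 Let $\mathcal F$ be the Fourier transform on $\mathbb R^2$, normalised by $(2\pi)^{-1}$. For $u\in\mathcal S'(\mathbb R^2\times\Sigma^2)$ let $u_{jk}=\langle u,\phi_j\otimes\phi_k\rangle\in\mathcal S'(\mathbb R^2)$ be the pairing in the variables $(x,y)$. Since $\phi_j\otimes\phi_k$ need not be smooth, it is defined by continuity: $u_{jk}(g)=\lim_n\langle u,g\otimes a_n\rangle$ for $g\in\mathcal S(\mathbb R^2)$ and every sequence $a_n\in C^\infty(\Sigma^2)$ with $a_n\to\phi_j\otimes\phi_k$ in $L^2(\Sigma^2)$ and $(\Delta_{h_x}+\Delta_{h_y})a_n$ convergent in $L^2(\Sigma^2)$. If $u\in L^2(\mathbb R^2\times\Sigma^2)$, then $u_{jk}(t,s)=\int_{\Sigma^2}u(t,s,x,y)\phi_j(x)\phi_k(y)\sqrt{h(x)}\sqrt{h(y)}\,dx\,dy$ belongs to $L^2(\mathbb R^2)$. Consider the condition $$(E_r)\qquad \sum_{j,k}\int_{\mathbb R^2}\bigl(\xi_0^2+\eta_0^2+\lambda_j^2+\lambda_k^2\bigr)^{r}\,\bigl|(\mathcal F u_{jk})(\xi_0,\eta_0)\bigr|^2\,d\xi_0\,d\eta_0<\infty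 ,$$ which includes that all $u_{jk}$ are defined and that their Fourier transforms are locally integrable functions. Then: 1. Every $u\in L^2(\mathbb R^2\times\Sigma^2)$ has the expansion $u(t,s,x,y)=\sum_{j,k}u_{jk}(t,s)\phi_j(x)\phi_k(y)$, convergent in $L^2$, with $u_{jk}\in L^2(\mathbb R^2)$. 2. For $0\le r\le 2$, $H^r(\mathbb R^2\times\Sigma^2)$ is the set of all $u\in L^2(\mathbb R^2\times\Sigma^2)$ that satisfy $(E_r)$. 3. For $-2\le r\le 2$, $H^r(\mathbb R^2\times\Sigma^2)$ is the set of all $u\in\mathcal S'(\mathbb R^2\times\Sigma^2)$ that satisfy $(E_r)$, and for $u\in H^r$ the expansion $u=\sum_{j,k}u_{jk}\otimes\phi_j\otimes\phi_k$ converges (weakly) in $\mathcal S'(\mathbb R^2\times\Sigma^2)$, tested on $g\otimes a$ with $g\in\mathcal S(\mathbb R^2)$ and $a\in C^\infty(\Sigma^2)$. 4. For $-2\le r\le 0$, $H^r(\mathbb R^2\times\Sigma^2)=(H^{-r}(\mathbb R^2\times\Sigma^2))'$ with respect to the $L^2$ pairing. -/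

import Mathlib

open MeasureTheory Filter Topology
open scoped Manifold ContDiff SchwartzMap ENNReal

noncomputable section

namespace EigenSobolev

/-- The plane `ℝ²` of the two time variables `(t, s)`. -/
abbrev R2 := EuclideanSpace ℝ (Fin 2)

/-- The model space of the three-dimensional manifold `Σ` (called `S` below). -/
abbrev R3 := EuclideanSpace ℝ (Fin 3)

section Smooth

variable {E : Type*} [NormedAddCommGroup E] [NormedSpace ℝ E] {H : Type*} [TopologicalSpace H]

/-- The complex vector space of smooth complex-valued functions on a manifold. -/
def smoothFunctions (I : ModelWithCorners ℝ E H) (X : Type*) [TopologicalSpace X]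
    [ChartedSpace H X] : Submodule ℂ (X → ℂ) where
  carrier := {f | ContMDiff I 𝓘(ℝ, ℂ) ∞ f}
  add_mem' hf hg := ContMDiff.add hf hg
  zero_mem' := contMDiff_const
  smul_mem' c _ hf := (contDiff_const_smul c).contMDiff.comp hf

end Smooth

/-- Nonnegative real powers of a bounded positive operator on a Hilbert space, through the
continuous functional calculus. -/
def opRpow {V : Type*} [NormedAddCommGroup V] [InnerProductSpace ℂ V] [CompleteSpace V]
    (R : V →L[ℂ] V) (α : ℝ) : V →L[ℂ] V :=
  CFC.rpow R α

/-- The graph, as a set of pairs of `L²` classes, of an operator `P` on functions with domain `D`.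
The graph of the closure of the operator is the topological closure of this set. -/
def opGraph {X : Type*} [MeasurableSpace X] (μ : Measure X) (D : Set (X → ℂ))
    (P : (X → ℂ) → X → ℂ) : Set (Lp ℂ 2 μ × Lp ℂ 2 μ) :=
  {w | ∃ f ∈ D, w.1 =ᵐ[μ] f ∧ w.2 =ᵐ[μ] P f}

section Geometry

variable {S : Type*} [TopologicalSpace S] [ChartedSpace R3 S]

/-- The matrix `h_{ab}(x) = h(∂_a, ∂_b)` of the metric in the chart `e`, at the point of `S` with
coordinates `x`. -/
def gram (h : Bundle.RiemannianMetric (fun p : S => TangentSpace (𝓡 3) p))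
    (e : OpenPartialHomeomorph S R3) (x : R3) : Matrix (Fin 3) (Fin 3) ℝ :=
  Matrix.of fun a b =>
    h.inner (e.symm x)
      (mfderiv (𝓡 3) (𝓡 3) e.symm x (EuclideanSpace.single a (1 : ℝ) : R3))
      (mfderiv (𝓡 3) (𝓡 3) e.symm x (EuclideanSpace.single b (1 : ℝ) : R3))

/-- The density `√h = √(det h_{ab})` in the chart `e`. -/
def sqrtDet (h : Bundle.RiemannianMetric (fun p : S => TangentSpace (𝓡 3) p))
    (e : OpenPartialHomeomorph S R3) (x : R3) : ℝ :=
  Real.sqrt (gram h e x).det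

/-- The metric has regularity `C^{1,1}`: in every chart its components are continuously
differentiable with locally Lipschitz first derivatives. -/
def IsC11 (h : Bundle.RiemannianMetric (fun p : S => TangentSpace (𝓡 3) p)) : Prop :=
  ∀ e ∈ atlas R3 S, ∀ a b : Fin 3,
    ContDiffOn ℝ 1 (fun x => gram h e x a b) e.target ∧
      LocallyLipschitzOn e.target (fderiv ℝ fun x => gram h e x a b)

/-- The measure `√h dx` on the domain of the chart `e`, extended by zero to `S`. -/
def chartVolume [MeasurableSpace S]
    (h : Bundle.RiemannianMetric (fun p : S => TangentSpace (𝓡 3) p))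
    (e : OpenPartialHomeomorph S R3) : Measure S :=
  ((volume.restrict e.target).withDensity fun x => ENNReal.ofReal (sqrtDet h e x)).map e.symm

/-- The Riemannian volume measure: the least measure that dominates `√h dx` on every chart domain.
Since the measures `√h dx` of different charts agree on overlaps, it is the measure that is given
by `√h dx` in every chart. -/
def vol [MeasurableSpace S]
    (h : Bundle.RiemannianMetric (fun p : S => TangentSpace (𝓡 3) p)) : Measure S :=
  ⨆ e ∈ atlas R3 S, chartVolume h e

/-- The Laplace-Beltrami operator `Δ_h f = (1/√h) ∂_a (√h h^{ab} ∂_b f)`, computed at `p` in the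
preferred chart at `p`. -/
def lapl (h : Bundle.RiemannianMetric (fun p : S => TangentSpace (𝓡 3) p))
    (f : S → ℂ) (p : S) : ℂ :=
  let e := chartAt R3 p
  ((sqrtDet h e (e p) : ℝ) : ℂ)⁻¹ *
    ∑ a : Fin 3, fderiv ℝ (fun y : R3 => ((sqrtDet h e y : ℝ) : ℂ) *
      ∑ b : Fin 3, (((gram h e y)⁻¹ a b : ℝ) : ℂ) *
        fderiv ℝ (f ∘ e.symm) y (EuclideanSpace.single b 1)) (e p) (EuclideanSpace.single a 1)

/-- The operator `Δ_{h_x} + Δ_{h_y}` on functions on `S × S`. -/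
def lapl2 (h : Bundle.RiemannianMetric (fun p : S => TangentSpace (𝓡 3) p))
    (f : S × S → ℂ) (q : S × S) : ℂ :=
  lapl h (fun x => f (x, q.2)) q.1 + lapl h (fun y => f (q.1, y)) q.2

/-- The operator `∂_tt + ∂_ss + Δ_{h_x} + Δ_{h_y}` on functions on `ℝ² × S²`, which is the
Laplace-Beltrami operator of the product metric. -/
def laplM (h : Bundle.RiemannianMetric (fun p : S => TangentSpace (𝓡 3) p))
    (f : R2 × S × S → ℂ) (p : R2 × S × S) : ℂ :=
  Laplacian.laplacian (fun z : R2 => f (z, p.2)) p.1 +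
    lapl2 h (fun q => f (p.1, q)) p.2

/-- Smooth functions on `S`. -/
abbrev smooth1 (S : Type*) [TopologicalSpace S] [ChartedSpace R3 S] : Submodule ℂ (S → ℂ) :=
  smoothFunctions (𝓡 3) S

/-- Smooth functions on `S × S`. -/
abbrev smooth2 (S : Type*) [TopologicalSpace S] [ChartedSpace R3 S] : Submodule ℂ (S × S → ℂ) :=
  smoothFunctions ((𝓡 3).prod (𝓡 3)) (S × S)

/-- The space `C_c^∞(ℝ² × S²)`. -/
def testM (S : Type*) [TopologicalSpace S] [ChartedSpace R3 S] : Set (R2 × S × S → ℂ) :=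
  {f | f ∈ smoothFunctions ((𝓡 2).prod ((𝓡 3).prod (𝓡 3))) (R2 × S × S) ∧ HasCompactSupport f}

/-- The space `𝓢'(ℝ² × S²)`, the dual of the completed projective tensor product of `𝓢(ℝ²)` and
`C^∞(S²)`. By the universal property of the projective tensor product, its elements are the jointly
continuous bilinear forms on `𝓢(ℝ²) × C^∞(S²)`, where `𝓢(ℝ²)` carries the Schwartz topology
and `C^∞(S²)` the topology of uniform convergence of all derivatives in charts, on compact
subsets of the chart domains. -/
structure TemperedM (S : Type*) [TopologicalSpace S] [ChartedSpace R3 S] where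
  /-- The bilinear form, `(g, a) ↦ ⟨u, g ⊗ a⟩`. -/
  form : 𝓢(R2, ℂ) →ₗ[ℂ] smooth2 S →ₗ[ℂ] ℂ
  /-- Continuity: the form is bounded by a product of continuous seminorms. -/
  bound : ∃ (N : ℕ) (C : ℝ) (F : Finset (S × S)) (K : S × S → Set (R3 × R3)),
    (∀ q ∈ F, IsCompact (K q) ∧ K q ⊆ (extChartAt ((𝓡 3).prod (𝓡 3)) q).target) ∧
    ∀ (g : 𝓢(R2, ℂ)) (a : smooth2 S) (B : ℝ), 0 ≤ B →
      (∀ q ∈ F, ∀ k ≤ N, ∀ y ∈ K q,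
        ‖iteratedFDeriv ℝ k (a.1 ∘ (extChartAt ((𝓡 3).prod (𝓡 3)) q).symm) y‖ ≤ B) →
      ‖form g a‖ ≤
        C * ((Finset.Iic (N, N)).sup (schwartzSeminormFamily ℂ R2 ℂ)) g * B

variable [MeasurableSpace S]

/-- The measure `√h(x) √h(y) dx dy` on `S × S`. -/
abbrev vol2 (h : Bundle.RiemannianMetric (fun p : S => TangentSpace (𝓡 3) p)) :
    Measure (S × S) :=
  (vol h).prod (vol h)

/-- The measure `√h(x) √h(y) dt ds dx dy` on `ℝ² × S²`. -/
abbrev volM (h : Bundle.RiemannianMetric (fun p : S => TangentSpace (𝓡 3) p)) :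
    Measure (R2 × S × S) :=
  (volume : Measure R2).prod (vol2 h)

/-- The pairing `∫ f · (g ⊗ a)` of a function on `ℝ² × S²` with `g ⊗ a`. -/
def pairM (h : Bundle.RiemannianMetric (fun p : S => TangentSpace (𝓡 3) p))
    (f : R2 × S × S → ℂ) (g : 𝓢(R2, ℂ)) (a : smooth2 S) : ℂ :=
  ∫ p, f p * (g p.1 * a.1 p.2) ∂(volM h)

/-- The graph of the closure of `cI - Δ_h`, with domain `C^∞(S)`, in `L²(S)`. This closure is the
self-adjoint operator denoted by `cI - Δ_h`. -/
def schrodingerGraph (h : Bundle.RiemannianMetric (fun p : S => TangentSpace (𝓡 3) p)) (c : ℝ) :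
    Set (Lp ℂ 2 (vol h) × Lp ℂ 2 (vol h)) :=
  closure (opGraph (vol h) (smooth1 S : Set (S → ℂ)) fun f p => (c : ℂ) * f p - lapl h f p)

/-- The bounded operator `R` on `L²(ℝ² × S²)` is the inverse of the closure of `I - Δ`, with
domain `C_c^∞`, where `Δ` is the Laplace-Beltrami operator of `ℝ² × S²`. -/
def IsInverse (h : Bundle.RiemannianMetric (fun p : S => TangentSpace (𝓡 3) p))
    (R : Lp ℂ 2 (volM h) →L[ℂ] Lp ℂ 2 (volM h)) : Prop :=
  ∀ w v : Lp ℂ 2 (volM h),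
    (w, v) ∈ closure (opGraph (volM h) (testM S) fun f p => f p - laplM h f p) ↔ R v = w

/-- `w` lies in the domain of `(I - Δ)^α` and `v = (I - Δ)^α w`. Negative powers are the powers
of the bounded positive operator `R = (I - Δ)⁻¹`, and `(I - Δ)^α`
is the inverse of `R^α` for `0 ≤ α`. -/
def IsFracPow (h : Bundle.RiemannianMetric (fun p : S => TangentSpace (𝓡 3) p)) (α : ℝ)
    (w v : Lp ℂ 2 (volM h)) : Prop :=
  ∃ R : Lp ℂ 2 (volM h) →L[ℂ] Lp ℂ 2 (volM h), IsInverse h R ∧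
    ((0 ≤ α ∧ opRpow R α v = w) ∨ (α < 0 ∧ opRpow R (-α) w = v))

/-- `u ∈ H^s(ℝ² × S²)`. The space is the completion of `C_c^∞` in the norm
`‖(I - Δ)^{s/2} f‖_{L²}`, realised in `𝓢'(ℝ² × S²)`: its elements are the limits in `𝓢'` of
sequences in `C_c^∞` that are Cauchy for this norm. -/
def MemH (h : Bundle.RiemannianMetric (fun p : S => TangentSpace (𝓡 3) p)) (s : ℝ)
    (u : TemperedM S) : Prop :=
  ∃ (f : ℕ → R2 × S × S → ℂ) (w v : ℕ → Lp ℂ 2 (volM h)),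
    (∀ n, f n ∈ testM S ∧ w n =ᵐ[volM h] f n ∧ IsFracPow h (s / 2) (w n) (v n)) ∧
    CauchySeq v ∧
    ∀ (g : 𝓢(R2, ℂ)) (a : smooth2 S),
      Tendsto (fun n => pairM h (f n) g a) atTop (𝓝 (u.form g a))

/-- `u ∈ (H^r(ℝ² × S²))'` for `0 ≤ r`. The operator `(I - Δ)^{r/2}` identifies `H^r`
isometrically with `L²`, so that the bounded functionals on `H^r` are
`w ↦ L ((I - Δ)^{r/2} w)` with `L` bounded on `L²`; such a functional is an element of `𝓢'` through
its values at `g ⊗ a`. -/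
def MemDualH (h : Bundle.RiemannianMetric (fun p : S => TangentSpace (𝓡 3) p)) (r : ℝ)
    (u : TemperedM S) : Prop :=
  ∃ L : Lp ℂ 2 (volM h) →L[ℂ] ℂ, ∀ (g : 𝓢(R2, ℂ)) (a : smooth2 S),
    ∃ w v : Lp ℂ 2 (volM h), (w =ᵐ[volM h] fun p => g p.1 * a.1 p.2) ∧
      IsFracPow h (r / 2) w v ∧ u.form g a = L v

/-- The tempered distribution `c = ⟨u, b⟩` on `ℝ²` is the pairing of `u` with the
function `b ∈ H²(S²)` in the variables `(x, y)`: for each `g ∈ 𝓢(ℝ²)`, the number `c g` is the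
limit of `⟨u, g ⊗ aₙ⟩` along every sequence of smooth functions `aₙ` on `S²` that converges to `b`
in the graph norm of the Laplacian on `S²`. Here `b` need not be smooth, since the
metric is not. -/
def IsPairing (h : Bundle.RiemannianMetric (fun p : S => TangentSpace (𝓡 3) p))
    (u : TemperedM S) (b : S × S → ℂ) (c : 𝓢'(R2, ℂ)) : Prop :=
  ∀ (a : ℕ → smooth2 S) (b' : S × S → ℂ), MemLp b' 2 (vol2 h) →
    Tendsto (fun n => eLpNorm (fun q => (a n).1 q - b q) 2 (vol2 h)) atTop (𝓝 0) →
    Tendsto (fun n => eLpNorm (fun q => lapl2 h (a n).1 q - b' q) 2 (vol2 h)) atTop (𝓝 0) →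
    ∀ g : 𝓢(R2, ℂ), Tendsto (fun n => u.form g (a n)) atTop (𝓝 (c g))

end Geometry

/-- The Fourier transform `(𝓕c)(ξ) = (2π)⁻¹ ∫ e^{-i z·ξ} c(z) dz` of the tempered distribution
`c` on `ℝ²` is the regular distribution given by the function `G`:
`⟨c, 𝓕g⟩ = ∫ G g` for all Schwartz functions `g`. -/
def IsFourier (c : 𝓢'(R2, ℂ)) (G : R2 → ℂ) : Prop :=
  LocallyIntegrable G ∧
    ∀ g k : 𝓢(R2, ℂ),
      (∀ x : R2, k x = (2 * (Real.pi : ℂ))⁻¹ *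
        ∫ ξ : R2, Complex.exp (-(Complex.I * ((inner ℝ x ξ : ℝ) : ℂ))) * g ξ) →
      Integrable (fun ξ => G ξ * g ξ) ∧ c k = ∫ ξ, G ξ * g ξ

/-- Finiteness of `∑_{j,k} ∫ (ξ₀² + η₀² + λ_j² + λ_k²)^s |𝓕u_{jk}(ξ₀, η₀)|² dξ₀ dη₀`, where
the Fourier transforms of the `u_{jk}` are regular distributions. -/
def FiniteEnergy (lam : ℕ → ℝ) (s : ℝ) (c : ℕ → ℕ → 𝓢'(R2, ℂ)) : Prop :=
  ∃ G : ℕ → ℕ → R2 → ℂ, (∀ j k, IsFourier (c j k) (G j k)) ∧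
    ∑' jk : ℕ × ℕ, ∫⁻ ξ : R2, ENNReal.ofReal
      ((ξ 0 ^ 2 + ξ 1 ^ 2 + lam jk.1 ^ 2 + lam jk.2 ^ 2) ^ s * ‖G jk.1 jk.2 ξ‖ ^ 2) < ⊤

end EigenSobolev

end

/-! Put `W(ξ, jk) = 1 + ν_jk + (2π)²|ξ|²` with `ν_jk = λ_j² + λ_k² - 2m ≥ 0`. The products `φ_j ⊗
φ_k` form an orthonormal basis of `L²(Σ²)` made of real eigenfunctions of the closure of `Δ_{h_x} +
Δ_{h_y}`, with eigenvalues `-ν_jk` (`isEigenBasis_prodBasis`). Fourier transform in the plane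
together with expansion in this basis is a unitary map `spT` from `L²(ℝ² × Σ²)` onto `L²` of
Lebesgue times counting measure. It turns `I - Δ` into multiplication by `W`, and so `H^r` into a
weighted `L²` space; this is why the theorem holds.

That the closure from test functions is the whole multiplication operator is an essential
self-adjointness statement, `isInverse_iff`. One inclusion is integration by parts, coefficient by
coefficient (`spT_sub_laplM`). The eigenfunctions need not be smooth, so this rests on Green's
identity for smooth functions (`integral_lapl_mul`), carried over to closures. The other inclusion
is density of the range: an `L²` function on the plane that annihilates `(1 + ν - Δ)g` for all
compactly supported smooth `g` is zero (`eq_zero_of_integral_mul_helm`). Polynomial approximation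
then identifies `(I - Δ)^α` with `W^α` (`isFracPow_iff`).

The centre of the proof is `memH_iff`: for `-2 ≤ r ≤ 2`, `u` lies in `H^r` exactly if some `y` in
`L²` on the spectral side satisfies `⟨u, g ⊗ a⟩ = ∑ ∫ y_jk W^{-r/2} (𝓕⁻¹g) a_jk`. The bound `r ≤ 2`
makes `(I - Δ)^{r/2} C_c^∞` dense, since `(I - Δ)^{r/2} f` is the bounded operator `(I - Δ)^{r/2 -
1}` applied to `(I - Δ)f`. The bound `-2 ≤ r` makes the integral converge: a smooth `a` has its
Laplacian in `L²`, so the transform of `g ⊗ a` can absorb one factor `W` (`dgam_ae`).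

The claims can now be read off. Up to the normalisation of frequencies, `u_jk` has Fourier transform
`W^{-r/2} y_jk`, and `‖y‖²` is the sum in `(E_r)` with weight `W^r`. The two weights come from
symbols that differ by the constant `1 - 2m` and are comparable because `m > 0` (`energy_shift`).
Conversely, a distribution whose coefficients have finite energy agrees with the one built from the
corresponding `y`: the difference vanishes on the basis and is continuous in the graph norm of the
Laplacian, in which the eigenfunction expansion of a smooth function converges
(`eq_zero_of_closable`). Duality is the Riesz theorem on the spectral side. -/

noncomputable section

namespace EigenSobolev

set_option linter.unusedSectionVars false

/-! ### The metric under changes of coordinates -/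

section Charts

variable {S : Type*} [TopologicalSpace S] [ChartedSpace R3 S]

/-- The change of coordinates from the chart `e` to the chart `e'`. -/
def coordChange (e e' : OpenPartialHomeomorph S R3) (x : R3) : R3 := e' (e.symm x)

/-- The Jacobian matrix of the change of coordinates. -/
def jac (e e' : OpenPartialHomeomorph S R3) (x : R3) : Matrix (Fin 3) (Fin 3) ℝ :=
  Matrix.of fun c a => (fderiv ℝ (coordChange e e') x (EuclideanSpace.single a 1)) c

lemma single_sum (v : R3) : v = ∑ c : Fin 3, v c • (EuclideanSpace.single c (1 : ℝ) : R3) := by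
  ext i
  simp [Finset.sum_apply, Pi.single_apply]

omit [ChartedSpace R3 S] in
lemma jac_det (e e' : OpenPartialHomeomorph S R3) (x : R3) :
    (jac e e' x).det = (fderiv ℝ (coordChange e e') x).det := by
  have : jac e e' x = LinearMap.toMatrix (EuclideanSpace.basisFun (Fin 3) ℝ).toBasis
      (EuclideanSpace.basisFun (Fin 3) ℝ).toBasis (fderiv ℝ (coordChange e e') x : R3 →ₗ[ℝ] R3) := by
    ext c a
    simp [jac, LinearMap.toMatrix_apply]
  rw [this, LinearMap.det_toMatrix]

/-- The derivative of the inverse of the chart `e`, whose values on the standard basis are the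
coordinate vector fields. -/
def frame (e : OpenPartialHomeomorph S R3) (x : R3) : R3 →L[ℝ] R3 :=
  mfderiv (𝓡 3) (𝓡 3) e.symm x

/-- The metric at `p`, as a bilinear form on the model space. -/
def met (h : Bundle.RiemannianMetric (fun p : S => TangentSpace (𝓡 3) p)) (p : S) :
    R3 →L[ℝ] R3 →L[ℝ] ℝ := h.inner p

lemma gram_apply (h : Bundle.RiemannianMetric (fun p : S => TangentSpace (𝓡 3) p))
    (e : OpenPartialHomeomorph S R3) (x : R3) (a b : Fin 3) :
    gram h e x a b = met h (e.symm x) (frame e x (EuclideanSpace.single a 1))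
      (frame e x (EuclideanSpace.single b 1)) := rfl

variable [IsManifold (𝓡 3) ∞ S] {e e' : OpenPartialHomeomorph S R3}

lemma contMDiffAt_chart_symm (he : e ∈ atlas R3 S) {x : R3} (hx : x ∈ e.target) :
    ContMDiffAt (𝓡 3) (𝓡 3) ∞ e.symm x :=
  (contMDiffOn_symm_of_mem_maximalAtlas (IsManifold.subset_maximalAtlas he)).contMDiffAt
    (e.open_target.mem_nhds hx)

lemma contMDiffAt_chart (he : e ∈ atlas R3 S) {p : S} (hp : p ∈ e.source) :
    ContMDiffAt (𝓡 3) (𝓡 3) ∞ e p :=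
  (contMDiffOn_of_mem_maximalAtlas (IsManifold.subset_maximalAtlas he)).contMDiffAt
    (e.open_source.mem_nhds hp)

lemma contDiffAt_coordChange (he : e ∈ atlas R3 S) (he' : e' ∈ atlas R3 S) {x : R3}
    (hx : x ∈ e.target) (hx' : e.symm x ∈ e'.source) :
    ContDiffAt ℝ ∞ (coordChange e e') x :=
  contMDiffAt_iff_contDiffAt.1 ((contMDiffAt_chart he' hx').comp x (contMDiffAt_chart_symm he hx))

omit [ChartedSpace R3 S] [IsManifold (𝓡 3) ∞ S] in
lemma eventually_symm_mem_source {x : R3} (hx : x ∈ e.target) (hx' : e.symm x ∈ e'.source) :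
    ∀ᶠ y in 𝓝 x, y ∈ e.target ∧ e.symm y ∈ e'.source :=
  (e.open_target.mem_nhds hx |> fun h => Filter.eventually_of_mem h fun _ h => h).and
    ((e.symm.continuousAt hx).eventually (e'.open_source.mem_nhds hx'))

lemma frame_coordChange (he : e ∈ atlas R3 S) (he' : e' ∈ atlas R3 S) {x : R3}
    (hx : x ∈ e.target) (hx' : e.symm x ∈ e'.source) :
    frame e x = (frame e' (coordChange e e' x)).comp (fderiv ℝ (coordChange e e') x) := by
  have h1 : (e.symm : R3 → S) =ᶠ[𝓝 x] e'.symm ∘ coordChange e e' := by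
    filter_upwards [eventually_symm_mem_source hx hx'] with y hy
    simp [coordChange, e'.left_inv hy.2]
  have h2 : frame e x = mfderiv (𝓡 3) (𝓡 3) (e'.symm ∘ coordChange e e') x := h1.mfderiv_eq
  have h3 : fderiv ℝ (coordChange e e') x = mfderiv (𝓡 3) (𝓡 3) (coordChange e e') x :=
    mfderiv_eq_fderiv.symm
  rw [h2, h3]
  exact mfderiv_comp x ((contMDiffAt_chart_symm he' (e'.map_source hx')).mdifferentiableAt
      (by simp)) ((contDiffAt_coordChange he he' hx hx').contMDiffAt.mdifferentiableAt (by simp))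

lemma frame_injective (he : e ∈ atlas R3 S) {x : R3} (hx : x ∈ e.target) :
    Function.Injective (frame e x) := by
  have h1 : (e ∘ e.symm : R3 → R3) =ᶠ[𝓝 x] id := by
    filter_upwards [e.open_target.mem_nhds hx] with y hy using e.right_inv hy
  have h2 : (mfderiv (𝓡 3) (𝓡 3) (e ∘ e.symm) x : R3 →L[ℝ] R3) =
      (mfderiv (𝓡 3) (𝓡 3) e (e.symm x) : R3 →L[ℝ] R3).comp (frame e x) :=
    mfderiv_comp (I := 𝓡 3) (I' := 𝓡 3) (I'' := 𝓡 3) x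
    ((contMDiffAt_chart he (e.map_target hx)).mdifferentiableAt
      (by simp)) ((contMDiffAt_chart_symm he hx).mdifferentiableAt (by simp))
  have h3 : (mfderiv (𝓡 3) (𝓡 3) (e ∘ e.symm) x : R3 →L[ℝ] R3) = ContinuousLinearMap.id ℝ R3 :=
    h1.mfderiv_eq.trans mfderiv_id
  rw [h3] at h2
  intro v w hvw
  have hv : v = (mfderiv (𝓡 3) (𝓡 3) e (e.symm x) : R3 →L[ℝ] R3) (frame e x v) :=
    DFunLike.congr_fun h2 v
  have hw : w = (mfderiv (𝓡 3) (𝓡 3) e (e.symm x) : R3 →L[ℝ] R3) (frame e x w) :=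
    DFunLike.congr_fun h2 w
  exact hv.trans ((congrArg _ hvw).trans hw.symm)

/-- There is one bilinear form on each tangent space, and the coordinate frames of the two charts
differ by the Jacobian matrix. -/
lemma gram_coordChange (h : Bundle.RiemannianMetric (fun p : S => TangentSpace (𝓡 3) p))
    (he : e ∈ atlas R3 S) (he' : e' ∈ atlas R3 S) {x : R3}
    (hx : x ∈ e.target) (hx' : e.symm x ∈ e'.source) :
    gram h e x = (jac e e' x).transpose * gram h e' (coordChange e e' x) * jac e e' x := by
  have hp : e'.symm (coordChange e e' x) = e.symm x := e'.left_inv hx'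
  ext a b
  rw [gram_apply, frame_coordChange he he' hx hx']
  simp only [Matrix.mul_apply, gram_apply, Matrix.transpose_apply, hp,
    ContinuousLinearMap.comp_apply]
  have hva : ∀ a, (fderiv ℝ (coordChange e e') x (EuclideanSpace.single a 1)) =
      ∑ c : Fin 3, jac e e' x c a • (EuclideanSpace.single c (1 : ℝ) : R3) :=
    fun a => single_sum _
  rw [hva a, hva b]
  simp only [map_sum, map_smul, _root_.sum_apply, _root_.smul_apply,
    smul_eq_mul, Finset.sum_mul, Finset.mul_sum]
  refine Finset.sum_congr rfl fun d _ => Finset.sum_congr rfl fun c _ => ?_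
  ring

omit [IsManifold (𝓡 3) ∞ S] in
lemma gram_isSymm (h : Bundle.RiemannianMetric (fun p : S => TangentSpace (𝓡 3) p))
    (e : OpenPartialHomeomorph S R3) (x : R3) : (gram h e x).IsSymm := by
  ext a b
  exact h.symm _ _ _

/-- The metric is positive on nonzero vectors, and the coordinate frame is injective because `e ∘
e.symm` is locally the identity. -/
lemma gram_posDef (h : Bundle.RiemannianMetric (fun p : S => TangentSpace (𝓡 3) p))
    (he : e ∈ atlas R3 S) {x : R3} (hx : x ∈ e.target) : (gram h e x).PosDef := by
  refine Matrix.PosDef.of_dotProduct_mulVec_pos ?_ ?_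
  · rw [Matrix.IsHermitian, Matrix.conjTranspose_eq_transpose_of_trivial]
    exact gram_isSymm h e x
  · intro v hv
    have h1 : star v ⬝ᵥ (gram h e x).mulVec v =
        met h (e.symm x) (frame e x (WithLp.toLp 2 v)) (frame e x (WithLp.toLp 2 v)) := by
      conv_rhs => rw [single_sum (WithLp.toLp 2 v)]
      simp only [map_sum, map_smul, _root_.sum_apply, _root_.smul_apply,
        smul_eq_mul, dotProduct, Matrix.mulVec, gram_apply, star_trivial, Finset.mul_sum]
      rw [Finset.sum_comm]
      refine Finset.sum_congr rfl fun d _ => Finset.sum_congr rfl fun c _ => ?_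
      ring
    rw [h1]
    refine h.pos (e.symm x) (frame e x (WithLp.toLp 2 v)) fun h0 => hv ?_
    have h2 : frame e x (WithLp.toLp 2 v) = frame e x 0 := by rw [map_zero]; exact h0
    have := frame_injective he hx h2
    simpa using congrArg (WithLp.ofLp) this

lemma gram_det_pos (h : Bundle.RiemannianMetric (fun p : S => TangentSpace (𝓡 3) p))
    (he : e ∈ atlas R3 S) {x : R3} (hx : x ∈ e.target) : 0 < (gram h e x).det :=
  (gram_posDef h he hx).det_pos

lemma sqrtDet_pos (h : Bundle.RiemannianMetric (fun p : S => TangentSpace (𝓡 3) p))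
    (he : e ∈ atlas R3 S) {x : R3} (hx : x ∈ e.target) : 0 < sqrtDet h e x :=
  Real.sqrt_pos.2 (gram_det_pos h he hx)

/-- Determinants of the congruence between Gram matrices. The factor is the one in the change of
variables formula, which is why chart volumes agree on overlaps. -/
lemma sqrtDet_coordChange (h : Bundle.RiemannianMetric (fun p : S => TangentSpace (𝓡 3) p))
    (he : e ∈ atlas R3 S) (he' : e' ∈ atlas R3 S) {x : R3}
    (hx : x ∈ e.target) (hx' : e.symm x ∈ e'.source) :
    sqrtDet h e x =
      |(fderiv ℝ (coordChange e e') x).det| * sqrtDet h e' (coordChange e e' x) := by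
  rw [sqrtDet, gram_coordChange h he he' hx hx', Matrix.det_mul, Matrix.det_mul,
    Matrix.det_transpose, jac_det, sqrtDet, ← Real.sqrt_sq_eq_abs,
    ← Real.sqrt_mul (sq_nonneg _)]
  ring_nf

omit [IsManifold (𝓡 3) ∞ S] in
lemma contDiffOn_gram {h : Bundle.RiemannianMetric (fun p : S => TangentSpace (𝓡 3) p)}
    (hh : IsC11 h) (he : e ∈ atlas R3 S) (a b : Fin 3) :
    ContDiffOn ℝ 1 (fun x => gram h e x a b) e.target := (hh e he a b).1

omit [IsManifold (𝓡 3) ∞ S] in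
lemma contDiffOn_gram_det {h : Bundle.RiemannianMetric (fun p : S => TangentSpace (𝓡 3) p)}
    (hh : IsC11 h) (he : e ∈ atlas R3 S) :
    ContDiffOn ℝ 1 (fun x => (gram h e x).det) e.target := by
  simp only [Matrix.det_fin_three]
  have := fun a b => contDiffOn_gram hh he a b
  fun_prop

lemma contDiffOn_sqrtDet {h : Bundle.RiemannianMetric (fun p : S => TangentSpace (𝓡 3) p)}
    (hh : IsC11 h) (he : e ∈ atlas R3 S) :
    ContDiffOn ℝ 1 (sqrtDet h e) e.target :=
  (contDiffOn_gram_det hh he).sqrt fun _ hx => (gram_det_pos h he hx).ne'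

lemma contDiffOn_gram_inv {h : Bundle.RiemannianMetric (fun p : S => TangentSpace (𝓡 3) p)}
    (hh : IsC11 h) (he : e ∈ atlas R3 S) (a b : Fin 3) :
    ContDiffOn ℝ 1 (fun x => (gram h e x)⁻¹ a b) e.target := by
  -- Cramer's rule: the entries of the inverse are polynomials in the `C¹` entries, divided by the
  -- positive determinant.
  have h1 : ∀ x, (gram h e x)⁻¹ a b = (gram h e x).det⁻¹ * (gram h e x).adjugate a b := by
    intro x
    rw [Matrix.inv_def, Ring.inverse_eq_inv']
    rfl
  simp only [h1]
  refine ((contDiffOn_gram_det hh he).inv fun x hx => (gram_det_pos h he hx).ne').mul ?_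
  have := fun a b => contDiffOn_gram hh he a b
  fin_cases a <;> fin_cases b <;> simp only [Matrix.adjugate_fin_three] <;>
    simp <;> fun_prop

end Charts

/-! ### The Riemannian volume in charts -/

section Volume

variable {S : Type*} [TopologicalSpace S] [ChartedSpace R3 S] [IsManifold (𝓡 3) ∞ S]
  [MeasurableSpace S] [BorelSpace S]
  {h : Bundle.RiemannianMetric (fun p : S => TangentSpace (𝓡 3) p)}
  {e e' : OpenPartialHomeomorph S R3}

omit [ChartedSpace R3 S] [IsManifold (𝓡 3) ∞ S] in
lemma measurableSet_target_inter (e : OpenPartialHomeomorph S R3) {B : Set S}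
    (hB : MeasurableSet B) : MeasurableSet (e.target ∩ e.symm ⁻¹' B) := by
  have h1 : Measurable (e.target.domRestrict e.symm) :=
    (continuousOn_iff_continuous_domRestrict.1 e.continuousOn_symm).measurable
  have := e.open_target.measurableSet.subtype_image (h1 hB)
  convert this using 1
  ext x
  simp [and_comm]

omit [ChartedSpace R3 S] [IsManifold (𝓡 3) ∞ S] in
lemma aemeasurable_symm (e : OpenPartialHomeomorph S R3) (ρ : R3 → ℝ≥0∞) :
    AEMeasurable e.symm ((volume.restrict e.target).withDensity ρ) := by
  exact (e.continuousOn_symm.aemeasurable e.open_target.measurableSet).mono_ac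
    (withDensity_absolutelyContinuous _ _)

omit [MeasurableSpace S] [BorelSpace S] in
lemma aemeasurable_sqrtDet (hh : IsC11 h) (he : e ∈ atlas R3 S) :
    AEMeasurable (fun x => ENNReal.ofReal (sqrtDet h e x)) (volume.restrict e.target) :=
  ((contDiffOn_sqrtDet hh he).continuousOn.aemeasurable
    e.open_target.measurableSet).ennreal_ofReal

omit [IsManifold (𝓡 3) ∞ S] in
-- Nothing is known about `e.symm` outside the target, but the measure has no mass there.
lemma chartVolume_apply (h : Bundle.RiemannianMetric (fun p : S => TangentSpace (𝓡 3) p))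
    (e : OpenPartialHomeomorph S R3) {B : Set S} (hB : MeasurableSet B) :
    chartVolume h e B =
      ∫⁻ x in e.target ∩ e.symm ⁻¹' B, ENNReal.ofReal (sqrtDet h e x) := by
  rw [chartVolume, Measure.map_apply_of_aemeasurable (aemeasurable_symm e _) hB]
  have : (volume.restrict e.target).withDensity (fun x => ENNReal.ofReal (sqrtDet h e x))
      (e.symm ⁻¹' B) = (volume.restrict e.target).withDensity
      (fun x => ENNReal.ofReal (sqrtDet h e x)) (e.target ∩ e.symm ⁻¹' B) := by
    refine measure_congr ?_
    have : ∀ᵐ x ∂((volume.restrict e.target).withDensity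
      (fun x => ENNReal.ofReal (sqrtDet h e x))), x ∈ e.target :=
      (withDensity_absolutelyContinuous _ _).ae_le (ae_restrict_mem e.open_target.measurableSet)
    filter_upwards [this] with x hx
    exact propext ⟨fun hxB => ⟨hx, hxB⟩, fun hxB => hxB.2⟩
  rw [this, withDensity_apply _ (measurableSet_target_inter e hB),
    Measure.restrict_restrict (measurableSet_target_inter e hB)]
  congr 2
  ext x
  simp +contextual

/-- Change of variables along the transition map; its Jacobian is the quotient of the two densities.
-/
lemma chartVolume_coordChange (h : Bundle.RiemannianMetric (fun p : S => TangentSpace (𝓡 3) p))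
    (he : e ∈ atlas R3 S) (he' : e' ∈ atlas R3 S) {B : Set S} (hB : MeasurableSet B)
    (h1 : B ⊆ e.source) (h2 : B ⊆ e'.source) : chartVolume h e B = chartVolume h e' B := by
  rw [chartVolume_apply h e hB, chartVolume_apply h e' hB]
  have himg : e'.target ∩ e'.symm ⁻¹' B = coordChange e e' '' (e.target ∩ e.symm ⁻¹' B) := by
    ext y
    constructor
    · rintro ⟨hy, hyB⟩
      refine ⟨e (e'.symm y), ⟨e.map_source (h1 hyB), ?_⟩, ?_⟩
      · simpa [e.left_inv (h1 hyB)] using hyB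
      · simp [coordChange, e.left_inv (h1 hyB), e'.right_inv hy]
    · rintro ⟨x, ⟨hx, hxB⟩, rfl⟩
      refine ⟨e'.map_source (h2 hxB), ?_⟩
      simpa [coordChange, e'.left_inv (h2 hxB)] using hxB
  rw [himg, lintegral_image_eq_lintegral_abs_det_fderiv_mul volume
    (measurableSet_target_inter e hB)
    (f' := fun x => fderiv ℝ (coordChange e e') x)]
  · refine setLIntegral_congr_fun (measurableSet_target_inter e hB) fun x hx => ?_
    rw [sqrtDet_coordChange h he he' hx.1 (h2 hx.2), ENNReal.ofReal_mul (abs_nonneg _)]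
  · intro x hx
    exact ((contDiffAt_coordChange he he' hx.1 (h2 hx.2)).differentiableAt
      (by simp)).hasFDerivAt.hasFDerivWithinAt
  · intro x hx y hy hxy
    have := congrArg e'.symm hxy
    simp only [coordChange, e'.left_inv (h2 hx.2), e'.left_inv (h2 hy.2)] at this
    exact e.symm.injOn hx.1 hy.1 this

omit [IsManifold (𝓡 3) ∞ S] in
lemma chartVolume_compl_source (h : Bundle.RiemannianMetric (fun p : S => TangentSpace (𝓡 3) p))
    (e : OpenPartialHomeomorph S R3) : chartVolume h e e.sourceᶜ = 0 := by
  rw [chartVolume_apply h e e.open_source.measurableSet.compl]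
  have : e.target ∩ e.symm ⁻¹' e.sourceᶜ = ∅ := by
    ext x
    simp only [Set.mem_inter_iff, Set.mem_preimage, Set.mem_compl_iff, Set.mem_empty_iff_false,
      iff_false, not_and, not_not]
    exact fun hx => e.map_target hx
  rw [this, Measure.restrict_empty, lintegral_zero_measure]

/-- In every chart the Riemannian volume is `√h dx`. -/
lemma vol_apply [CompactSpace S] (h : Bundle.RiemannianMetric (fun p : S => TangentSpace (𝓡 3) p))
    (he : e ∈ atlas R3 S) {B : Set S} (hB : MeasurableSet B) (hBe : B ⊆ e.source) :
    vol h B = chartVolume h e B := by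
  classical
  obtain ⟨T, hT⟩ := isCompact_univ.elim_finite_subcover (fun p : S => (chartAt R3 p).source)
    (fun p => (chartAt R3 p).open_source) fun p _ => Set.mem_iUnion.2 ⟨p, mem_chart_source R3 p⟩
  let n := T.card
  let E : Fin n → OpenPartialHomeomorph S R3 := fun i => chartAt R3 (T.equivFin.symm i : S)
  have hE : ∀ i, E i ∈ atlas R3 S := fun i => chart_mem_atlas _ _
  have hcov : ∀ p, ∃ i, p ∈ (E i).source := by
    intro p
    obtain ⟨q, hq, hp⟩ := Set.mem_iUnion₂.1 (hT (Set.mem_univ p))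
    exact ⟨T.equivFin ⟨q, hq⟩, by simpa [E] using hp⟩
  let D : Fin n → Set S := disjointed fun i => (E i).source
  have hD : ∀ i, MeasurableSet (D i) := fun i => by
    simp only [D, disjointed_apply, Finset.sup_eq_iSup, Set.iSup_eq_iUnion]
    exact (E i).open_source.measurableSet.diff (MeasurableSet.iUnion fun j =>
      MeasurableSet.iUnion fun _ => (E j).open_source.measurableSet)
  have hDE : ∀ i, D i ⊆ (E i).source := fun i => disjointed_subset _ i
  have hDd : Pairwise (Function.onFun Disjoint D) := disjoint_disjointed _
  have hDU : ⋃ i, D i = Set.univ := by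
    rw [show (⋃ i, D i) = ⋃ i, (E i).source from iUnion_disjointed]
    exact Set.eq_univ_of_forall fun p => Set.mem_iUnion.2 (hcov p)
  -- A supremum of measures is not computed set by set. Cutting a finite cover by charts into
  -- disjoint pieces gives an explicit measure, which is compared with `vol` in both directions.
  let μ : Measure S := ∑ i, (chartVolume h (E i)).restrict (D i)
  have hμ : ∀ {e : OpenPartialHomeomorph S R3}, e ∈ atlas R3 S → ∀ {B : Set S},
      MeasurableSet B → B ⊆ e.source → μ B = chartVolume h e B := by
    intro e he B hB hBe
    have : chartVolume h e B = ∑ i, chartVolume h e (B ∩ D i) := by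
      rw [← tsum_fintype (L := .unconditional _), ← measure_iUnion
        (fun i j hij => (hDd hij).mono Set.inter_subset_right Set.inter_subset_right)
        (fun i => hB.inter (hD i)), ← Set.inter_iUnion, hDU, Set.inter_univ]
    rw [this]
    simp only [μ, Measure.finsetSum_apply, Measure.restrict_apply hB]
    refine Finset.sum_congr rfl fun i _ => ?_
    exact chartVolume_coordChange h (hE i) he (hB.inter (hD i))
      (Set.inter_subset_right.trans (hDE i)) (Set.inter_subset_left.trans hBe)
  have hvol : vol h = μ := by
    refine le_antisymm ?_ ?_
    · refine iSup₂_le fun e he => Measure.le_iff.2 fun B hB => ?_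
      have h1 : chartVolume h e B = chartVolume h e (B ∩ e.source) := by
        rw [← measure_inter_add_sdiff B e.open_source.measurableSet]
        have : chartVolume h e (B \ e.source) = 0 :=
          measure_mono_null (fun x hx => hx.2) (chartVolume_compl_source h e)
        rw [this, add_zero]
      rw [h1, ← hμ he (hB.inter e.open_source.measurableSet) Set.inter_subset_right]
      exact measure_mono Set.inter_subset_left
    · refine Measure.le_iff.2 fun B hB => ?_
      have h2 : vol h B = ∑ i, vol h (B ∩ D i) := by
        rw [← tsum_fintype (L := .unconditional _), ← measure_iUnion
          (fun i j hij => (hDd hij).mono Set.inter_subset_right Set.inter_subset_right)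
          (fun i => hB.inter (hD i)), ← Set.inter_iUnion, hDU, Set.inter_univ]
      rw [h2]
      simp only [μ, Measure.finsetSum_apply, Measure.restrict_apply hB]
      refine Finset.sum_le_sum fun i _ => ?_
      exact (le_iSup₂ (f := fun e (_ : e ∈ atlas R3 S) => chartVolume h e) (E i) (hE i)) _
  rw [hvol, hμ he hB hBe]

end Volume

/-! ### Finiteness and full support of the volume -/

section VolumeProperties

variable {S : Type*} [TopologicalSpace S] [ChartedSpace R3 S] [IsManifold (𝓡 3) ∞ S]
  [MeasurableSpace S] [BorelSpace S] [CompactSpace S]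
  {h : Bundle.RiemannianMetric (fun p : S => TangentSpace (𝓡 3) p)}
  {e e' : OpenPartialHomeomorph S R3}

lemma vol_restrict_source (h : Bundle.RiemannianMetric (fun p : S => TangentSpace (𝓡 3) p))
    (he : e ∈ atlas R3 S) : (vol h).restrict e.source = chartVolume h e := by
  ext B hB
  rw [Measure.restrict_apply hB, vol_apply h he (hB.inter e.open_source.measurableSet)
    Set.inter_subset_right, ← measure_inter_add_sdiff B e.open_source.measurableSet,
    measure_mono_null (fun x hx => hx.2 : B \ e.source ⊆ e.sourceᶜ)
      (chartVolume_compl_source h e), add_zero]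

lemma setIntegral_source (hh : IsC11 h) (he : e ∈ atlas R3 S) {F : S → ℂ}
    (hF : AEStronglyMeasurable F ((vol h).restrict e.source)) :
    ∫ p in e.source, F p ∂(vol h) = ∫ x in e.target, (sqrtDet h e x : ℂ) * F (e.symm x) := by
  rw [vol_restrict_source h he] at hF ⊢
  rw [chartVolume, integral_map (aemeasurable_symm e _) hF,
    integral_withDensity_eq_integral_toReal_smul₀ (aemeasurable_sqrtDet hh he)
      (by simp)]
  refine integral_congr_ae (Eventually.of_forall fun x => ?_)
  have hs : 0 ≤ sqrtDet h e x := Real.sqrt_nonneg _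
  simp only [Complex.real_smul, ENNReal.toReal_ofReal hs]

/-- The density is continuous, so integrable over closed balls inside a chart target; compactness of
the manifold then turns local finiteness into finiteness. -/
lemma isFiniteMeasure_vol (hh : IsC11 h) : IsFiniteMeasure (vol h) := by
  have : IsLocallyFiniteMeasure (vol h) := by
    refine ⟨fun p => ?_⟩
    set e := chartAt R3 p with he0
    have he : e ∈ atlas R3 S := chart_mem_atlas R3 p
    have hp : p ∈ e.source := mem_chart_source R3 p
    obtain ⟨r, hr, hrt⟩ := Metric.nhds_basis_closedBall.mem_iff.1
      (e.open_target.mem_nhds (e.map_source hp))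
    refine ⟨e.source ∩ e ⁻¹' Metric.ball (e p) r,
      (e.isOpen_inter_preimage Metric.isOpen_ball).mem_nhds ⟨hp, Metric.mem_ball_self hr⟩, ?_⟩
    have hm : MeasurableSet (e.source ∩ e ⁻¹' Metric.ball (e p) r) :=
      (e.isOpen_inter_preimage Metric.isOpen_ball).measurableSet
    rw [vol_apply h he hm Set.inter_subset_left, chartVolume_apply h e hm]
    have hint : IntegrableOn (sqrtDet h e) (Metric.closedBall (e p) r) :=
      ((contDiffOn_sqrtDet hh he).continuousOn.mono hrt).integrableOn_compact
        (isCompact_closedBall _ _)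
    refine lt_of_le_of_lt (lintegral_mono_set ?_) hint.lintegral_lt_top
    rintro x ⟨hx, hx2⟩
    have := hx2.2
    simp only [Set.mem_preimage, e.right_inv hx] at this
    exact Metric.ball_subset_closedBall this
  exact ⟨isCompact_univ.measure_lt_top⟩

/-- The density is positive. As a consequence continuous functions that agree almost everywhere
agree everywhere, so weak arguments yield pointwise identities. -/
lemma isOpenPosMeasure_vol (hh : IsC11 h) :
    (vol h).IsOpenPosMeasure := by
  refine ⟨fun U hU ⟨p, hp⟩ => ?_⟩
  set e := chartAt R3 p with he0
  have he : e ∈ atlas R3 S := chart_mem_atlas R3 p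
  have hpe : p ∈ e.source := mem_chart_source R3 p
  have hUe : IsOpen (U ∩ e.source) := hU.inter e.open_source
  refine fun h0 => absurd (measure_mono_null Set.inter_subset_left h0 :
    vol h (U ∩ e.source) = 0) ?_
  rw [vol_apply h he hUe.measurableSet Set.inter_subset_right,
    chartVolume_apply h e hUe.measurableSet]
  have hA : IsOpen (e.target ∩ e.symm ⁻¹' (U ∩ e.source)) :=
    e.isOpen_inter_preimage_symm hUe
  intro h0
  have hsub : e.target ∩ e.symm ⁻¹' (U ∩ e.source) ⊆ e.target := Set.inter_subset_left
  have hcont : AEMeasurable (fun x => ENNReal.ofReal (sqrtDet h e x))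
      (volume.restrict (e.target ∩ e.symm ⁻¹' (U ∩ e.source))) :=
    (aemeasurable_sqrtDet hh he).mono_set hsub
  rw [lintegral_eq_zero_iff' hcont, Filter.EventuallyEq, ae_restrict_iff' hA.measurableSet] at h0
  refine hA.measure_ne_zero volume ⟨e p, e.map_source hpe, ?_⟩ ?_
  · simp [e.left_inv hpe, hp, hpe]
  · refine measure_mono_null (fun x hx => ?_) h0
    intro hx0
    exact (ENNReal.ofReal_pos.2 (sqrtDet_pos h he hx.1)).ne' (hx0 hx)

end VolumeProperties

/-! ### Laplacian and gradient pairing in coordinates -/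

section Coordinates

variable {S : Type*} [TopologicalSpace S] [ChartedSpace R3 S]

/-- The partial derivative of `f` in the chart `e`. -/
def pd (e : OpenPartialHomeomorph S R3) (f : S → ℂ) (b : Fin 3) (y : R3) : ℂ :=
  fderiv ℝ (f ∘ e.symm) y (EuclideanSpace.single b 1)

/-- The components `√h h^{ab} ∂_b f` in the chart `e`. -/
def flux (h : Bundle.RiemannianMetric (fun p : S => TangentSpace (𝓡 3) p))
    (e : OpenPartialHomeomorph S R3) (f : S → ℂ) (a : Fin 3) (y : R3) : ℂ :=
  ((sqrtDet h e y : ℝ) : ℂ) * ∑ b : Fin 3, (((gram h e y)⁻¹ a b : ℝ) : ℂ) * pd e f b y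

/-- The Laplace-Beltrami operator in the chart `e`. -/
def laplC (h : Bundle.RiemannianMetric (fun p : S => TangentSpace (𝓡 3) p))
    (e : OpenPartialHomeomorph S R3) (f : S → ℂ) (y : R3) : ℂ :=
  ((sqrtDet h e y : ℝ) : ℂ)⁻¹ *
    ∑ a : Fin 3, fderiv ℝ (flux h e f a) y (EuclideanSpace.single a 1)

/-- The pairing `h^{ab} ∂_a f ∂_b g` in the chart `e`. -/
def gradC (h : Bundle.RiemannianMetric (fun p : S => TangentSpace (𝓡 3) p))
    (e : OpenPartialHomeomorph S R3) (f g : S → ℂ) (y : R3) : ℂ :=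
  ∑ a : Fin 3, ∑ b : Fin 3, (((gram h e y)⁻¹ a b : ℝ) : ℂ) * pd e f b y * pd e g a y

lemma lapl_eq_laplC (h : Bundle.RiemannianMetric (fun p : S => TangentSpace (𝓡 3) p))
    (f : S → ℂ) (p : S) : lapl h f p = laplC h (chartAt R3 p) f (chartAt R3 p p) := rfl

variable {h : Bundle.RiemannianMetric (fun p : S => TangentSpace (𝓡 3) p)}
  [IsManifold (𝓡 3) ∞ S] {e e' : OpenPartialHomeomorph S R3} {f g ψ : S → ℂ}

lemma contDiffAt_comp_symm (he : e ∈ atlas R3 S) (hf : f ∈ smooth1 S) {x : R3}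
    (hx : x ∈ e.target) : ContDiffAt ℝ ∞ (f ∘ e.symm) x :=
  contMDiffAt_iff_contDiffAt.1
    ((show ContMDiff (𝓡 3) 𝓘(ℝ, ℂ) ∞ f from hf).contMDiffAt.comp x (contMDiffAt_chart_symm he hx))

lemma contDiffOn_pd (he : e ∈ atlas R3 S) (hf : f ∈ smooth1 S) (b : Fin 3) :
    ContDiffOn ℝ ∞ (pd e f b) e.target := fun x hx =>
  (((contDiffAt_comp_symm he hf hx).fderiv_right (m := ∞) (by simp)).clm_apply
    contDiffAt_const).contDiffWithinAt

/-- The outer derivative of the Laplacian also falls on the metric coefficients; a `C¹` flux gives a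
continuous `Δ_h f`. -/
lemma contDiffOn_flux (hh : IsC11 h) (he : e ∈ atlas R3 S) (hf : f ∈ smooth1 S) (a : Fin 3) :
    ContDiffOn ℝ 1 (flux h e f a) e.target := by
  have h1 : ∀ b, ContDiffOn ℝ 1 (pd e f b) e.target := fun b =>
    (contDiffOn_pd he hf b).of_le (by simp)
  have h2 : ∀ {F : R3 → ℝ}, ContDiffOn ℝ 1 F e.target →
      ContDiffOn ℝ 1 (fun x => (F x : ℂ)) e.target := fun hF =>
    Complex.ofRealCLM.contDiff.comp_contDiffOn hF
  exact (h2 (contDiffOn_sqrtDet hh he)).mul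
    (ContDiffOn.sum fun b _ => (h2 (contDiffOn_gram_inv hh he a b)).mul (h1 b))

lemma continuousOn_laplC (hh : IsC11 h) (he : e ∈ atlas R3 S) (hf : f ∈ smooth1 S) :
    ContinuousOn (laplC h e f) e.target := by
  refine ContinuousOn.mul (ContinuousOn.inv₀ ?_ ?_) (continuousOn_finsetSum _ fun a _ => ?_)
  · exact Complex.continuous_ofReal.comp_continuousOn (contDiffOn_sqrtDet hh he).continuousOn
  · exact fun x hx => Complex.ofReal_ne_zero.2 (sqrtDet_pos h he hx).ne'
  · exact ((contDiffOn_flux hh he hf a).continuousOn_fderiv_of_isOpen e.open_target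
      le_rfl).clm_apply continuousOn_const

lemma continuousOn_gradC (hh : IsC11 h) (he : e ∈ atlas R3 S) (hf : f ∈ smooth1 S)
    (hg : g ∈ smooth1 S) : ContinuousOn (gradC h e f g) e.target := by
  refine continuousOn_finsetSum _ fun a _ => continuousOn_finsetSum _ fun b _ => ?_
  exact ((Complex.continuous_ofReal.comp_continuousOn
    (contDiffOn_gram_inv hh he a b).continuousOn).mul (contDiffOn_pd he hf b).continuousOn).mul
    (contDiffOn_pd he hg a).continuousOn

lemma pd_coordChange (he : e ∈ atlas R3 S) (he' : e' ∈ atlas R3 S) (hf : f ∈ smooth1 S) {x : R3}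
    (hx : x ∈ e.target) (hx' : e.symm x ∈ e'.source) (a : Fin 3) :
    pd e f a x = ∑ c : Fin 3, (jac e e' x c a : ℂ) * pd e' f c (coordChange e e' x) := by
  have h1 : f ∘ e.symm =ᶠ[𝓝 x] (f ∘ e'.symm) ∘ coordChange e e' := by
    filter_upwards [eventually_symm_mem_source hx hx'] with y hy
    simp [coordChange, e'.left_inv hy.2]
  have h2 : coordChange e e' x ∈ e'.target := e'.map_source hx'
  rw [pd, h1.fderiv_eq, fderiv_comp x
    ((contDiffAt_comp_symm he' hf h2).differentiableAt (by simp))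
    ((contDiffAt_coordChange he he' hx hx').differentiableAt (by simp)),
    ContinuousLinearMap.comp_apply, single_sum (fderiv ℝ (coordChange e e') x _), map_sum]
  refine Finset.sum_congr rfl fun c _ => ?_
  rw [map_smul, Complex.real_smul]
  rfl

lemma gradC_coordChange (he : e ∈ atlas R3 S) (he' : e' ∈ atlas R3 S) (hf : f ∈ smooth1 S)
    (hg : g ∈ smooth1 S) {x : R3} (hx : x ∈ e.target) (hx' : e.symm x ∈ e'.source) :
    gradC h e f g x = gradC h e' f g (coordChange e e' x) := by
  have hdet := (gram_det_pos h he hx).ne'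
  rw [gram_coordChange h he he' hx hx', Matrix.det_mul, Matrix.det_mul,
    Matrix.det_transpose] at hdet
  have hJ : IsUnit (jac e e' x).det := by
    rw [isUnit_iff_ne_zero]
    intro h0
    simp [h0] at hdet
  -- Inverse Gram matrices transform contravariantly, which absorbs the two Jacobians produced by
  -- the chain rule.
  have key : jac e e' x * (gram h e x)⁻¹ * (jac e e' x).transpose =
      (gram h e' (coordChange e e' x))⁻¹ := by
    rw [gram_coordChange h he he' hx hx', Matrix.mul_inv_rev, Matrix.mul_inv_rev,
      ← Matrix.transpose_nonsing_inv, ← Matrix.mul_assoc, ← Matrix.mul_assoc,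
      Matrix.mul_nonsing_inv _ hJ, Matrix.one_mul, Matrix.mul_assoc, ← Matrix.transpose_mul,
      Matrix.mul_nonsing_inv _ hJ, Matrix.transpose_one, Matrix.mul_one]
  have key' : ∀ c d, (((gram h e' (coordChange e e' x))⁻¹ c d : ℝ) : ℂ) =
      ∑ b, (∑ a, (jac e e' x c a : ℂ) * ((gram h e x)⁻¹ a b : ℝ)) * (jac e e' x d b : ℂ) := by
    intro c d
    rw [← key]
    simp [Matrix.mul_apply]
  simp only [gradC, key', pd_coordChange he he' hf hx hx', pd_coordChange he he' hg hx hx']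
  simp only [Fin.sum_univ_three]
  ring

end Coordinates

/-! ### Chart independence of the Laplacian and Green's identity -/

section Green

variable {S : Type*} [TopologicalSpace S] [ChartedSpace R3 S] [T2Space S] [CompactSpace S]
  [IsManifold (𝓡 3) ∞ S] 
  {h : Bundle.RiemannianMetric (fun p : S => TangentSpace (𝓡 3) p)}
  {e e' : OpenPartialHomeomorph S R3} {f g ψ : S → ℂ}

/-- The coordinate expression of `ψ` in the chart `e`, extended by zero. -/
def coordExt (e : OpenPartialHomeomorph S R3) (ψ : S → ℂ) : R3 → ℂ :=
  e.target.indicator (ψ ∘ e.symm)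

omit [ChartedSpace R3 S] [IsManifold (𝓡 3) ∞ S] [T2Space S] in
lemma tsupport_coordExt (hs : tsupport ψ ⊆ e.source) :
    tsupport (coordExt e ψ) ⊆ e '' tsupport ψ := by
  have hK : IsCompact (e '' tsupport ψ) :=
    (isClosed_tsupport ψ).isCompact.image_of_continuousOn (e.continuousOn.mono hs)
  refine closure_minimal (fun x hx => ?_) hK.isClosed
  by_cases hxt : x ∈ e.target
  · rw [Function.mem_support, coordExt, Set.indicator_of_mem hxt] at hx
    exact ⟨e.symm x, subset_closure hx, e.right_inv hxt⟩
  · exact absurd (Set.indicator_of_notMem hxt _) hx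

omit [ChartedSpace R3 S] [IsManifold (𝓡 3) ∞ S] [T2Space S] in
lemma tsupport_coordExt_subset (hs : tsupport ψ ⊆ e.source) :
    tsupport (coordExt e ψ) ⊆ e.target := by
  refine (tsupport_coordExt hs).trans ?_
  rintro _ ⟨p, hp, rfl⟩
  exact e.map_source (hs hp)

omit [ChartedSpace R3 S] [IsManifold (𝓡 3) ∞ S] [T2Space S] in
lemma hasCompactSupport_coordExt (hs : tsupport ψ ⊆ e.source) :
    HasCompactSupport (coordExt e ψ) :=
  ((isClosed_tsupport ψ).isCompact.image_of_continuousOn (e.continuousOn.mono hs)).of_isClosed_subset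
    (isClosed_tsupport _) (tsupport_coordExt hs)

omit [ChartedSpace R3 S] [IsManifold (𝓡 3) ∞ S] [T2Space S] [CompactSpace S] in
lemma coordExt_eventuallyEq {x : R3} (hx : x ∈ e.target) :
    coordExt e ψ =ᶠ[𝓝 x] ψ ∘ e.symm := by
  filter_upwards [e.open_target.mem_nhds hx] with y hy
  simp [coordExt, hy]

omit [T2Space S] in
lemma contDiff_coordExt (he : e ∈ atlas R3 S) (hψ : ψ ∈ smooth1 S) (hs : tsupport ψ ⊆ e.source) :
    ContDiff ℝ ∞ (coordExt e ψ) := by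
  rw [contDiff_iff_contDiffAt]
  intro x
  by_cases hx : x ∈ tsupport (coordExt e ψ)
  · have hx' := tsupport_coordExt_subset hs hx
    exact (contDiffAt_comp_symm he hψ hx').congr_of_eventuallyEq (coordExt_eventuallyEq hx')
  · exact contDiffAt_const.congr_of_eventuallyEq (notMem_tsupport_iff_eventuallyEq.1 hx)

/-- Integration by parts for a function that is `C¹` on an open set containing the compact support
of the other factor. -/
lemma integral_fderiv_mul_of_tsupport_subset {U : Set R3} (hU : IsOpen U) {F G : R3 → ℂ}
    (hF : ContDiffOn ℝ 1 F U) (hG : ContDiff ℝ ∞ G) (hGc : HasCompactSupport G)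
    (hGU : tsupport G ⊆ U) (v : R3) :
    Integrable (fun x => fderiv ℝ F x v * G x) ∧ Integrable (fun x => F x * fderiv ℝ G x v) ∧
      ∫ x, fderiv ℝ F x v * G x = - ∫ x, F x * fderiv ℝ G x v := by
  -- A product is continuous on the whole space if one factor is continuous on `U` and the other is
  -- continuous with support inside `U`.
  have key : ∀ {A B : R3 → ℂ}, ContinuousOn A U → Continuous B → tsupport B ⊆ tsupport G →
      Integrable (fun x => A x * B x) := by
    intro A B hA hB hBG
    have h1 : tsupport (fun x => A x * B x) ⊆ tsupport G := 
      (tsupport_mul_subset_right).trans hBG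
    refine Continuous.integrable_of_hasCompactSupport ?_ (hGc.of_isClosed_subset
      (isClosed_tsupport _) h1)
    exact (hA.mul hB.continuousOn).continuous_of_tsupport_subset hU (h1.trans hGU)
  have hG' : Continuous fun x => fderiv ℝ G x v :=
    (hG.continuous_fderiv (by simp)).clm_apply continuous_const
  have hGs : tsupport (fun x => fderiv ℝ G x v) ⊆ tsupport G := tsupport_fderiv_apply_subset ℝ v
  have hF' : ContinuousOn (fun x => fderiv ℝ F x v) U :=
    (hF.continuousOn_fderiv_of_isOpen hU le_rfl).clm_apply continuousOn_const
  have i1 := key hF' hG.continuous subset_rfl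
  have i2 := key hF.continuousOn hG' hGs
  have i3 := key hF.continuousOn hG.continuous subset_rfl
  refine ⟨i1, i2, ?_⟩
  rw [integral_mul_fderiv_eq_neg_fderiv_mul_of_integrable i1 i2 i3 _ _, neg_neg]
  · exact fun x hx => (hF.differentiableOn (by simp)).differentiableAt (hU.mem_nhds (hGU hx))
  · exact fun x _ => hG.differentiable (by simp) x

variable [MeasurableSpace S] [BorelSpace S]

omit [T2Space S] in
-- The density `√h` of the volume cancels the factor `1/√h` of the Laplacian and leaves the
-- divergence of a `C¹` flux, which is integrated by parts against `ψ`.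
lemma setIntegral_laplC_mul (hh : IsC11 h) (he : e ∈ atlas R3 S) (hf : f ∈ smooth1 S)
    (hψ : ψ ∈ smooth1 S) (hs : tsupport ψ ⊆ e.source) :
    ∫ p in e.source, laplC h e f (e p) * ψ p ∂(vol h) =
      - ∫ p in e.source, gradC h e f ψ (e p) ∂(vol h) := by
  have hcψ : Continuous ψ := (show ContMDiff (𝓡 3) 𝓘(ℝ, ℂ) ∞ ψ from hψ).continuous
  have m1 : AEStronglyMeasurable (fun p => laplC h e f (e p) * ψ p)
      ((vol h).restrict e.source) :=
    (((continuousOn_laplC hh he hf).comp e.continuousOn fun p hp => e.map_source hp).mul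
      hcψ.continuousOn).aestronglyMeasurable e.open_source.measurableSet
  have m2 : AEStronglyMeasurable (fun p => gradC h e f ψ (e p)) ((vol h).restrict e.source) :=
    ((continuousOn_gradC hh he hf hψ).comp e.continuousOn fun p hp =>
      e.map_source hp).aestronglyMeasurable e.open_source.measurableSet
  rw [setIntegral_source hh he m1, setIntegral_source hh he m2]
  have hibp := fun a : Fin 3 => integral_fderiv_mul_of_tsupport_subset e.open_target
    (contDiffOn_flux hh he hf a) (contDiff_coordExt he hψ hs) (hasCompactSupport_coordExt hs)
    (tsupport_coordExt_subset hs) (EuclideanSpace.single a 1)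
  have h1 : ∫ x in e.target, (sqrtDet h e x : ℂ) *
      (laplC h e f (e (e.symm x)) * ψ (e.symm x)) =
      ∑ a, ∫ x, fderiv ℝ (flux h e f a) x (EuclideanSpace.single a 1) * coordExt e ψ x := by
    rw [← integral_finsetSum _ fun a _ => (hibp a).1]
    refine Eq.trans ?_ (setIntegral_eq_integral_of_forall_compl_eq_zero (s := e.target) ?_)
    · refine setIntegral_congr_fun e.open_target.measurableSet fun x hx => ?_
      have hne : (sqrtDet h e x : ℂ) ≠ 0 := Complex.ofReal_ne_zero.2 (sqrtDet_pos h he hx).ne'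
      simp only [e.right_inv hx, laplC, coordExt, Set.indicator_of_mem hx, Function.comp_apply,
        ← Finset.sum_mul]
      field_simp
    · intro x hx
      simp [coordExt, hx]
  have h2 : ∫ x in e.target, (sqrtDet h e x : ℂ) * gradC h e f ψ (e (e.symm x)) =
      ∑ a, ∫ x, flux h e f a x * fderiv ℝ (coordExt e ψ) x (EuclideanSpace.single a 1) := by
    rw [← integral_finsetSum _ fun a _ => (hibp a).2.1]
    refine Eq.trans ?_ (setIntegral_eq_integral_of_forall_compl_eq_zero (s := e.target) ?_)
    · refine setIntegral_congr_fun e.open_target.measurableSet fun x hx => ?_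
      simp only [e.right_inv hx, (coordExt_eventuallyEq hx).fderiv_eq, flux, gradC,
        Finset.mul_sum, Finset.sum_mul]
      refine Finset.sum_congr rfl fun a _ => Finset.sum_congr rfl fun b _ => ?_
      simp only [pd]
      ring
    · intro x hx
      have : x ∉ tsupport (coordExt e ψ) := fun hx' => hx (tsupport_coordExt_subset hs hx')
      simp [(notMem_tsupport_iff_eventuallyEq.1 this).fderiv_eq]
  rw [h1, h2, ← Finset.sum_neg_distrib]
  exact Finset.sum_congr rfl fun a _ => (hibp a).2.2

omit [T2Space S] [CompactSpace S] [IsManifold (𝓡 3) ∞ S] [MeasurableSpace S] [BorelSpace S] in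
lemma gradC_eq_zero {p : S} (hp : p ∈ e.source) (hpψ : p ∉ tsupport ψ) :
    gradC h e f ψ (e p) = 0 := by
  have h1 : ψ ∘ e.symm =ᶠ[𝓝 (e p)] 0 := by
    have := (e.symm.continuousAt (e.map_source hp)).tendsto
    rw [e.left_inv hp] at this
    exact this.eventually (notMem_tsupport_iff_eventuallyEq.1 hpψ)
  simp [gradC, pd, h1.fderiv_eq]

omit [T2Space S] in
lemma integrable_laplC_mul (hh : IsC11 h) (he : e ∈ atlas R3 S) (hf : f ∈ smooth1 S)
    (hψ : ψ ∈ smooth1 S) (hs : tsupport ψ ⊆ e.source) :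
    Integrable (fun p => laplC h e f (e p) * ψ p) (vol h) := by
  have := isFiniteMeasure_vol hh
  have hcψ : Continuous ψ := (show ContMDiff (𝓡 3) 𝓘(ℝ, ℂ) ∞ ψ from hψ).continuous
  refine Continuous.integrable_of_hasCompactSupport ?_ (HasCompactSupport.of_compactSpace _)
  exact (((continuousOn_laplC hh he hf).comp e.continuousOn fun p hp => e.map_source hp).mul
      hcψ.continuousOn).continuous_of_tsupport_subset e.open_source
      (tsupport_mul_subset_right.trans hs)

omit [T2Space S] in
-- The gradient pairing vanishes off the support of `ψ`, so it may be integrated over any `O`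
-- between that support and the chart domain. With `O` an overlap, two charts can be compared.
lemma integral_laplC_mul (hh : IsC11 h) (he : e ∈ atlas R3 S) (hf : f ∈ smooth1 S)
    (hψ : ψ ∈ smooth1 S) (hs : tsupport ψ ⊆ e.source) {O : Set S}
    (hOe : O ⊆ e.source) (hsO : tsupport ψ ⊆ O) :
    ∫ p, laplC h e f (e p) * ψ p ∂(vol h) = - ∫ p in O, gradC h e f ψ (e p) ∂(vol h) := by
  rw [← setIntegral_eq_integral_of_forall_compl_eq_zero (s := e.source),
    setIntegral_laplC_mul hh he hf hψ hs,
    setIntegral_eq_of_subset_of_forall_sdiff_eq_zero e.open_source.measurableSet hOe]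
  · exact fun p hp => gradC_eq_zero hp.1 fun h0 => hp.2 (hsO h0)
  · intro p hp
    rw [image_eq_zero_of_notMem_tsupport fun h0 => hp (hs h0), mul_zero]

/-- No second derivatives of the transition map are computed. Tested against `ψ` supported in the
overlap, both expressions give `-∫ h(∇f, ∇ψ)`, which is invariant by the first-order transformation
rule; the two functions are continuous and the volume has full support. -/
lemma laplC_coordChange (hh : IsC11 h) (he : e ∈ atlas R3 S) (he' : e' ∈ atlas R3 S)
    (hf : f ∈ smooth1 S) {p : S} (hp : p ∈ e.source) (hp' : p ∈ e'.source) :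
    laplC h e f (e p) = laplC h e' f (e' p) := by
  have := isFiniteMeasure_vol hh
  have := isOpenPosMeasure_vol hh
  set O : Set S := e.source ∩ e'.source with hO
  have hOo : IsOpen O := e.open_source.inter e'.open_source
  have c1 : ContinuousOn (fun p => laplC h e f (e p)) e.source :=
    (continuousOn_laplC hh he hf).comp e.continuousOn fun p hp => e.map_source hp
  have c2 : ContinuousOn (fun p => laplC h e' f (e' p)) e'.source :=
    (continuousOn_laplC hh he' hf).comp e'.continuousOn fun p hp => e'.map_source hp
  have c1' := c1.mono (Set.inter_subset_left : O ⊆ _)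
  have c2' := c2.mono (Set.inter_subset_right : O ⊆ _)
  have hae : ∀ᵐ p ∂(vol h), p ∈ O → laplC h e f (e p) - laplC h e' f (e' p) = 0 := by
    refine hOo.ae_eq_zero_of_integral_contMDiff_smul_eq_zero (𝓡 3)
      ((c1'.sub c2').locallyIntegrableOn hOo.measurableSet) fun ψ hψ _ hψs => ?_
    have hψ' : (fun p => (ψ p : ℂ)) ∈ smooth1 S :=
      Complex.ofRealCLM.contDiff.contMDiff.comp hψ
    have hts : tsupport (fun p => (ψ p : ℂ)) ⊆ O := by
      refine subset_trans (closure_mono fun p hp => ?_) hψs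
      exact fun h0 => hp (by simp [h0])
    have hs1 := hts.trans Set.inter_subset_left
    have hs2 := hts.trans Set.inter_subset_right
    have e1 := integral_laplC_mul hh he hf hψ' hs1 Set.inter_subset_left hts
    have e2 := integral_laplC_mul hh he' hf hψ' hs2 Set.inter_subset_right hts
    have e3 : ∫ p in O, gradC h e f (fun p => (ψ p : ℂ)) (e p) ∂(vol h) =
        ∫ p in O, gradC h e' f (fun p => (ψ p : ℂ)) (e' p) ∂(vol h) := by
      refine setIntegral_congr_fun hOo.measurableSet fun p hp => ?_
      have hpe' : e.symm (e p) ∈ e'.source := by rw [e.left_inv hp.1]; exact hp.2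
      rw [gradC_coordChange he he' hf hψ' (e.map_source hp.1) hpe', coordChange, e.left_inv hp.1]
    have e4 := integral_sub (integrable_laplC_mul hh he hf hψ' hs1)
      (integrable_laplC_mul hh he' hf hψ' hs2)
    rw [e1, e2, e3, sub_self] at e4
    rw [← e4]
    refine integral_congr_ae (Eventually.of_forall fun p => ?_)
    simp only [Complex.real_smul]
    ring
  have := Measure.eqOn_open_of_ae_eq (μ := vol h) (U := O)
    (f := fun p => laplC h e f (e p)) (g := fun p => laplC h e' f (e' p))
    (by
      rw [Filter.EventuallyEq, ae_restrict_iff' hOo.measurableSet]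
      filter_upwards [hae] with p hp hpO using sub_eq_zero.1 (hp hpO)) hOo c1' c2'
  exact this ⟨hp, hp'⟩

lemma lapl_eq_chart (hh : IsC11 h) (he : e ∈ atlas R3 S) (hf : f ∈ smooth1 S) {p : S}
    (hp : p ∈ e.source) : lapl h f p = laplC h e f (e p) := by
  rw [lapl_eq_laplC]
  exact laplC_coordChange hh (chart_mem_atlas R3 p) he hf (mem_chart_source R3 p) hp

/-- The definition changes chart from point to point; near `p` the chart at `p` may be used
throughout. -/
lemma continuous_lapl (hh : IsC11 h) (hf : f ∈ smooth1 S) : Continuous (lapl h f) := by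
  rw [continuous_iff_continuousAt]
  intro p
  have he : chartAt R3 p ∈ atlas R3 S := chart_mem_atlas R3 p
  have hp : (chartAt R3 p).source ∈ 𝓝 p :=
    (chartAt R3 p).open_source.mem_nhds (mem_chart_source R3 p)
  have c1 : ContinuousOn (fun q => laplC h (chartAt R3 p) f (chartAt R3 p q))
      (chartAt R3 p).source :=
    (continuousOn_laplC hh he hf).comp (chartAt R3 p).continuousOn
      fun p hp => (chartAt R3 _).map_source hp
  refine (c1.continuousAt hp).congr ?_
  filter_upwards [hp] with q hq using (lapl_eq_chart hh he hf hq).symm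

/-- The pairing `h(∇f, ∇g)`. -/
def gradPair (h : Bundle.RiemannianMetric (fun p : S => TangentSpace (𝓡 3) p)) (f g : S → ℂ)
    (p : S) : ℂ := gradC h (chartAt R3 p) f g (chartAt R3 p p)

omit [T2Space S] [CompactSpace S] [MeasurableSpace S] [BorelSpace S] in
lemma gradPair_eq_chart (he : e ∈ atlas R3 S) (hf : f ∈ smooth1 S) (hg : g ∈ smooth1 S) {p : S}
    (hp : p ∈ e.source) : gradPair h f g p = gradC h e f g (e p) := by
  have h0 := mem_chart_source R3 p
  have hpe' : (chartAt R3 p).symm (chartAt R3 p p) ∈ e.source := by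
    rwa [(chartAt R3 p).left_inv h0]
  rw [gradPair, gradC_coordChange (chart_mem_atlas R3 p) he hf hg
    ((chartAt R3 p).map_source h0) hpe', coordChange, (chartAt R3 p).left_inv h0]

omit [T2Space S] [CompactSpace S] [MeasurableSpace S] [BorelSpace S] in
lemma continuous_gradPair (hh : IsC11 h) (hf : f ∈ smooth1 S) (hg : g ∈ smooth1 S) :
    Continuous (gradPair h f g) := by
  rw [continuous_iff_continuousAt]
  intro p
  have he : chartAt R3 p ∈ atlas R3 S := chart_mem_atlas R3 p
  have hp : (chartAt R3 p).source ∈ 𝓝 p :=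
    (chartAt R3 p).open_source.mem_nhds (mem_chart_source R3 p)
  have c1 : ContinuousOn (fun q => gradC h (chartAt R3 p) f g (chartAt R3 p q))
      (chartAt R3 p).source :=
    (continuousOn_gradC hh he hf hg).comp (chartAt R3 p).continuousOn
      fun p hp => (chartAt R3 _).map_source hp
  refine (c1.continuousAt hp).congr ?_
  filter_upwards [hp] with q hq using (gradPair_eq_chart he hf hg hq).symm

lemma integral_lapl_mul_of_tsupport (hh : IsC11 h) (he : e ∈ atlas R3 S) (hf : f ∈ smooth1 S)
    (hψ : ψ ∈ smooth1 S) (hs : tsupport ψ ⊆ e.source) :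
    ∫ p, lapl h f p * ψ p ∂(vol h) = - ∫ p, gradPair h f ψ p ∂(vol h) := by
  have h1 : ∫ p, lapl h f p * ψ p ∂(vol h) = ∫ p, laplC h e f (e p) * ψ p ∂(vol h) := by
    refine integral_congr_ae (Eventually.of_forall fun p => ?_)
    by_cases hp : p ∈ e.source
    · simp only [lapl_eq_chart hh he hf hp]
    · simp only [image_eq_zero_of_notMem_tsupport fun h0 => hp (hs h0), mul_zero]
  rw [h1, integral_laplC_mul hh he hf hψ hs subset_rfl hs]
  refine congrArg _ (Eq.trans ?_
    (setIntegral_eq_integral_of_forall_compl_eq_zero (s := e.source) ?_))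
  · exact setIntegral_congr_fun e.open_source.measurableSet fun p hp =>
      (gradPair_eq_chart he hf hψ hp).symm
  · exact fun p hp => gradC_eq_zero (mem_chart_source R3 p) fun h0 => hp (hs h0)

/-- **Green's identity**. -/
theorem integral_lapl_mul (hh : IsC11 h) (hf : f ∈ smooth1 S) (hg : g ∈ smooth1 S) :
    ∫ p, lapl h f p * g p ∂(vol h) = - ∫ p, gradPair h f g p ∂(vol h) := by
  have := isFiniteMeasure_vol hh
  -- The identity is known when the second factor is supported in one chart. A subordinate partition
  -- of unity cuts `g` into such pieces, finitely many by compactness.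
  obtain ⟨ρ, hρ⟩ := SmoothPartitionOfUnity.exists_isSubordinate_chartAt_source (𝓡 3) S
  have hfin : {i | (Function.support (ρ i)).Nonempty}.Finite :=
    ρ.locallyFinite.finite_nonempty_of_compact
  let T := hfin.toFinset
  have hsum : ∀ p, ∑ i ∈ T, ρ i p = 1 := fun p => by
    refine ρ.sum_finsupport' p (Set.mem_univ p) fun i hi => ?_
    exact hfin.mem_toFinset.2 ⟨p, ρ.mem_finsupport p |>.1 hi⟩
  let ψ : S → S → ℂ := fun i p => (ρ i p : ℂ) * g p
  have hψ : ∀ i, ψ i ∈ smooth1 S := fun i => by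
    have : ContMDiff (𝓡 3) 𝓘(ℝ, ℂ) ∞ (fun p => (ρ i p : ℝ) • g p) :=
      (ρ i).contMDiff.smul hg
    exact this
  have hψs : ∀ i, tsupport (ψ i) ⊆ (chartAt R3 i).source := fun i => by
    refine (closure_mono fun p hp => ?_ : tsupport (ψ i) ⊆ tsupport (ρ i)).trans (hρ i)
    exact fun h0 => hp (by simp [ψ, h0])
  have hgs : ∀ p, g p = ∑ i ∈ T, ψ i p := fun p => by
    simp only [ψ, ← Finset.sum_mul]
    rw [← Complex.ofReal_sum, hsum]
    simp
  have hgs' : g = ∑ i ∈ T, ψ i := by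
    ext p
    rw [hgs p, Finset.sum_apply]
  have hgrad : ∀ p, gradPair h f g p = ∑ i ∈ T, gradPair h f (ψ i) p := fun p => by
    have hx := (chartAt R3 p).map_source (mem_chart_source R3 p)
    have hpd : ∀ a, pd (chartAt R3 p) g a (chartAt R3 p p) =
        ∑ i ∈ T, pd (chartAt R3 p) (ψ i) a (chartAt R3 p p) := fun a => by
      have : g ∘ (chartAt R3 p).symm = fun y => ∑ i ∈ T, (ψ i ∘ (chartAt R3 p).symm) y := by
        ext y
        simp [hgs]
      rw [pd, this, fderiv_fun_sum fun i _ =>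
        (contDiffAt_comp_symm (chart_mem_atlas R3 p) (hψ i) hx).differentiableAt (by simp)]
      simp [pd]
    simp only [gradPair, gradC, hpd, Finset.mul_sum]
    rw [Finset.sum_comm (s := T)]
    refine Finset.sum_congr rfl fun a _ => ?_
    rw [Finset.sum_comm (s := T)]
  have hint : ∀ {F : S → ℂ}, Continuous F → Integrable F (vol h) := fun hF =>
    hF.integrable_of_hasCompactSupport (HasCompactSupport.of_compactSpace _)
  have hc : ∀ {F : S → ℂ}, F ∈ smooth1 S → Continuous F := fun {F} hF =>
    (show ContMDiff (𝓡 3) 𝓘(ℝ, ℂ) ∞ F from hF).continuous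
  simp only [hgrad, hgs, Finset.mul_sum]
  rw [integral_finsetSum T (f := fun i p => lapl h f p * ψ i p)
      fun i _ => hint ((continuous_lapl hh hf).mul (hc (hψ i))),
    integral_finsetSum _ fun i _ => hint (continuous_gradPair hh hf (hψ i)),
    ← Finset.sum_neg_distrib]
  exact Finset.sum_congr rfl fun i _ =>
    integral_lapl_mul_of_tsupport hh (chart_mem_atlas R3 i) hf (hψ i) (hψs i)

omit [T2Space S] [CompactSpace S] [IsManifold (𝓡 3) ∞ S] [MeasurableSpace S] [BorelSpace S] in
lemma gradPair_comm (f g : S → ℂ) (p : S) : gradPair h f g p = gradPair h g f p := by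
  have hs := (gram_isSymm h (chartAt R3 p) (chartAt R3 p p)).inv
  simp only [gradPair, gradC]
  rw [Finset.sum_comm]
  refine Finset.sum_congr rfl fun a _ => Finset.sum_congr rfl fun b _ => ?_
  rw [← hs.apply a b]
  ring

theorem integral_lapl_mul_comm (hh : IsC11 h) (hf : f ∈ smooth1 S) (hg : g ∈ smooth1 S) :
    ∫ p, lapl h f p * g p ∂(vol h) = ∫ p, f p * lapl h g p ∂(vol h) := by
  rw [integral_lapl_mul hh hf hg]
  simp only [gradPair_comm f g, mul_comm (f _)]
  rw [integral_lapl_mul hh hg hf]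

omit [T2Space S] [CompactSpace S] [IsManifold (𝓡 3) ∞ S] [MeasurableSpace S] [BorelSpace S] in
lemma conj_mem_smooth1 (hf : f ∈ smooth1 S) : (fun p => starRingEnd ℂ (f p)) ∈ smooth1 S :=
  Complex.conjCLE.contDiff.contMDiff.comp hf

omit [T2Space S] [CompactSpace S] [IsManifold (𝓡 3) ∞ S] [MeasurableSpace S] [BorelSpace S]
  [ChartedSpace R3 S] in
lemma pd_conj (e : OpenPartialHomeomorph S R3) (f : S → ℂ) (a : Fin 3) (x : R3) :
    pd e (fun p => starRingEnd ℂ (f p)) a x = starRingEnd ℂ (pd e f a x) := by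
  have : (fun p => starRingEnd ℂ (f p)) ∘ e.symm = Complex.conjCLE ∘ (f ∘ e.symm) := rfl
  rw [pd, this, ContinuousLinearEquiv.comp_fderiv]
  rfl

omit [T2Space S] [CompactSpace S] [MeasurableSpace S] [BorelSpace S] in
-- The inverse Gram matrix is real, so mixed terms in the real and imaginary parts of `df` are
-- imaginary. Two values of a positive semidefinite form remain.
lemma gradPair_conj_re_nonneg (f : S → ℂ) (p : S) :
    0 ≤ (gradPair h f (fun p => starRingEnd ℂ (f p)) p).re := by
  have hx := (chartAt R3 p).map_source (mem_chart_source R3 p)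
  have hpos := (gram_posDef h (chart_mem_atlas R3 p) hx).inv.posSemidef
  set G := (gram h (chartAt R3 p) (chartAt R3 p p))⁻¹ with hG
  have h1 := hpos.dotProduct_mulVec_nonneg (fun a => (pd (chartAt R3 p) f a (chartAt R3 p p)).re)
  have h2 := hpos.dotProduct_mulVec_nonneg (fun a => (pd (chartAt R3 p) f a (chartAt R3 p p)).im)
  have : (gradPair h f (fun p => starRingEnd ℂ (f p)) p).re =
    (star (fun a => (pd (chartAt R3 p) f a (chartAt R3 p p)).re) ⬝ᵥ
      G.mulVec (fun a => (pd (chartAt R3 p) f a (chartAt R3 p p)).re)) +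
    (star (fun a => (pd (chartAt R3 p) f a (chartAt R3 p p)).im) ⬝ᵥ
      G.mulVec (fun a => (pd (chartAt R3 p) f a (chartAt R3 p p)).im)) := by
    simp only [gradPair, gradC, pd_conj, ← hG, Complex.re_sum, dotProduct, Matrix.mulVec,
      Finset.mul_sum, star_trivial, ← Finset.sum_add_distrib, Pi.star_apply]
    refine Finset.sum_congr rfl fun a _ => Finset.sum_congr rfl fun b _ => ?_
    simp
    ring
  rw [this]
  exact add_nonneg h1 h2

theorem integral_lapl_mul_conj_re_nonpos (hh : IsC11 h) (hf : f ∈ smooth1 S) :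
    (∫ p, lapl h f p * starRingEnd ℂ (f p) ∂(vol h)).re ≤ 0 := by
  have := isFiniteMeasure_vol hh
  have hint : Integrable (gradPair h f (fun p => starRingEnd ℂ (f p))) (vol h) :=
    (continuous_gradPair hh hf (conj_mem_smooth1 hf)).integrable_of_hasCompactSupport
      (HasCompactSupport.of_compactSpace _)
  rw [integral_lapl_mul hh hf (conj_mem_smooth1 hf), Complex.neg_re, neg_nonpos]
  have h1 : (∫ p, gradPair h f (fun p => starRingEnd ℂ (f p)) p ∂(vol h)).re =
      ∫ p, (gradPair h f (fun p => starRingEnd ℂ (f p)) p).re ∂(vol h) :=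
    (integral_re hint).symm
  rw [h1]
  exact integral_nonneg fun p => gradPair_conj_re_nonneg f p

end Green

/-! ### Smooth dependence of derivatives on parameters -/

section Parameters

variable {EP : Type*} [NormedAddCommGroup EP] [NormedSpace ℝ EP] {HP : Type*}
  [TopologicalSpace HP] {IP : ModelWithCorners ℝ EP HP} {P : Type*} [TopologicalSpace P]
  [ChartedSpace HP P] [IsManifold IP ∞ P]
  {E : Type*} [NormedAddCommGroup E] [NormedSpace ℝ E]

/-- Partial derivatives of a smooth function depend smoothly on parameters. -/
lemma contMDiffAt_fderiv_param {G : P × E → ℂ} {x₀ : P × E}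
    (hG : ContMDiffAt (IP.prod 𝓘(ℝ, E)) 𝓘(ℝ, ℂ) ∞ G x₀) (v : E) :
    ContMDiffAt (IP.prod 𝓘(ℝ, E)) 𝓘(ℝ, ℂ) ∞
      (fun q : P × E => fderiv ℝ (fun y => G (q.1, y)) q.2 v) x₀ := by
  have h1 : ContMDiffAt ((IP.prod 𝓘(ℝ, E)).prod 𝓘(ℝ, E)) 𝓘(ℝ, ℂ) ∞
      (Function.uncurry fun (q : P × E) (y : E) => G (q.1, y)) (x₀, x₀.2) := by
    have h2 : ContMDiffAt ((IP.prod 𝓘(ℝ, E)).prod 𝓘(ℝ, E)) (IP.prod 𝓘(ℝ, E)) ∞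
        (fun w : (P × E) × E => (w.1.1, w.2)) (x₀, x₀.2) :=
      (contMDiffAt_fst.comp _ contMDiffAt_fst).prodMk contMDiffAt_snd
    exact ContMDiffAt.comp (x₀, x₀.2) (g := G) hG h2
  have h3 := ContMDiffAt.mfderiv (m := ∞) (fun (q : P × E) (y : E) => G (q.1, y))
    (fun q : P × E => q.2) h1 contMDiffAt_snd (by simp)
  have h4 : ContMDiffAt (IP.prod 𝓘(ℝ, E)) 𝓘(ℝ, E →L[ℝ] ℂ) ∞
      (fun q : P × E => fderiv ℝ (fun y => G (q.1, y)) q.2) x₀ := by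
    have h5 : (fun q : P × E => fderiv ℝ (fun y => G (q.1, y)) q.2) =
        fun q : P × E => (mfderiv 𝓘(ℝ, E) 𝓘(ℝ, ℂ) (fun y => G (q.1, y)) q.2 : E →L[ℝ] ℂ) := by
      ext1 q
      exact mfderiv_eq_fderiv.symm
    -- Between vector spaces the tangent coordinates are trivial, so the statement about `mfderiv`
    -- is one about `fderiv`.
    have h6 := inTangentCoordinates_model_space (I := 𝓘(ℝ, E)) (I' := 𝓘(ℝ, ℂ))
      (fun q : P × E => q.2) (fun q : P × E => G (q.1, q.2))
      (fun q => (mfderiv 𝓘(ℝ, E) 𝓘(ℝ, ℂ) (fun y => G (q.1, y)) q.2 : E →L[ℝ] ℂ)) x₀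
    rw [h5]
    exact h6 ▸ h3
  exact h4.clm_apply contMDiffAt_const

end Parameters

/-! ### Joint continuity of the Laplacian in point and parameter -/

section ParametersLaplacian

variable {EP : Type*} [NormedAddCommGroup EP] [NormedSpace ℝ EP] {HP : Type*}
  [TopologicalSpace HP] {IP : ModelWithCorners ℝ EP HP} {P : Type*} [TopologicalSpace P]
  [ChartedSpace HP P] [IsManifold IP ∞ P]
  {S : Type*} [TopologicalSpace S] [ChartedSpace R3 S] [T2Space S] [CompactSpace S]
  [IsManifold (𝓡 3) ∞ S] [MeasurableSpace S] [BorelSpace S]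
  {h : Bundle.RiemannianMetric (fun p : S => TangentSpace (𝓡 3) p)}

omit [IsManifold IP ∞ P] [T2Space S] [CompactSpace S] [IsManifold (𝓡 3) ∞ S]
  [MeasurableSpace S] [BorelSpace S] in
lemma slice_mem_smooth1 {F : P × S → ℂ} (hF : ContMDiff (IP.prod (𝓡 3)) 𝓘(ℝ, ℂ) ∞ F) (p : P) :
    (fun x => F (p, x)) ∈ smooth1 S :=
  hF.comp (contMDiff_const.prodMk contMDiff_id)

/-- In a fixed chart the product rule writes the Laplacian as a sum of terms in which the metric
coefficients depend on the point alone, and the derivatives of `F` are jointly smooth. -/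
lemma continuous_lapl_param (hh : IsC11 h) {F : P × S → ℂ}
    (hF : ContMDiff (IP.prod (𝓡 3)) 𝓘(ℝ, ℂ) ∞ F) :
    Continuous fun q : P × S => lapl h (fun x => F (q.1, x)) q.2 := by
  rw [continuous_iff_continuousAt]
  rintro ⟨p₀, x₀⟩
  set e := chartAt R3 x₀ with he_def
  have he : e ∈ atlas R3 S := chart_mem_atlas R3 x₀
  have hx₀ : x₀ ∈ e.source := mem_chart_source R3 x₀
  have hy₀ : e x₀ ∈ e.target := e.map_source hx₀
  let G : P × R3 → ℂ := fun w => F (w.1, e.symm w.2)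
  have hG : ∀ w : P × R3, w.2 ∈ e.target → ContMDiffAt (IP.prod (𝓡 3)) 𝓘(ℝ, ℂ) ∞ G w :=
    fun w hw => hF.contMDiffAt.comp w (contMDiffAt_fst.prodMk
      ((contMDiffAt_chart_symm he hw).comp w contMDiffAt_snd))
  let D : Fin 3 → P × R3 → ℂ := fun b w =>
    fderiv ℝ (fun y => G (w.1, y)) w.2 (EuclideanSpace.single b 1)
  have hD : ∀ b (w : P × R3), w.2 ∈ e.target → ContMDiffAt (IP.prod (𝓡 3)) 𝓘(ℝ, ℂ) ∞ (D b) w :=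
    fun b w hw => contMDiffAt_fderiv_param (hG w hw) _
  let D2 : Fin 3 → Fin 3 → P × R3 → ℂ := fun a b w =>
    fderiv ℝ (fun y => D b (w.1, y)) w.2 (EuclideanSpace.single a 1)
  have hD2 : ∀ a b (w : P × R3), w.2 ∈ e.target →
      ContMDiffAt (IP.prod (𝓡 3)) 𝓘(ℝ, ℂ) ∞ (D2 a b) w :=
    fun a b w hw => contMDiffAt_fderiv_param (hD b w hw) _
  let c : Fin 3 → Fin 3 → R3 → ℂ := fun a b y =>
    ((sqrtDet h e y : ℝ) : ℂ) * (((gram h e y)⁻¹ a b : ℝ) : ℂ)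
  have hc : ∀ a b, ContDiffOn ℝ 1 (c a b) e.target := fun a b =>
    (Complex.ofRealCLM.contDiff.comp_contDiffOn (contDiffOn_sqrtDet hh he)).mul
      (Complex.ofRealCLM.contDiff.comp_contDiffOn (contDiffOn_gram_inv hh he a b))
  have hlap : ∀ w : P × R3, w.2 ∈ e.target → laplC h e (fun x => F (w.1, x)) w.2 =
      ((sqrtDet h e w.2 : ℝ) : ℂ)⁻¹ * ∑ a : Fin 3, ∑ b : Fin 3,
        (c a b w.2 * D2 a b w + D b w * fderiv ℝ (c a b) w.2 (EuclideanSpace.single a 1)) := by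
    intro w hw
    rw [laplC]
    congr 1
    refine Finset.sum_congr rfl fun a _ => ?_
    have hfl : flux h e (fun x => F (w.1, x)) a = fun y => ∑ b, c a b y * D b (w.1, y) := by
      ext y
      simp only [flux, Finset.mul_sum, c, D, G, pd, Function.comp_def, mul_assoc]
    have hdc : ∀ b, DifferentiableAt ℝ (c a b) w.2 := fun b =>
      ((hc a b).differentiableOn (by simp)).differentiableAt (e.open_target.mem_nhds hw)
    have hdD : ∀ b, DifferentiableAt ℝ (fun y => D b (w.1, y)) w.2 := fun b => by
      have h1 : ContMDiffAt (𝓡 3) 𝓘(ℝ, ℂ) ∞ (fun y : R3 => D b (w.1, y)) w.2 :=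
        ContMDiffAt.comp (g := D b) (f := fun y : R3 => (w.1, y)) w.2 (hD b w hw)
          (contMDiffAt_const.prodMk contMDiffAt_id)
      exact (contMDiffAt_iff_contDiffAt.1 h1).differentiableAt (by simp)
    rw [hfl, fderiv_fun_sum (A := fun b y => c a b y * D b (w.1, y))
      fun b _ => (hdc b).mul (hdD b), _root_.sum_apply]
    refine Finset.sum_congr rfl fun b _ => ?_
    rw [fderiv_fun_mul (hdc b) (hdD b)]
    simp [D2]
  have hnhds : e.source ∈ 𝓝 x₀ := e.open_source.mem_nhds hx₀
  have hcont : ContinuousAt (fun w : P × R3 => ((sqrtDet h e w.2 : ℝ) : ℂ)⁻¹ *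
      ∑ a : Fin 3, ∑ b : Fin 3, (c a b w.2 * D2 a b w +
        D b w * fderiv ℝ (c a b) w.2 (EuclideanSpace.single a 1))) (p₀, e x₀) := by
    have cont2 : ∀ {k : R3 → ℂ}, ContinuousOn k e.target →
        ContinuousAt (fun w : P × R3 => k w.2) (p₀, e x₀) := fun hk =>
      ContinuousAt.comp (f := fun w : P × R3 => w.2) (x := (p₀, e x₀))
        (hk.continuousAt (e.open_target.mem_nhds hy₀)) continuousAt_snd
    refine ContinuousAt.mul (cont2 (k := fun y => ((sqrtDet h e y : ℝ) : ℂ)⁻¹) ?_) ?_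
    · exact (Complex.continuous_ofReal.comp_continuousOn
        (contDiffOn_sqrtDet hh he).continuousOn).inv₀
        fun x hx => Complex.ofReal_ne_zero.2 (sqrtDet_pos h he hx).ne'
    · refine tendsto_finsetSum _ fun a _ => tendsto_finsetSum _ fun b _ => ?_
      refine ((cont2 (hc a b).continuousOn).mul (hD2 a b _ hy₀).continuousAt).add
        ((hD b _ hy₀).continuousAt.mul
          (cont2 (k := fun y => fderiv ℝ (c a b) y (EuclideanSpace.single a 1)) ?_))
      exact ((hc a b).continuousOn_fderiv_of_isOpen e.open_target le_rfl).clm_apply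
        continuousOn_const
  have hmap : ContinuousAt (fun q : P × S => (q.1, e q.2)) (p₀, x₀) :=
    continuousAt_fst.prodMk (ContinuousAt.comp (f := fun q : P × S => q.2) (x := (p₀, x₀))
      (e.continuousAt hx₀) continuousAt_snd)
  refine (ContinuousAt.comp (f := fun q : P × S => (q.1, e q.2)) (x := (p₀, x₀))
    hcont hmap).congr ?_
  filter_upwards [(continuous_snd (X := P) (Y := S)).continuousAt.preimage_mem_nhds
    (x := (p₀, x₀)) hnhds] with q hq
  have hq' : q.2 ∈ e.source := hq
  rw [lapl_eq_chart hh he (slice_mem_smooth1 hF q.1) hq']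
  exact (hlap (q.1, e q.2) (e.map_source hq')).symm

lemma continuous_lapl2 (hh : IsC11 h) {a : S × S → ℂ} (ha : a ∈ smooth2 S) :
    (Continuous fun q : S × S => lapl h (fun x => a (x, q.2)) q.1) ∧
      (Continuous fun q : S × S => lapl h (fun y => a (q.1, y)) q.2) ∧ Continuous (lapl2 h a) := by
  have ha' : ContMDiff ((𝓡 3).prod (𝓡 3)) 𝓘(ℝ, ℂ) ∞ a := ha
  have h1 : ContMDiff ((𝓡 3).prod (𝓡 3)) 𝓘(ℝ, ℂ) ∞ fun q : S × S => a (q.2, q.1) :=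
    ha'.comp (contMDiff_snd.prodMk contMDiff_fst)
  have c1 := (continuous_lapl_param hh h1).comp continuous_swap
  have c2 := continuous_lapl_param hh ha'
  exact ⟨c1, c2, c1.add c2⟩

end ParametersLaplacian

/-! ### Tensor products and partial pairings in `L²` -/

section TensorProducts

variable {X Y : Type*} [MeasurableSpace X] [MeasurableSpace Y] {μ : Measure X} {ν : Measure Y}

lemma inner_eq_integral (f g : Lp ℂ 2 μ) :
    inner ℂ f g = ∫ x, starRingEnd ℂ (f x) * g x ∂μ := by
  rw [L2.inner_def]
  simp only [RCLike.inner_apply, mul_comm]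

lemma integrable_conj_mul (f g : Lp ℂ 2 μ) :
    Integrable (fun x => starRingEnd ℂ (f x) * g x) μ := by
  have := L2.integrable_inner (𝕜 := ℂ) f g
  simpa only [RCLike.inner_apply, mul_comm] using this

variable [SigmaFinite μ] [SigmaFinite ν]

lemma memLp_tensor {f : X → ℂ} {g : Y → ℂ} (hf : MemLp f 2 μ) (hg : MemLp g 2 ν) :
    MemLp (fun p : X × Y => f p.1 * g p.2) 2 (μ.prod ν) := by
  refine (memLp_two_iff_integrable_sq_norm (show AEStronglyMeasurable
    (fun p : X × Y => f p.1 * g p.2) (μ.prod ν) from hf.1.comp_fst.mul hg.1.comp_snd)).2 ?_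
  have := ((memLp_two_iff_integrable_sq_norm hf.1).1 hf).mul_prod
    ((memLp_two_iff_integrable_sq_norm hg.1).1 hg)
  simpa only [norm_mul, mul_pow] using this

/-- The tensor product of two square integrable functions. -/
def tens (f : Lp ℂ 2 μ) (g : Lp ℂ 2 ν) : Lp ℂ 2 (μ.prod ν) :=
  (memLp_tensor (Lp.memLp f) (Lp.memLp g)).toLp

lemma coeFn_tens (f : Lp ℂ 2 μ) (g : Lp ℂ 2 ν) :
    tens f g =ᵐ[μ.prod ν] fun p => f p.1 * g p.2 := MemLp.coeFn_toLp _

omit [SigmaFinite μ] in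
lemma ae_prod_mk {f f' : X → ℂ} {g g' : Y → ℂ} (hf : f =ᵐ[μ] f') (hg : g =ᵐ[ν] g') :
    (fun p : X × Y => f p.1 * g p.2) =ᵐ[μ.prod ν] fun p => f' p.1 * g' p.2 := by
  filter_upwards [Measure.quasiMeasurePreserving_fst.ae_eq_comp hf,
    Measure.quasiMeasurePreserving_snd.ae_eq_comp hg] with p h1 h2
  simp only [Function.comp_apply] at h1 h2
  rw [h1, h2]

lemma tens_eq_of_ae {f : Lp ℂ 2 μ} {g : Lp ℂ 2 ν} {f' : X → ℂ} {g' : Y → ℂ} (hf : f =ᵐ[μ] f')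
    (hg : g =ᵐ[ν] g') : tens f g =ᵐ[μ.prod ν] fun p => f' p.1 * g' p.2 :=
  (coeFn_tens f g).trans (ae_prod_mk hf hg)

lemma inner_tens_tens (f f' : Lp ℂ 2 μ) (g g' : Lp ℂ 2 ν) :
    inner ℂ (tens f g) (tens f' g') = inner ℂ f f' * inner ℂ g g' := by
  rw [inner_eq_integral, inner_eq_integral, inner_eq_integral, ← integral_prod_mul]
  refine integral_congr_ae ?_
  filter_upwards [coeFn_tens f g, coeFn_tens f' g'] with p h1 h2
  rw [h1, h2, map_mul]
  ring

lemma norm_tens (f : Lp ℂ 2 μ) (g : Lp ℂ 2 ν) : ‖tens f g‖ = ‖f‖ * ‖g‖ := by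
  have h := inner_tens_tens f f g g
  rw [inner_self_eq_norm_sq_to_K, inner_self_eq_norm_sq_to_K, inner_self_eq_norm_sq_to_K] at h
  norm_cast at h
  rw [← mul_pow] at h
  exact (sq_eq_sq₀ (norm_nonneg _) (by positivity)).1 h

/-- The tensor product as a bilinear map. -/
def tensBilin : Lp ℂ 2 μ →ₗ[ℂ] Lp ℂ 2 ν →ₗ[ℂ] Lp ℂ 2 (μ.prod ν) :=
  LinearMap.mk₂ ℂ tens
    (fun f f' g => by
      refine Lp.ext ((coeFn_tens _ _).trans ?_)
      filter_upwards [Lp.coeFn_add (tens f g) (tens f' g), coeFn_tens f g, coeFn_tens f' g,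
        ae_prod_mk (Lp.coeFn_add f f') (EventuallyEq.refl _ g)] with p h1 h2 h3 h4
      rw [h4, h1, Pi.add_apply, Pi.add_apply, h2, h3, add_mul])
    (fun c f g => by
      refine Lp.ext ((coeFn_tens _ _).trans ?_)
      filter_upwards [Lp.coeFn_smul c (tens f g), coeFn_tens f g,
        ae_prod_mk (Lp.coeFn_smul c f) (EventuallyEq.refl _ g)] with p h1 h2 h4
      rw [h4, h1, Pi.smul_apply, Pi.smul_apply, h2, smul_mul_assoc])
    (fun f g g' => by
      refine Lp.ext ((coeFn_tens _ _).trans ?_)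
      filter_upwards [Lp.coeFn_add (tens f g) (tens f g'), coeFn_tens f g, coeFn_tens f g',
        ae_prod_mk (EventuallyEq.refl _ f) (Lp.coeFn_add g g')] with p h1 h2 h3 h4
      rw [h4, h1, Pi.add_apply, Pi.add_apply, h2, h3, mul_add])
    (fun c f g => by
      refine Lp.ext ((coeFn_tens _ _).trans ?_)
      filter_upwards [Lp.coeFn_smul c (tens f g), coeFn_tens f g,
        ae_prod_mk (EventuallyEq.refl _ f) (Lp.coeFn_smul c g)] with p h1 h2 h4
      rw [h4, h1, Pi.smul_apply, Pi.smul_apply, h2, mul_smul_comm])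

/-- The tensor product as a continuous bilinear map. -/
def tensCLM : Lp ℂ 2 μ →L[ℂ] Lp ℂ 2 ν →L[ℂ] Lp ℂ 2 (μ.prod ν) :=
  tensBilin.mkContinuous₂ 1 fun f g => by
    rw [one_mul]
    exact (norm_tens f g).le

/-- The isometry `f ↦ f ⊗ g` for a unit vector `g`. -/
def tensIsometry (μ : Measure X) [SigmaFinite μ] (g : Lp ℂ 2 ν) (hg : ‖g‖ = 1) :
    Lp ℂ 2 μ →ₗᵢ[ℂ] Lp ℂ 2 (μ.prod ν) where
  toLinearMap := tensBilin.flip g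
  norm_map' f := by
    change ‖tens f g‖ = ‖f‖
    rw [norm_tens, hg, mul_one]

@[simp] lemma tensIsometry_apply (f : Lp ℂ 2 μ) (g : Lp ℂ 2 ν) (hg : ‖g‖ = 1) :
    tensIsometry μ g hg f = tens f g := rfl

/-- The partial pairing with `g`, which is the adjoint of `f ↦ f ⊗ g`. -/
def partialPair (μ : Measure X) [SigmaFinite μ] (g : Lp ℂ 2 ν) :
    Lp ℂ 2 (μ.prod ν) →L[ℂ] Lp ℂ 2 μ :=
  ContinuousLinearMap.adjoint ((tensCLM (μ := μ)).flip g)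

lemma inner_partialPair_right (f : Lp ℂ 2 μ) (g : Lp ℂ 2 ν) (U : Lp ℂ 2 (μ.prod ν)) :
    inner ℂ f (partialPair μ g U) = inner ℂ (tens f g) U := by
  rw [partialPair, ContinuousLinearMap.adjoint_inner_right]
  rfl

lemma integrable_tensor_mul {f : X → ℂ} (hf : MemLp f 2 μ) (g : Lp ℂ 2 ν)
    (U : Lp ℂ 2 (μ.prod ν)) :
    Integrable (fun p : X × Y => f p.1 * (starRingEnd ℂ (g p.2) * U p)) (μ.prod ν) := by
  have h1 : MemLp (fun p : X × Y => f p.1 * starRingEnd ℂ (g p.2)) 2 (μ.prod ν) :=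
    memLp_tensor hf (Lp.memLp g).star
  have := h1.integrable_mul (Lp.memLp U)
  refine this.congr (Eventually.of_forall fun p => ?_)
  simp only [Pi.mul_apply, mul_assoc]

/-- The abstract adjoint is tested against indicators of sets of finite measure; Fubini identifies
it with integration over the slice. -/
lemma coeFn_partialPair (g : Lp ℂ 2 ν) (U : Lp ℂ 2 (μ.prod ν)) :
    partialPair μ g U =ᵐ[μ] fun x => ∫ y, starRingEnd ℂ (g y) * U (x, y) ∂ν := by
  have hint : ∀ A, MeasurableSet A → μ A < ⊤ →
      Integrable (fun p : X × Y => A.indicator (fun _ => (1 : ℂ)) p.1 *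
        (starRingEnd ℂ (g p.2) * U p)) (μ.prod ν) := fun A hA hμ =>
    integrable_tensor_mul (memLp_indicator_const 2 hA 1 (Or.inr hμ.ne)) g U
  have hslice : ∀ (A : Set X) (x : X), ∫ y, A.indicator (fun _ => (1 : ℂ)) x *
      (starRingEnd ℂ (g y) * U (x, y)) ∂ν =
      A.indicator (fun x => ∫ y, starRingEnd ℂ (g y) * U (x, y) ∂ν) x := by
    intro A x
    rw [integral_const_mul]
    by_cases hx : x ∈ A <;> simp [hx]
  refine ae_eq_of_forall_setIntegral_eq_of_sigmaFinite (fun A hA hμ => ?_) (fun A hA hμ => ?_)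
    fun A hA hμ => ?_
  · exact integrableOn_Lp_of_measure_ne_top _ fact_one_le_two_ennreal.elim hμ.ne
  · have := (hint A hA hμ).integral_prod_left
    simp only [hslice] at this
    exact (integrable_indicator_iff hA).1 this
  · have h1 : ∫ x in A, (partialPair μ g U) x ∂μ =
        inner ℂ (indicatorConstLp 2 hA hμ.ne (1 : ℂ)) (partialPair μ g U) := by
      rw [L2.inner_indicatorConstLp_one]
    rw [h1, inner_partialPair_right, inner_eq_integral]
    have h2 := integral_prod _ (hint A hA hμ)
    simp only [hslice] at h2
    rw [integral_indicator hA] at h2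
    rw [← h2]
    refine integral_congr_ae ?_
    filter_upwards [tens_eq_of_ae (f := indicatorConstLp 2 hA hμ.ne (1 : ℂ)) (g := g)
      indicatorConstLp_coeFn (EventuallyEq.refl _ _)] with p hp
    rw [hp, map_mul, mul_assoc]
    congr 1
    by_cases hx : p.1 ∈ A <;> simp [hx]

/-- A square integrable function on a product is determined by its partial pairings with a basis. -/
lemma eq_zero_of_partialPair {ι : Type*} [Countable ι] (b : HilbertBasis ι ℂ (Lp ℂ 2 ν))
    (U : Lp ℂ 2 (μ.prod ν)) (h : ∀ i, partialPair μ (b i) U = 0) : U = 0 := by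
  -- Countability gives one null set for all basis vectors; almost every slice is then orthogonal to
  -- the whole basis.
  have h1 : ∀ᵐ x ∂μ, ∀ i, ∫ y, starRingEnd ℂ (b i y) * U (x, y) ∂ν = 0 := by
    rw [ae_all_iff]
    intro i
    have h2 := coeFn_partialPair (b i) U
    rw [h i] at h2
    filter_upwards [h2, Lp.coeFn_zero ℂ 2 μ] with x hx hx0
    rw [← hx, hx0, Pi.zero_apply]
  have hU := Lp.memLp U
  have h3 : ∀ᵐ x ∂μ, MemLp (fun y => U (x, y)) 2 ν := by
    filter_upwards [hU.1.prodMk_left,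
      ((memLp_two_iff_integrable_sq_norm hU.1).1 hU).prod_right_ae] with x hx1 hx2
    exact (memLp_two_iff_integrable_sq_norm hx1).2 hx2
  have h4 : ∀ᵐ x ∂μ, ∀ᵐ y ∂ν, U (x, y) = 0 := by
    filter_upwards [h1, h3] with x hx1 hx3
    have h5 : hx3.toLp = 0 := by
      refine b.repr.injective (by
        ext i
        rw [b.repr_apply_apply, inner_eq_integral, map_zero]
        simp only [lp.coeFn_zero, Pi.zero_apply]
        rw [← hx1 i]
        refine integral_congr_ae ?_
        filter_upwards [hx3.coeFn_toLp] with y hy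
        rw [hy])
    have h6 := hx3.coeFn_toLp
    rw [h5] at h6
    filter_upwards [h6, Lp.coeFn_zero ℂ 2 ν] with y hy hy0
    rw [← hy, hy0, Pi.zero_apply]
  refine (Lp.eq_zero_iff_ae_eq_zero).2 ?_
  have hm : AEMeasurable (fun p => ‖U p‖ₑ) (μ.prod ν) := hU.1.enorm
  have h7 : ∫⁻ p, ‖U p‖ₑ ∂(μ.prod ν) = 0 := by
    rw [lintegral_prod _ hm]
    refine (lintegral_congr_ae ?_).trans lintegral_zero
    filter_upwards [h4] with x hx
    refine (lintegral_congr_ae ?_).trans lintegral_zero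
    filter_upwards [hx] with y hy
    simp [hy]
  rw [lintegral_eq_zero_iff' hm] at h7
  filter_upwards [h7] with p hp
  simpa using hp

/-- Completeness: an element orthogonal to all the ranges has zero partial pairing with each basis
vector. -/
lemma isHilbertSum_tens {ι : Type*} [Countable ι] (b : HilbertBasis ι ℂ (Lp ℂ 2 ν)) :
    IsHilbertSum ℂ (fun _ : ι => Lp ℂ 2 μ)
      (fun i => tensIsometry μ (b i) (b.orthonormal.1 i)) := by
  refine IsHilbertSum.mk (fun i j hij f f' => ?_) ?_
  · simp only [tensIsometry_apply]
    rw [inner_tens_tens, b.orthonormal.2 hij, mul_zero]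
  · rw [top_le_iff, Submodule.topologicalClosure_eq_top_iff, Submodule.eq_bot_iff]
    intro U hU
    refine eq_zero_of_partialPair b U fun i => ?_
    refine ext_inner_left ℂ fun f => ?_
    rw [inner_partialPair_right, inner_zero_right]
    exact hU _ (Submodule.mem_iSup_of_mem i ⟨f, rfl⟩)

lemma orthonormal_tens {ι κ : Type*} {a : ι → Lp ℂ 2 μ} {b : κ → Lp ℂ 2 ν}
    (ha : Orthonormal ℂ a) (hb : Orthonormal ℂ b) :
    Orthonormal ℂ (fun ik : ι × κ => tens (a ik.1) (b ik.2)) := by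
  refine ⟨fun ik => by rw [norm_tens, ha.1, hb.1, mul_one], fun ik jl hne => ?_⟩
  change inner ℂ (tens _ _) (tens _ _) = 0
  rw [inner_tens_tens]
  by_cases h1 : ik.1 = jl.1
  · rw [hb.2 fun h2 => hne (Prod.ext h1 h2), mul_zero]
  · rw [ha.2 h1, zero_mul]

/-- The Hilbert basis of tensor products. -/
def prodBasis {ι κ : Type*} [Countable κ] (a : HilbertBasis ι ℂ (Lp ℂ 2 μ))
    (b : HilbertBasis κ ℂ (Lp ℂ 2 ν)) : HilbertBasis (ι × κ) ℂ (Lp ℂ 2 (μ.prod ν)) :=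
  HilbertBasis.mkOfOrthogonalEqBot (v := fun ik : ι × κ => tens (a ik.1) (b ik.2))
    (orthonormal_tens a.orthonormal b.orthonormal)
    (by
      rw [Submodule.eq_bot_iff]
      intro U hU
      refine eq_zero_of_partialPair b U fun k => a.repr.injective ?_
      ext i
      rw [a.repr_apply_apply, inner_partialPair_right, map_zero]
      exact hU _ (Submodule.subset_span ⟨(i, k), rfl⟩))

lemma prodBasis_apply {ι κ : Type*} [Countable κ] (a : HilbertBasis ι ℂ (Lp ℂ 2 μ))
    (b : HilbertBasis κ ℂ (Lp ℂ 2 ν)) (ik : ι × κ) :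
    prodBasis a b ik = tens (a ik.1) (b ik.2) := by
  exact congrFun (HilbertBasis.coe_mkOfOrthogonalEqBot _ _) ik

end TensorProducts

/-! ### Multiplication operators and their continuous calculus -/

section Multipliers

open unitInterval

variable {X : Type*} [MeasurableSpace X] {κ : Measure X}

lemma memLp_bounded_mul {f : X → ℂ} (hf : Measurable f) {C : ℝ} (hC : ∀ x, ‖f x‖ ≤ C)
    {u : X → ℂ} (hu : MemLp u 2 κ) : MemLp (fun x => f x * u x) 2 κ := by
  refine MemLp.of_le_mul (c := C) hu (hf.aestronglyMeasurable.mul hu.1) ?_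
  refine Eventually.of_forall fun x => ?_
  rw [norm_mul]
  exact mul_le_mul_of_nonneg_right (hC x) (norm_nonneg _)

lemma norm_apply_le_norm (f : C(I, ℝ)) (x : I) : ‖((f x : ℝ) : ℂ)‖ ≤ ‖f‖ := by
  rw [Complex.norm_real]
  exact f.norm_coe_le_norm x

variable {t : X → I} (ht : Measurable t)

include ht in
lemma memLp_comp_mul (f : C(I, ℝ)) (u : Lp ℂ 2 κ) :
    MemLp (fun x => ((f (t x) : ℝ) : ℂ) * u x) 2 κ :=
  memLp_bounded_mul (Complex.measurable_ofReal.comp (f.continuous.measurable.comp ht))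
    (fun x => norm_apply_le_norm f (t x)) (Lp.memLp u)

/-- Multiplication by `f ∘ t` on `L²`. -/
def multLin (κ : Measure X) (ht : Measurable t) (f : C(I, ℝ)) : Lp ℂ 2 κ →ₗ[ℂ] Lp ℂ 2 κ where
  toFun u := (memLp_comp_mul ht f u).toLp
  map_add' u v := by
    refine Lp.ext ((MemLp.coeFn_toLp _).trans ?_)
    filter_upwards [Lp.coeFn_add u v, Lp.coeFn_add (memLp_comp_mul ht f u).toLp
      (memLp_comp_mul ht f v).toLp, (memLp_comp_mul ht f u).coeFn_toLp,
      (memLp_comp_mul ht f v).coeFn_toLp] with x h1 h2 h3 h4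
    rw [h1, h2, Pi.add_apply, Pi.add_apply, h3, h4, mul_add]
  map_smul' c u := by
    refine Lp.ext ((MemLp.coeFn_toLp _).trans ?_)
    filter_upwards [Lp.coeFn_smul c u, Lp.coeFn_smul c (memLp_comp_mul ht f u).toLp,
      (memLp_comp_mul ht f u).coeFn_toLp] with x h1 h2 h3
    rw [h1, RingHom.id_apply, h2, Pi.smul_apply, Pi.smul_apply, h3, mul_smul_comm]

/-- Multiplication by `f ∘ t` on `L²`, as a bounded operator. -/
def mult (κ : Measure X) (ht : Measurable t) (f : C(I, ℝ)) : Lp ℂ 2 κ →L[ℂ] Lp ℂ 2 κ :=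
  (multLin κ ht f).mkContinuous ‖f‖ fun u => by
    refine Lp.norm_le_mul_norm_of_ae_le_mul ?_
    filter_upwards [(memLp_comp_mul ht f u).coeFn_toLp] with x hx
    change ‖(memLp_comp_mul ht f u).toLp _ x‖ ≤ _
    rw [hx, norm_mul]
    exact mul_le_mul_of_nonneg_right (norm_apply_le_norm f (t x)) (norm_nonneg _)

lemma norm_mult_le (f : C(I, ℝ)) : ‖mult κ ht f‖ ≤ ‖f‖ :=
  LinearMap.mkContinuous_norm_le _ (norm_nonneg _) _

lemma coeFn_mult (f : C(I, ℝ)) (u : Lp ℂ 2 κ) :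
    mult κ ht f u =ᵐ[κ] fun x => ((f (t x) : ℝ) : ℂ) * u x :=
  (memLp_comp_mul ht f u).coeFn_toLp

/-- The functional calculus of the multiplication operator by `t`. -/
def multHom (κ : Measure X) (ht : Measurable t) : C(I, ℝ) →ₐ[ℝ] (Lp ℂ 2 κ →L[ℂ] Lp ℂ 2 κ) :=
  AlgHom.ofLinearMap
    { toFun := mult κ ht
      map_add' := fun f g => by
        refine ContinuousLinearMap.ext fun u => Lp.ext ?_
        filter_upwards [coeFn_mult ht (f + g) u, coeFn_mult ht f u, coeFn_mult ht g u,
          Lp.coeFn_add (mult κ ht f u) (mult κ ht g u)] with x h1 h2 h3 h4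
        rw [add_apply, h1, h4, Pi.add_apply, h2, h3, ContinuousMap.add_apply,
          Complex.ofReal_add, add_mul]
      map_smul' := fun c f => by
        refine ContinuousLinearMap.ext fun u => Lp.ext ?_
        filter_upwards [coeFn_mult ht (c • f) u, coeFn_mult ht f u,
          Lp.coeFn_smul c (mult κ ht f u)] with x h1 h2 h4
        rw [RingHom.id_apply, smul_apply, h1, h4, Pi.smul_apply, h2,
          ContinuousMap.smul_apply, smul_eq_mul, Complex.ofReal_mul, mul_assoc,
          Complex.real_smul] }
    (by
      refine ContinuousLinearMap.ext fun u => Lp.ext ?_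
      refine (coeFn_mult ht 1 u).trans (Eventually.of_forall fun x => ?_)
      simp)
    (fun f g => by
      refine ContinuousLinearMap.ext fun u => Lp.ext ?_
      change mult κ ht (f * g) u =ᵐ[κ] mult κ ht f (mult κ ht g u)
      filter_upwards [coeFn_mult ht (f * g) u, coeFn_mult ht f (mult κ ht g u),
        coeFn_mult ht g u] with x h1 h2 h3
      rw [h1, h2, h3, ContinuousMap.mul_apply, Complex.ofReal_mul, mul_assoc])

lemma inner_mult_left (f : C(I, ℝ)) (u v : Lp ℂ 2 κ) :
    inner ℂ (mult κ ht f u) v = inner ℂ u (mult κ ht f v) := by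
  rw [inner_eq_integral, inner_eq_integral]
  refine integral_congr_ae ?_
  filter_upwards [coeFn_mult ht f u, coeFn_mult ht f v] with x h1 h2
  rw [h1, h2, map_mul, Complex.conj_ofReal]
  ring

lemma inner_mult_self_nonneg {f : C(I, ℝ)} (hf : 0 ≤ f) (u : Lp ℂ 2 κ) :
    0 ≤ (inner ℂ (mult κ ht f u) u).re := by
  rw [inner_eq_integral, ← Complex.reCLM_apply, ← ContinuousLinearMap.integral_comp_comm _
    (integrable_conj_mul _ _)]
  refine integral_nonneg_of_ae ?_
  filter_upwards [coeFn_mult ht f u] with x h1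
  rw [Complex.reCLM_apply, h1, map_mul, Complex.conj_ofReal, mul_assoc, Complex.re_ofReal_mul,
    mul_comm (starRingEnd ℂ (u x)), Complex.mul_conj, Complex.ofReal_re]
  exact mul_nonneg (hf (t x)) (Complex.normSq_nonneg _)

end Multipliers

/-! ### Powers of a positive contraction -/

section FunctionalCalculus

open unitInterval

/-- The function `x ↦ x ^ α` on the unit interval. -/
def powI (α : ℝ) (hα : 0 ≤ α) : C(I, ℝ) :=
  ⟨fun x => (x : ℝ) ^ α, continuous_subtype_val.rpow_const fun _ => Or.inr hα⟩

/-- The inclusion of the unit interval in `ℝ`. -/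
def inclI : C(I, ℝ) := ⟨fun x => (x : ℝ), continuous_subtype_val⟩

variable {V : Type*} [NormedAddCommGroup V] [InnerProductSpace ℂ V] [CompleteSpace V]

/-- The powers of a positive contraction can be computed in every contractive functional
calculus. -/
lemma opRpow_eq_of_algHom (Φ : C(I, ℝ) →ₐ[ℝ] (V →L[ℂ] V)) (hΦ : ∀ f, ‖Φ f‖ ≤ ‖f‖)
    (hpos : (Φ inclI).IsPositive) (α : ℝ) (hα : 0 ≤ α) :
    opRpow (Φ inclI) α = Φ (powI α hα) := by
  set R := Φ inclI with hR
  have h0 : 0 ≤ R := (ContinuousLinearMap.nonneg_iff_isPositive R).2 hpos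
  have hsa : IsSelfAdjoint R := hpos.isSelfAdjoint
  have hn : ‖R‖ ≤ 1 := (hΦ _).trans <| (ContinuousMap.norm_le _ zero_le_one).2 fun x => by
    change ‖(x : ℝ)‖ ≤ 1
    rw [Real.norm_of_nonneg x.2.1]
    exact x.2.2
  have hspec : ∀ x ∈ spectrum ℝ R, x ∈ I := fun x hx => by
    refine ⟨spectrum_nonneg_of_nonneg h0 hx, ?_⟩
    have h1 := (spectrum.norm_le_norm_mul_of_mem hx)
    have h2 : ‖(1 : V →L[ℂ] V)‖ ≤ 1 := ContinuousLinearMap.norm_id_le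
    calc x ≤ ‖x‖ := le_abs_self x
      _ ≤ ‖R‖ * ‖(1 : V →L[ℂ] V)‖ := h1
      _ ≤ 1 * 1 := mul_le_mul hn h2 (norm_nonneg _) zero_le_one
      _ = 1 := one_mul 1
  rw [opRpow, show CFC.rpow R α = R ^ α from rfl, CFC.rpow_eq_cfc_real h0]
  refine eq_of_forall_dist_le fun ε hε => ?_
  have hcont : ContinuousOn (fun x : ℝ => x ^ α) (Set.Icc 0 1) :=
    (Real.continuous_rpow_const hα).continuousOn
  -- The spectrum lies in `[0, 1]`, where `x ^ α` is a uniform limit of polynomials. The two calculi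
  -- agree on polynomials and neither increases the supremum norm.
  obtain ⟨p, hp⟩ := exists_polynomial_near_of_continuousOn 0 1 _ hcont (ε / 2) (half_pos hε)
  have h1 : cfc (fun x => p.eval x) R = Φ (Polynomial.aeval inclI p) := by
    rw [cfc_polynomial p R hsa, hR, ← Polynomial.aeval_algHom_apply]
  have h2 : ‖cfc (fun x : ℝ => x ^ α) R - cfc (fun x => p.eval x) R‖ ≤ ε / 2 := by
    rw [← cfc_sub (fun x : ℝ => x ^ α) (fun x => p.eval x) R
      (hcont.mono hspec) p.continuous.continuousOn]
    refine norm_cfc_le (half_pos hε).le fun x hx => ?_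
    rw [Real.norm_eq_abs, abs_sub_comm]
    exact (hp x (hspec x hx)).le
  have h3 : ‖Φ (Polynomial.aeval inclI p) - Φ (powI α hα)‖ ≤ ε / 2 := by
    rw [← map_sub]
    refine (hΦ _).trans ((ContinuousMap.norm_le _ (half_pos hε).le).2 fun x => ?_)
    rw [Real.norm_eq_abs, ContinuousMap.sub_apply]
    have : (Polynomial.aeval inclI p) x = p.eval (x : ℝ) := by
      rw [Polynomial.aeval_continuousMap_apply]
      rfl
    rw [this]
    exact (hp x x.2).le
  rw [dist_eq_norm]
  calc _ = ‖(cfc (fun x : ℝ => x ^ α) R - cfc (fun x => p.eval x) R) +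
        (Φ (Polynomial.aeval inclI p) - Φ (powI α hα))‖ := by rw [h1]; congr 1; abel
    _ ≤ ε / 2 + ε / 2 := (norm_add_le _ _).trans (add_le_add h2 h3)
    _ = ε := add_halves ε

end FunctionalCalculus

/-! ### Products with a counting measure -/

section CountingMeasure

variable {X ι : Type*} [MeasurableSpace X] [MeasurableSpace ι] [MeasurableSingletonClass ι]
  [Countable ι] {μ : Measure X} [SigmaFinite μ]

/-- Splits `X × ι` into countably many copies of `X`, so that null sets, integrals and square
integrability reduce to slices. -/
lemma prod_count (μ : Measure X) [SigmaFinite μ] : μ.prod (Measure.count : Measure ι) =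
    Measure.sum fun i => μ.map fun x => (x, i) := by
  rw [Measure.count, Measure.prod_sum_right]
  simp only [Measure.prod_dirac]

lemma ae_prod_count {P : X × ι → Prop} :
    (∀ᵐ p ∂(μ.prod (Measure.count : Measure ι)), P p) ↔ ∀ i, ∀ᵐ x ∂μ, P (x, i) := by
  rw [prod_count, Measure.ae_sum_iff]
  exact forall_congr' fun i => (measurableEmbedding_prod_mk_right i).ae_map_iff

lemma lintegral_prod_count (f : X × ι → ℝ≥0∞) :
    ∫⁻ p, f p ∂(μ.prod (Measure.count : Measure ι)) = ∑' i, ∫⁻ x, f (x, i) ∂μ := by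
  rw [prod_count, lintegral_sum_measure]
  exact tsum_congr fun i => (measurableEmbedding_prod_mk_right i).lintegral_map _

lemma hasSum_integral_prod_count {f : X × ι → ℂ}
    (hf : Integrable f (μ.prod (Measure.count : Measure ι))) :
    HasSum (fun i => ∫ x, f (x, i) ∂μ) (∫ p, f p ∂(μ.prod (Measure.count : Measure ι))) := by
  rw [prod_count] at hf ⊢
  have h := hasSum_integral_measure hf
  simp only [(measurableEmbedding_prod_mk_right _).integral_map] at h
  exact h

lemma memLp_slice {f : X × ι → ℂ} (hf : MemLp f 2 (μ.prod (Measure.count : Measure ι))) (i : ι) :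
    MemLp (fun x => f (x, i)) 2 μ := by
  rw [prod_count] at hf
  have h1 := hf.mono_measure (Measure.le_sum _ i)
  exact (measurableEmbedding_prod_mk_right i).memLp_map_measure_iff.1 h1

/-- The unit mass at `i` in `L²` of the counting measure. -/
def unitMass (i : ι) : Lp ℂ 2 (Measure.count : Measure ι) :=
  indicatorConstLp 2 (measurableSet_singleton i) (by simp) (1 : ℂ)

lemma unitMass_apply (i j : ι) : unitMass i j = ({i} : Set ι).indicator (fun _ => (1 : ℂ)) j :=
  Measure.ae_count_iff.1 indicatorConstLp_coeFn j

lemma inner_unitMass (i : ι) (f : Lp ℂ 2 (Measure.count : Measure ι)) :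
    inner ℂ (unitMass i) f = f i := by
  rw [unitMass, L2.inner_indicatorConstLp_one, Measure.restrict_singleton, integral_smul_measure,
    integral_dirac]
  simp

/-- The unit masses are a Hilbert basis of `L²` of the counting measure. -/
def massBasis (ι : Type*) [MeasurableSpace ι] [MeasurableSingletonClass ι] [Countable ι] :
    HilbertBasis ι ℂ (Lp ℂ 2 (Measure.count : Measure ι)) :=
  HilbertBasis.mkOfOrthogonalEqBot (v := unitMass)
    (by
      classical
      rw [orthonormal_iff_ite]
      intro i j
      rw [inner_unitMass, unitMass_apply]
      by_cases hij : i = j <;> simp [hij])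
    (by
      rw [Submodule.eq_bot_iff]
      intro f hf
      refine Lp.eq_zero_iff_ae_eq_zero.2 (Measure.ae_count_iff.2 fun i => ?_)
      rw [← inner_unitMass]
      exact hf _ (Submodule.subset_span ⟨i, rfl⟩))

@[simp] lemma massBasis_apply (i : ι) : massBasis ι i = unitMass i :=
  congrFun (HilbertBasis.coe_mkOfOrthogonalEqBot _ _) i

lemma partialPair_unitMass (i : ι) (Y : Lp ℂ 2 (μ.prod (Measure.count : Measure ι))) :
    partialPair μ (unitMass i) Y =ᵐ[μ] fun x => Y (x, i) := by
  refine (coeFn_partialPair _ _).trans (Eventually.of_forall fun x => ?_)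
  change ∫ j, starRingEnd ℂ (unitMass i j) * Y (x, j) ∂Measure.count = Y (x, i)
  have : (fun j => starRingEnd ℂ (unitMass i j) * Y (x, j)) =
      ({i} : Set ι).indicator fun j => Y (x, j) := by
    funext j
    rw [unitMass_apply]
    by_cases hj : j = i <;> simp [hj]
  rw [this, integral_indicator (measurableSet_singleton i), Measure.restrict_singleton,
    integral_smul_measure, integral_dirac]
  simp

end CountingMeasure

/-! ### The unitary map of eigenfunction expansion -/

section SpectralTransform

variable {X Y ι : Type*} [MeasurableSpace X] [MeasurableSpace Y] {μ : Measure X} {ν : Measure Y}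
  [SigmaFinite μ] [SigmaFinite ν] [MeasurableSpace ι] [MeasurableSingletonClass ι] [Countable ι]

lemma isHilbertSum_tens_comp (F : Lp ℂ 2 μ ≃ₗᵢ[ℂ] Lp ℂ 2 μ) (b : HilbertBasis ι ℂ (Lp ℂ 2 ν)) :
    IsHilbertSum ℂ (fun _ : ι => Lp ℂ 2 μ)
      (fun i => (tensIsometry μ (b i) (b.orthonormal.1 i)).comp F.symm.toLinearIsometry) := by
  refine IsHilbertSum.mk (fun i j hij f f' => ?_) ?_
  · change inner ℂ (tens _ _) (tens _ _) = 0
    rw [inner_tens_tens, b.orthonormal.2 hij, mul_zero]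
  · rw [top_le_iff, Submodule.topologicalClosure_eq_top_iff, Submodule.eq_bot_iff]
    intro U hU
    refine eq_zero_of_partialPair b U fun i => ?_
    refine ext_inner_left ℂ fun f => ?_
    rw [inner_partialPair_right, inner_zero_right]
    refine hU _ (Submodule.mem_iSup_of_mem i ⟨F f, ?_⟩)
    change tens (F.symm (F f)) (b i) = _
    rw [F.symm_apply_apply]

/-- The unitary map that expands a function of two variables in a basis in the second variable
and applies `F` to the coefficients. -/
def spec (F : Lp ℂ 2 μ ≃ₗᵢ[ℂ] Lp ℂ 2 μ) (b : HilbertBasis ι ℂ (Lp ℂ 2 ν)) :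
    Lp ℂ 2 (μ.prod ν) ≃ₗᵢ[ℂ] Lp ℂ 2 (μ.prod (Measure.count : Measure ι)) :=
  (isHilbertSum_tens_comp F b).linearIsometryEquiv.trans
    (isHilbertSum_tens (massBasis ι)).linearIsometryEquiv.symm

lemma spec_tens (F : Lp ℂ 2 μ ≃ₗᵢ[ℂ] Lp ℂ 2 μ) (b : HilbertBasis ι ℂ (Lp ℂ 2 ν))
    (f : Lp ℂ 2 μ) (i : ι) : spec F b (tens f (b i)) = tens (F f) (unitMass i) := by
  classical
  have h1 := (isHilbertSum_tens_comp F b).linearIsometryEquiv_symm_apply_single (i := i) (F f)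
  have h2 : tens f (b i) = (isHilbertSum_tens_comp F b).linearIsometryEquiv.symm
      (lp.single 2 i (F f)) := by
    rw [h1]
    change _ = tens (F.symm (F f)) (b i)
    rw [F.symm_apply_apply]
  rw [spec, LinearIsometryEquiv.trans_apply, h2, LinearIsometryEquiv.apply_symm_apply,
    (isHilbertSum_tens (massBasis ι)).linearIsometryEquiv_symm_apply_single, tensIsometry_apply,
    massBasis_apply]

/-- `spec` is unitary and sends `f ⊗ b i` to `F f ⊗ unitMass i`, so inner products with these
tensors correspond. -/
lemma partialPair_spec (F : Lp ℂ 2 μ ≃ₗᵢ[ℂ] Lp ℂ 2 μ) (b : HilbertBasis ι ℂ (Lp ℂ 2 ν))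
    (U : Lp ℂ 2 (μ.prod ν)) (i : ι) :
    partialPair μ (unitMass i) (spec F b U) = F (partialPair μ (b i) U) := by
  refine ext_inner_left ℂ fun f => ?_
  obtain ⟨f, rfl⟩ := F.surjective f
  rw [inner_partialPair_right, ← spec_tens F b, LinearIsometryEquiv.inner_map_map,
    LinearIsometryEquiv.inner_map_map, inner_partialPair_right]

lemma spec_ae (F : Lp ℂ 2 μ ≃ₗᵢ[ℂ] Lp ℂ 2 μ) (b : HilbertBasis ι ℂ (Lp ℂ 2 ν))
    (U : Lp ℂ 2 (μ.prod ν)) (i : ι) :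
    (fun x => spec F b U (x, i)) =ᵐ[μ] F (partialPair μ (b i) U) := by
  rw [← partialPair_spec]
  exact (partialPair_unitMass i _).symm

end SpectralTransform

/-! ### The bilinear pairing of square integrable functions -/

section BilinearPairing

variable {X : Type*} [MeasurableSpace X] {μ : Measure X}

/-- Distributions pair bilinearly. Conjugating the fixed factor turns the pairing into an inner
product, hence a continuous functional. -/
lemma integral_mul_eq_inner {c : X → ℂ} (hc : MemLp c 2 μ) (w : Lp ℂ 2 μ) :
    ∫ x, w x * c x ∂μ = inner ℂ (hc.star.toLp _) w := by
  rw [inner_eq_integral]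
  refine integral_congr_ae ?_
  filter_upwards [hc.star.coeFn_toLp] with x hx
  rw [hx, Pi.star_apply, RCLike.star_def, Complex.conj_conj, mul_comm]

lemma continuous_integral_mul {c : X → ℂ} (hc : MemLp c 2 μ) :
    Continuous fun w : Lp ℂ 2 μ => ∫ x, w x * c x ∂μ := by
  simp only [integral_mul_eq_inner hc]
  fun_prop

lemma memLp_of_continuous {X : Type*} [TopologicalSpace X] [CompactSpace X] [MeasurableSpace X]
    [BorelSpace X] [SecondCountableTopology X] {μ : Measure X} [IsFiniteMeasure μ] {c : X → ℂ}
    (hc : Continuous c) : MemLp c 2 μ :=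
  hc.memLp_of_hasCompactSupport (HasCompactSupport.of_compactSpace c)

end BilinearPairing

/-! ### Weak eigenvalue equations -/

section Eigenfunctions

variable {S : Type*} [TopologicalSpace S] [ChartedSpace R3 S] [T2Space S] [CompactSpace S]
  [SecondCountableTopology S] [IsManifold (𝓡 3) ∞ S] [MeasurableSpace S] [BorelSpace S]
  {h : Bundle.RiemannianMetric (fun p : S => TangentSpace (𝓡 3) p)} [IsFiniteMeasure (vol h)]
  {m : ℝ} {w v : Lp ℂ 2 (vol h)}

lemma continuous_of_mem_smooth1 {f : S → ℂ} (hf : f ∈ smooth1 S) : Continuous f :=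
  (show ContMDiff (𝓡 3) 𝓘(ℝ, ℂ) ∞ f from hf).continuous

lemma continuous_of_mem_smooth2 {a : S × S → ℂ} (ha : a ∈ smooth2 S) : Continuous a :=
  (show ContMDiff ((𝓡 3).prod (𝓡 3)) 𝓘(ℝ, ℂ) ∞ a from ha).continuous

/-- On smooth functions this is symmetry of `Δ_h`. Both sides are continuous in `(w, v)`, so it
survives the closure, where the eigenfunctions live. -/
lemma schrodingerGraph_integral (hh : IsC11 h) (hw : (w, v) ∈ schrodingerGraph h m) {f : S → ℂ}
    (hf : f ∈ smooth1 S) :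
    ∫ x, w x * ((m : ℂ) * f x - lapl h f x) ∂(vol h) = ∫ x, v x * f x ∂(vol h) := by
  have hcf := continuous_of_mem_smooth1 hf
  have hcl := continuous_lapl hh hf
  have hc1 : MemLp (fun x => (m : ℂ) * f x - lapl h f x) 2 (vol h) :=
    memLp_of_continuous (by fun_prop)
  have hc2 : MemLp f 2 (vol h) := memLp_of_continuous hcf
  have hclosed : IsClosed {p : Lp ℂ 2 (vol h) × Lp ℂ 2 (vol h) |
      ∫ x, p.1 x * ((m : ℂ) * f x - lapl h f x) ∂(vol h) = ∫ x, p.2 x * f x ∂(vol h)} :=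
    isClosed_eq ((continuous_integral_mul hc1).comp continuous_fst)
      ((continuous_integral_mul hc2).comp continuous_snd)
  refine closure_minimal ?_ hclosed hw
  rintro ⟨w, v⟩ ⟨u, hu, h1, h2⟩
  have hu' : u ∈ smooth1 S := hu
  have hcu := continuous_of_mem_smooth1 hu'
  have hclu := continuous_lapl hh hu'
  have hint : ∀ {c : S → ℂ}, Continuous c → Integrable c (vol h) := fun hc =>
    hc.integrable_of_hasCompactSupport (HasCompactSupport.of_compactSpace _)
  have e1 : ∫ x, w x * ((m : ℂ) * f x - lapl h f x) ∂(vol h) =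
      ∫ x, ((m : ℂ) * u x * f x - u x * lapl h f x) ∂(vol h) := by
    refine integral_congr_ae ?_
    filter_upwards [h1] with x hx
    rw [hx]
    ring
  have e2 : ∫ x, v x * f x ∂(vol h) =
      ∫ x, ((m : ℂ) * u x * f x - lapl h u x * f x) ∂(vol h) := by
    refine integral_congr_ae ?_
    filter_upwards [h2] with x hx
    rw [hx]
    ring
  change ∫ x, w x * ((m : ℂ) * f x - lapl h f x) ∂(vol h) = ∫ x, v x * f x ∂(vol h)
  rw [e1, e2, integral_sub (hint (by fun_prop)) (hint (by fun_prop)),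
    integral_sub (hint (by fun_prop)) (hint (by fun_prop)), integral_lapl_mul_comm hh hu' hf]

/-- A closed condition, which holds on smooth functions because `-Δ_h` is nonnegative. -/
lemma schrodingerGraph_re_inner (hh : IsC11 h) (hw : (w, v) ∈ schrodingerGraph h m) :
    m * ‖w‖ ^ 2 ≤ (inner ℂ w v).re := by
  set A : Set (Lp ℂ 2 (vol h) × Lp ℂ 2 (vol h)) :=
    {p | m * ‖p.1‖ ^ 2 ≤ (inner ℂ p.1 p.2).re} with hA
  have hclosed : IsClosed A := by
    refine isClosed_le ((continuous_fst.norm.pow 2).const_mul m) ?_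
    exact Complex.continuous_re.comp continuous_inner
  suffices hsub : opGraph (vol h) (smooth1 S : Set (S → ℂ))
      (fun f p => (m : ℂ) * f p - lapl h f p) ⊆ A by
    rw [schrodingerGraph] at hw
    have h2 := closure_minimal hsub hclosed hw
    rwa [hA] at h2
  rintro ⟨w, v⟩ ⟨u, hu, h1, h2⟩
  have hu' : u ∈ smooth1 S := hu
  have hcu := continuous_of_mem_smooth1 hu'
  have hclu := continuous_lapl hh hu'
  have hint : ∀ {c : S → ℂ}, Continuous c → Integrable c (vol h) := fun hc =>
    hc.integrable_of_hasCompactSupport (HasCompactSupport.of_compactSpace _)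
  have hcc : Continuous fun x => starRingEnd ℂ (u x) := Complex.continuous_conj.comp hcu
  have e1 : inner ℂ w v = (m : ℂ) * inner ℂ w w -
      ∫ x, lapl h u x * starRingEnd ℂ (u x) ∂(vol h) := by
    rw [inner_eq_integral, inner_eq_integral, ← integral_const_mul, ← integral_sub
      ((integrable_conj_mul w w).const_mul _) (hint (by fun_prop))]
    refine integral_congr_ae ?_
    filter_upwards [h1, h2] with x hx hx2
    rw [hx, hx2]
    ring
  change m * ‖w‖ ^ 2 ≤ (inner ℂ w v).re
  have e2 := integral_lapl_mul_conj_re_nonpos hh hu'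
  rw [e1, inner_self_eq_norm_sq_to_K, Complex.sub_re]
  have e3 : ((m : ℂ) * ((‖w‖ : ℝ) : ℂ) ^ 2).re = m * ‖w‖ ^ 2 := by
    rw [← Complex.ofReal_pow, ← Complex.ofReal_mul, Complex.ofReal_re]
  change m * ‖w‖ ^ 2 ≤ ((m : ℂ) * ((‖w‖ : ℝ) : ℂ) ^ 2).re - _
  rw [e3]
  linarith

variable {l : ℝ}

/-- This makes `ν_jk` nonnegative, so that the symbol of `I - Δ` is at least one. -/
lemma le_sq_of_eigen (hh : IsC11 h) (hw : (w, ((l : ℂ) ^ 2) • w) ∈ schrodingerGraph h m)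
    (hn : ‖w‖ = 1) : m ≤ l ^ 2 := by
  have h1 := schrodingerGraph_re_inner hh hw
  rw [inner_smul_right, inner_self_eq_norm_sq_to_K, hn, one_pow, mul_one] at h1
  have h2 : ((l : ℂ) ^ 2 * (((1 : ℝ) : ℝ) : ℂ) ^ 2).re = l ^ 2 := by
    rw [← Complex.ofReal_pow, ← Complex.ofReal_pow, ← Complex.ofReal_mul, Complex.ofReal_re]
    ring
  exact h1.trans h2.le

lemma integral_lapl_mul_eigen (hh : IsC11 h)
    (hw : (w, ((l : ℂ) ^ 2) • w) ∈ schrodingerGraph h m) {f : S → ℂ} (hf : f ∈ smooth1 S) :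
    ∫ x, lapl h f x * w x ∂(vol h) = ((m - l ^ 2 : ℝ) : ℂ) * ∫ x, f x * w x ∂(vol h) := by
  have h1 := schrodingerGraph_integral hh hw hf
  have hcf := continuous_of_mem_smooth1 hf
  have hcl := continuous_lapl hh hf
  have hint : ∀ {c : S → ℂ}, Continuous c → Integrable (fun x => w x * c x) (vol h) := fun hc =>
    (Lp.memLp w).integrable_mul (memLp_of_continuous hc)
  have h2 : ∫ x, (((l : ℂ) ^ 2) • w) x * f x ∂(vol h) = (l : ℂ) ^ 2 * ∫ x, w x * f x ∂(vol h) := by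
    rw [← integral_const_mul]
    refine integral_congr_ae ?_
    filter_upwards [Lp.coeFn_smul ((l : ℂ) ^ 2) w] with x hx
    rw [hx, Pi.smul_apply, smul_eq_mul, mul_assoc]
  have h3 : ∫ x, w x * ((m : ℂ) * f x - lapl h f x) ∂(vol h) =
      (m : ℂ) * ∫ x, w x * f x ∂(vol h) - ∫ x, w x * lapl h f x ∂(vol h) := by
    rw [← integral_const_mul, ← integral_sub ((hint hcf).const_mul _) (hint hcl)]
    refine integral_congr_ae (Eventually.of_forall fun x => ?_)
    simp only
    ring
  rw [h2, h3] at h1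
  simp only [mul_comm _ (w _)]
  push_cast
  linear_combination -h1

lemma memLp_mul_prod (w v : Lp ℂ 2 (vol h)) :
    MemLp (fun q : S × S => w q.1 * v q.2) 2 (vol2 h) :=
  memLp_tensor (Lp.memLp w) (Lp.memLp v)

/-- Fubini and the weak eigenvalue equation in each variable: all derivatives stay on the smooth
slices of `a`. -/
lemma integral_lapl2_mul_eigen (hh : IsC11 h) {l' : ℝ}
    (hw : (w, ((l : ℂ) ^ 2) • w) ∈ schrodingerGraph h m)
    (hv : (v, ((l' : ℂ) ^ 2) • v) ∈ schrodingerGraph h m) {a : S × S → ℂ} (ha : a ∈ smooth2 S) :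
    ∫ q, lapl2 h a q * (w q.1 * v q.2) ∂(vol2 h) =
      ((m - l ^ 2 + (m - l' ^ 2) : ℝ) : ℂ) * ∫ q, a q * (w q.1 * v q.2) ∂(vol2 h) := by
  obtain ⟨hx, hy, -⟩ := continuous_lapl2 hh ha
  have hca := continuous_of_mem_smooth2 ha
  have ha' : ContMDiff ((𝓡 3).prod (𝓡 3)) 𝓘(ℝ, ℂ) ∞ a := ha
  have hint : ∀ {c : S × S → ℂ}, Continuous c →
      Integrable (fun q => c q * (w q.1 * v q.2)) (vol2 h) := fun hc =>
    (memLp_of_continuous hc).integrable_mul (memLp_mul_prod w v)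
  have e1 : ∫ q, lapl h (fun x => a (x, q.2)) q.1 * (w q.1 * v q.2) ∂(vol2 h) =
      ((m - l ^ 2 : ℝ) : ℂ) * ∫ q, a q * (w q.1 * v q.2) ∂(vol2 h) := by
    rw [integral_prod_symm _ (hint hx), integral_prod_symm _ (hint hca), ← integral_const_mul]
    refine integral_congr_ae (Eventually.of_forall fun y => ?_)
    have hs : (fun x => a (x, y)) ∈ smooth1 S := ha'.comp (contMDiff_id.prodMk contMDiff_const)
    have := integral_lapl_mul_eigen hh hw hs
    simp only [← mul_assoc, integral_mul_const]
    rw [this]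
  have e2 : ∫ q, lapl h (fun y => a (q.1, y)) q.2 * (w q.1 * v q.2) ∂(vol2 h) =
      ((m - l' ^ 2 : ℝ) : ℂ) * ∫ q, a q * (w q.1 * v q.2) ∂(vol2 h) := by
    rw [integral_prod _ (hint hy), integral_prod _ (hint hca), ← integral_const_mul]
    refine integral_congr_ae (Eventually.of_forall fun x => ?_)
    have hs : (fun y => a (x, y)) ∈ smooth1 S := ha'.comp (contMDiff_const.prodMk contMDiff_id)
    have := integral_lapl_mul_eigen hh hv hs
    simp only [mul_left_comm _ (w _), integral_const_mul]
    rw [this]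
  simp only [lapl2, add_mul]
  rw [integral_add (hint hx) (hint hy), e1, e2]
  push_cast
  ring

end Eigenfunctions

/-! ### Linearity of the Laplacians -/

section Linearity

variable {S : Type*} [TopologicalSpace S] [ChartedSpace R3 S] [T2Space S] [CompactSpace S]
  [IsManifold (𝓡 3) ∞ S]
  {h : Bundle.RiemannianMetric (fun p : S => TangentSpace (𝓡 3) p)} {f g : S → ℂ}

lemma lapl_smul (h : Bundle.RiemannianMetric (fun p : S => TangentSpace (𝓡 3) p)) (c : ℂ)
    (f : S → ℂ) (p : S) : lapl h (fun x => c * f x) p = c * lapl h f p := by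
  have h1 : ∀ (e : OpenPartialHomeomorph S R3) (b : Fin 3) (y : R3),
      pd e (fun x => c * f x) b y = c * pd e f b y := fun e b y => by
    have : (fun x => c * f x) ∘ e.symm = c • (f ∘ e.symm) := rfl
    rw [pd, this, fderiv_const_smul_field]
    rfl
  have h2 : ∀ (e : OpenPartialHomeomorph S R3) (a : Fin 3),
      flux h e (fun x => c * f x) a = c • flux h e f a := fun e a => by
    funext y
    simp only [flux, h1, Pi.smul_apply, smul_eq_mul, Finset.mul_sum]
    exact Finset.sum_congr rfl fun b _ => by ring
  simp only [lapl_eq_laplC, laplC, h2, fderiv_const_smul_field]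
  simp only [Pi.smul_apply, smul_apply, smul_eq_mul, Finset.mul_sum]
  exact Finset.sum_congr rfl fun b _ => by ring

lemma lapl_add (hh : IsC11 h) (hf : f ∈ smooth1 S) (hg : g ∈ smooth1 S) (p : S) :
    lapl h (fun x => f x + g x) p = lapl h f p + lapl h g p := by
  set e := chartAt R3 p
  have he : e ∈ atlas R3 S := chart_mem_atlas R3 p
  have hp : e p ∈ e.target := e.map_source (mem_chart_source R3 p)
  have h1 : ∀ (b : Fin 3), ∀ y ∈ e.target,
      pd e (fun x => f x + g x) b y = pd e f b y + pd e g b y := fun b y hy => by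
    have : (fun x => f x + g x) ∘ e.symm = (f ∘ e.symm) + (g ∘ e.symm) := rfl
    rw [pd, this, fderiv_add ((contDiffAt_comp_symm he hf hy).differentiableAt (by simp))
      ((contDiffAt_comp_symm he hg hy).differentiableAt (by simp))]
    rfl
  have h2 : ∀ (a : Fin 3),
      flux h e (fun x => f x + g x) a =ᶠ[𝓝 (e p)] flux h e f a + flux h e g a := fun a => by
    filter_upwards [e.open_target.mem_nhds hp] with y hy
    simp only [flux, Pi.add_apply, Finset.mul_sum, ← Finset.sum_add_distrib]
    exact Finset.sum_congr rfl fun b _ => by rw [h1 b y hy]; ring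
  have hd : ∀ {f : S → ℂ}, f ∈ smooth1 S → ∀ a, DifferentiableAt ℝ (flux h e f a) (e p) :=
    fun hf a => ((contDiffOn_flux hh he hf a).contDiffAt
      (e.open_target.mem_nhds hp)).differentiableAt (by simp)
  simp only [lapl_eq_laplC, laplC]
  rw [← mul_add, ← Finset.sum_add_distrib]
  congr 1
  refine Finset.sum_congr rfl fun a _ => ?_
  rw [(h2 a).fderiv_eq, fderiv_add (hd hf a) (hd hg a)]
  rfl

variable {a b : S × S → ℂ}

lemma slice_left_mem_smooth1 (ha : a ∈ smooth2 S) (y : S) : (fun x => a (x, y)) ∈ smooth1 S :=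
  (show ContMDiff ((𝓡 3).prod (𝓡 3)) 𝓘(ℝ, ℂ) ∞ a from ha).comp
    (contMDiff_id.prodMk contMDiff_const)

lemma slice_right_mem_smooth1 (ha : a ∈ smooth2 S) (x : S) : (fun y => a (x, y)) ∈ smooth1 S :=
  (show ContMDiff ((𝓡 3).prod (𝓡 3)) 𝓘(ℝ, ℂ) ∞ a from ha).comp
    (contMDiff_const.prodMk contMDiff_id)

lemma lapl2_smul (c : ℂ) (a : S × S → ℂ) (q : S × S) :
    lapl2 h (fun q => c * a q) q = c * lapl2 h a q := by
  rw [lapl2, lapl_smul h c fun x => a (x, q.2), lapl_smul h c fun y => a (q.1, y), lapl2, mul_add]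

lemma lapl2_add (hh : IsC11 h) (ha : a ∈ smooth2 S) (hb : b ∈ smooth2 S) (q : S × S) :
    lapl2 h (fun q => a q + b q) q = lapl2 h a q + lapl2 h b q := by
  rw [lapl2, lapl_add hh (slice_left_mem_smooth1 ha q.2) (slice_left_mem_smooth1 hb q.2),
    lapl_add hh (slice_right_mem_smooth1 ha q.1) (slice_right_mem_smooth1 hb q.1), lapl2, lapl2]
  ring

lemma lapl2_tensor (f g : S → ℂ) (q : S × S) :
    lapl2 h (fun q => f q.1 * g q.2) q = lapl h f q.1 * g q.2 + f q.1 * lapl h g q.2 := by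
  rw [lapl2, lapl_smul h (f q.1) g]
  simp only [mul_comm (f _)]
  rw [lapl_smul h (g q.2) f]
  ring

lemma tensor_mem_smooth2 (hf : f ∈ smooth1 S) (hg : g ∈ smooth1 S) :
    (fun q : S × S => f q.1 * g q.2) ∈ smooth2 S :=
  (contDiff_fst.mul contDiff_snd : ContDiff ℝ ∞ fun p : ℂ × ℂ => p.1 * p.2).contMDiff.comp <|
    ((show ContMDiff (𝓡 3) 𝓘(ℝ, ℂ) ∞ f from hf).comp contMDiff_fst).prodMk_space
    ((show ContMDiff (𝓡 3) 𝓘(ℝ, ℂ) ∞ g from hg).comp contMDiff_snd)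

end Linearity

/-! ### The eigenbasis of `L²(Σ²)` -/

section EigenBasis

/-- For `p` in the graph of `c - Δ` the vector `c • p.1 - p.2` stands for `Δ p.1`. The Leibniz rule
so expressed is continuous in both pairs, hence passes to the closures of the graphs. -/
lemma bilin_mem_closure {V W : Type*} [NormedAddCommGroup V] [NormedSpace ℂ V]
    [NormedAddCommGroup W] [NormedSpace ℂ W] (B : V →L[ℂ] V →L[ℂ] W) (c : ℂ) {A A' : Set (V × V)}
    {D : Set (W × W)} (hD : ∀ p ∈ A, ∀ p' ∈ A',
      (B p.1 p'.1, B (c • p.1 - p.2) p'.1 + B p.1 (c • p'.1 - p'.2)) ∈ D) {p p' : V × V}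
    (hp : p ∈ closure A) (hp' : p' ∈ closure A') :
    (B p.1 p'.1, B (c • p.1 - p.2) p'.1 + B p.1 (c • p'.1 - p'.2)) ∈ closure D :=
  map_mem_closure₂ (f := fun p p' => (B p.1 p'.1,
    B (c • p.1 - p.2) p'.1 + B p.1 (c • p'.1 - p'.2))) (by fun_prop) hp hp' hD

variable {S : Type*} [TopologicalSpace S] [ChartedSpace R3 S] [T2Space S] [CompactSpace S]
  [SecondCountableTopology S] [IsManifold (𝓡 3) ∞ S] [MeasurableSpace S] [BorelSpace S]
  {h : Bundle.RiemannianMetric (fun p : S => TangentSpace (𝓡 3) p)} [IsFiniteMeasure (vol h)]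
  {m : ℝ} {w v w' v' : Lp ℂ 2 (vol h)}

/-- A Hilbert basis of `L²(S × S)` of real eigenfunctions of the closure of the Laplacian
`Δ_{h_x} + Δ_{h_y}`, with eigenvalues `-ν i`. -/
structure IsEigenBasis {ι : Type*} (h : Bundle.RiemannianMetric (fun p : S => TangentSpace (𝓡 3) p))
    (b : HilbertBasis ι ℂ (Lp ℂ 2 (vol2 h))) (nu : ι → ℝ) : Prop where
  nonneg : ∀ i, 0 ≤ nu i
  conj_eq : ∀ i, ∀ᵐ q ∂(vol2 h), starRingEnd ℂ (b i q) = b i q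
  integral_lapl2_mul : ∀ i, ∀ a ∈ smooth2 S,
    ∫ q, lapl2 h a q * b i q ∂(vol2 h) = -(nu i : ℂ) * ∫ q, a q * b i q ∂(vol2 h)
  mem_closure : ∀ i, (b i, -(nu i : ℂ) • b i) ∈
    closure (opGraph (vol2 h) (smooth2 S : Set (S × S → ℂ)) (lapl2 h))

lemma tens_mem_closure_opGraph (hw : (w, v) ∈ schrodingerGraph h m)
    (hw' : (w', v') ∈ schrodingerGraph h m) :
    (tens w w', tens ((m : ℂ) • w - v) w' + tens w ((m : ℂ) • w' - v')) ∈
      closure (opGraph (vol2 h) (smooth2 S : Set (S × S → ℂ)) (lapl2 h)) := by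
  rw [schrodingerGraph] at hw hw'
  refine bilin_mem_closure tensCLM (m : ℂ) ?_ hw hw'
  rintro ⟨w, v⟩ ⟨f, hf, h1, h2⟩ ⟨w', v'⟩ ⟨g, hg, h1', h2'⟩
  refine ⟨_, tensor_mem_smooth2 hf hg, tens_eq_of_ae h1 h1', ?_⟩
  have e1 : (((m : ℂ) • w - v : Lp ℂ 2 (vol h)) : S → ℂ) =ᵐ[vol h] lapl h f := by
    filter_upwards [Lp.coeFn_sub ((m : ℂ) • w) v, Lp.coeFn_smul (m : ℂ) w, h1, h2] with
      x k1 k2 k3 k4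
    change w x = f x at k3
    change v x = _ at k4
    rw [k1, Pi.sub_apply, k2, Pi.smul_apply, k3, k4, smul_eq_mul]
    ring
  have e2 : (((m : ℂ) • w' - v' : Lp ℂ 2 (vol h)) : S → ℂ) =ᵐ[vol h] lapl h g := by
    filter_upwards [Lp.coeFn_sub ((m : ℂ) • w') v', Lp.coeFn_smul (m : ℂ) w', h1', h2'] with
      x k1 k2 k3 k4
    change w' x = g x at k3
    change v' x = _ at k4
    rw [k1, Pi.sub_apply, k2, Pi.smul_apply, k3, k4, smul_eq_mul]
    ring
  change ((tens ((m : ℂ) • w - v) w' + tens w ((m : ℂ) • w' - v') : Lp ℂ 2 (vol2 h)) :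
    S × S → ℂ) =ᵐ[vol2 h] _
  filter_upwards [Lp.coeFn_add (tens ((m : ℂ) • w - v) w') (tens w ((m : ℂ) • w' - v')),
    tens_eq_of_ae e1 h1', tens_eq_of_ae h1 e2] with q k1 k2 k3
  rw [k1, Pi.add_apply, k2, k3, lapl2_tensor]

lemma tens_smul_left {X Y : Type*} [MeasurableSpace X] [MeasurableSpace Y] {μ : Measure X}
    {ν : Measure Y} [SigmaFinite μ] [SigmaFinite ν] (c : ℂ) (f : Lp ℂ 2 μ) (g : Lp ℂ 2 ν) :
    tens (c • f) g = c • tens f g := tensBilin.map_smul₂ c f g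

lemma tens_smul_right {X Y : Type*} [MeasurableSpace X] [MeasurableSpace Y] {μ : Measure X}
    {ν : Measure Y} [SigmaFinite μ] [SigmaFinite ν] (c : ℂ) (f : Lp ℂ 2 μ) (g : Lp ℂ 2 ν) :
    tens f (c • g) = c • tens f g := (tensBilin f).map_smul c g

/-- Each factor is an eigenfunction of `-Δ_h` with eigenvalue `λ² - m`, and eigenvalues add on
tensor products. -/
theorem isEigenBasis_prodBasis (hh : IsC11 h) (φ : HilbertBasis ℕ ℂ (Lp ℂ 2 (vol h)))
    (hreal : ∀ j, ∀ᵐ x ∂(vol h), (φ j x).im = 0) (lam : ℕ → ℝ)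
    (heig : ∀ j, (φ j, ((lam j : ℂ) ^ 2) • φ j) ∈ schrodingerGraph h m) :
    IsEigenBasis h (prodBasis φ φ) fun jk => lam jk.1 ^ 2 - m + (lam jk.2 ^ 2 - m) where
  nonneg jk := by
    have h1 := le_sq_of_eigen hh (heig jk.1) (φ.orthonormal.1 jk.1)
    have h2 := le_sq_of_eigen hh (heig jk.2) (φ.orthonormal.1 jk.2)
    linarith
  conj_eq jk := by
    have hr : ∀ j, (fun x => starRingEnd ℂ (φ j x)) =ᵐ[vol h] φ j := fun j => by
      filter_upwards [hreal j] with x hx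
      exact Complex.conj_eq_iff_im.2 hx
    filter_upwards [coeFn_tens (φ jk.1) (φ jk.2), ae_prod_mk (hr jk.1) (hr jk.2)] with q h1 h2
    rw [prodBasis_apply, h1, map_mul, h2]
  integral_lapl2_mul jk a ha := by
    have h1 : ∀ c : S × S → ℂ, ∫ q, c q * prodBasis φ φ jk q ∂(vol2 h) =
        ∫ q, c q * (φ jk.1 q.1 * φ jk.2 q.2) ∂(vol2 h) := fun c => by
      refine integral_congr_ae ?_
      filter_upwards [coeFn_tens (φ jk.1) (φ jk.2)] with q h1
      rw [prodBasis_apply, h1]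
    rw [h1, h1, integral_lapl2_mul_eigen hh (heig _) (heig _) ha]
    push_cast
    ring
  mem_closure jk := by
    have h1 := tens_mem_closure_opGraph (heig jk.1) (heig jk.2)
    rw [prodBasis_apply]
    convert h1 using 2
    rw [← sub_smul, ← sub_smul, tens_smul_left, tens_smul_right, ← add_smul]
    congr 1
    push_cast
    ring

end EigenBasis

/-! ### `1 + ν - Δ` on the plane; frequencies are ordinary ones, hence the factor `(2π)²` -/

section Plane

open FourierTransform Laplacian

/-- The operator `1 + ν - Δ` on Schwartz functions. -/
def helm (ν : ℝ) : 𝓢(R2, ℂ) →L[ℂ] 𝓢(R2, ℂ) :=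
  ((1 + ν : ℝ) : ℂ) • ContinuousLinearMap.id ℂ _ - LineDeriv.laplacianCLM ℂ R2 𝓢(R2, ℂ)

/-- The symbol of `1 + ν - Δ`. -/
def wt (ν : ℝ) (ξ : R2) : ℝ := 1 + ν + (2 * Real.pi) ^ 2 * ‖ξ‖ ^ 2

lemma helm_apply (ν : ℝ) (g : 𝓢(R2, ℂ)) (x : R2) :
    helm ν g x = ((1 + ν : ℝ) : ℂ) * g x - Laplacian.laplacian (g : R2 → ℂ) x := by
  rw [← SchwartzMap.laplacian_apply, ← SchwartzMap.laplacianCLM_eq (𝕜 := ℂ)]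
  rfl

lemma helm_eq (ν : ℝ) (g : 𝓢(R2, ℂ)) : helm ν g = helm 0 g + (ν : ℂ) • g := by
  ext x
  change helm ν g x = helm 0 g x + (ν : ℂ) * g x
  rw [helm_apply, helm_apply]
  push_cast
  ring

lemma fourier_helm (ν : ℝ) (g : 𝓢(R2, ℂ)) (ξ : R2) : 𝓕 (helm ν g) ξ = (wt ν ξ : ℂ) * 𝓕 g ξ := by
  have h1 : 𝓕 (Δ g) ξ = -((2 * Real.pi) ^ 2 * ‖ξ‖ ^ 2 : ℝ) * 𝓕 g ξ := by
    rw [SchwartzMap.laplacian_eq_fourierMultiplierCLM, FourierTransform.fourier_smul,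
      SchwartzMap.fourierMultiplierCLM_apply, FourierTransform.fourier_fourierInv_eq,
      smul_apply, SchwartzMap.smulLeftCLM_apply_apply (by fun_prop)]
    simp
    ring
  have h2 : helm ν g = ((1 + ν : ℝ) : ℂ) • g - Δ g := by
    rw [← SchwartzMap.laplacianCLM_eq (𝕜 := ℂ)]
    rfl
  rw [h2, sub_eq_add_neg, ← neg_one_smul ℂ (Δ g), FourierTransform.fourier_add,
    FourierTransform.fourier_smul, FourierTransform.fourier_smul, add_apply,
    smul_apply, smul_apply, h1, wt]
  push_cast
  simp only [smul_eq_mul]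
  ring

lemma wt_neg (ν : ℝ) (ξ : R2) : wt ν (-ξ) = wt ν ξ := by rw [wt, wt, norm_neg]

lemma fourierInv_helm (ν : ℝ) (g : 𝓢(R2, ℂ)) (ξ : R2) :
    𝓕⁻ (helm ν g) ξ = (wt ν ξ : ℂ) * 𝓕⁻ g ξ := by
  have h : ∀ g : 𝓢(R2, ℂ), 𝓕⁻ g ξ = 𝓕 g (-ξ) := fun g => by
    rw [SchwartzMap.fourierInv_apply_eq]
    rfl
  rw [h, h, fourier_helm, wt_neg]

/-- The complex conjugate of a Schwartz function. -/
def conjS (g : 𝓢(R2, ℂ)) : 𝓢(R2, ℂ) :=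
  SchwartzMap.postcompCLM (𝕜 := ℝ) (Complex.conjCLE : ℂ →L[ℝ] ℂ) g

@[simp] lemma conjS_apply (g : 𝓢(R2, ℂ)) (x : R2) : conjS g x = starRingEnd ℂ (g x) := rfl

lemma fourier_conjS (g : 𝓢(R2, ℂ)) (ξ : R2) : 𝓕 (conjS g) ξ = starRingEnd ℂ (𝓕⁻ g ξ) := by
  rw [SchwartzMap.fourier_coe, SchwartzMap.fourierInv_coe, Real.fourier_eq', Real.fourierInv_eq',
    ← integral_conj]
  refine integral_congr_ae (Eventually.of_forall fun x => ?_)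
  simp only [conjS_apply, smul_eq_mul, map_mul, ← Complex.exp_conj]
  congr 2
  simp only [Complex.conj_ofReal, Complex.conj_I]
  push_cast
  ring

/-- The `L²` transform agrees with the distributional one, which moves onto the test function; hence
the bilinear Parseval formula pairs `𝓕` with `𝓕⁻`. -/
lemma integral_fourier_mul_fourierInv (w : Lp ℂ 2 (volume : Measure R2)) (g : 𝓢(R2, ℂ)) :
    ∫ ξ, (𝓕 w) ξ * 𝓕⁻ g ξ = ∫ x, w x * g x := by
  have h1 := Lp.fourier_toTemperedDistribution_eq w
  have h2 := congrArg (fun T : 𝓢'(R2, ℂ) => T (𝓕⁻ g)) h1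
  simp only [TemperedDistribution.fourier_apply, FourierTransform.fourier_fourierInv_eq,
    Lp.toTemperedDistribution_apply, smul_eq_mul] at h2
  simp only [mul_comm _ (g _), mul_comm _ (𝓕⁻ g _)]
  exact h2.symm

lemma ae_eq_zero_of_integral_mul_schwartz {G : R2 → ℂ} (hG : LocallyIntegrable G)
    (h : ∀ g : 𝓢(R2, ℂ), HasCompactSupport g → ∫ x, G x * g x = 0) : G =ᵐ[volume] 0 := by
  refine ae_eq_zero_of_integral_contDiff_smul_eq_zero hG fun g hg hgc => ?_
  have hgc' : HasCompactSupport (fun x => (g x : ℂ)) := hgc.comp_left Complex.ofReal_zero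
  have := h (hgc'.toSchwartzMap (Complex.ofRealCLM.contDiff.comp hg)) hgc'
  rw [← this]
  refine integral_congr_ae (Eventually.of_forall fun x => ?_)
  change (g x) • G x = G x * (g x : ℂ)
  rw [Complex.real_smul, mul_comm]

end Plane

/-! ### Cutoffs and uniqueness of weak solutions on the plane -/

section Cutoff

open FourierTransform Laplacian

/-- A smooth function on the plane with compact support that equals one near the origin. -/
def bump : 𝓢(R2, ℂ) :=
  ((⟨1, 2, one_pos, one_lt_two⟩ : ContDiffBump (0 : R2)).hasCompactSupport.comp_left
    (g := fun r : ℝ => (r : ℂ)) Complex.ofReal_zero).toSchwartzMap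
    (Complex.ofRealCLM.contDiff.comp
      (⟨1, 2, one_pos, one_lt_two⟩ : ContDiffBump (0 : R2)).contDiff)

lemma hasCompactSupport_bump : HasCompactSupport bump :=
  (⟨1, 2, one_pos, one_lt_two⟩ : ContDiffBump (0 : R2)).hasCompactSupport.comp_left
    (g := fun r : ℝ => (r : ℂ)) Complex.ofReal_zero

lemma bump_eq_one {x : R2} (hx : ‖x‖ < 1) : bump x = 1 := by
  have : (⟨1, 2, one_pos, one_lt_two⟩ : ContDiffBump (0 : R2)) x = 1 :=
    ContDiffBump.one_of_mem_closedBall _ (by simpa using hx.le)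
  change (((⟨1, 2, one_pos, one_lt_two⟩ : ContDiffBump (0 : R2)) x : ℝ) : ℂ) = 1
  rw [this, Complex.ofReal_one]

/-- The bump function, dilated by `n + 1`. -/
def dilBump (n : ℕ) (x : R2) : ℂ := bump (((n : ℝ) + 1)⁻¹ • x)

lemma contDiff_dilBump (n : ℕ) : ContDiff ℝ ∞ (dilBump n) :=
  (bump.smooth ⊤).comp (contDiff_const_smul _)

lemma hasCompactSupport_dilBump (n : ℕ) : HasCompactSupport (dilBump n) :=
  hasCompactSupport_bump.comp_smul (inv_ne_zero (by positivity))

/-- The argument is scaled by at most one, which can only shrink derivatives; the bound is uniform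
in `n`. -/
lemma norm_iteratedFDeriv_dilBump_le (n i : ℕ) (x : R2) :
    ‖iteratedFDeriv ℝ i (dilBump n) x‖ ≤ SchwartzMap.seminorm ℝ 0 i bump := by
  have h0 : ‖((n : ℝ) + 1)⁻¹ • ContinuousLinearMap.id ℝ R2‖ ≤ 1 := by
    refine (norm_smul_le _ _).trans (mul_le_one₀ ?_ (norm_nonneg _)
      (ContinuousLinearMap.norm_id_le (𝕜 := ℝ) (E := R2)))
    rw [Real.norm_of_nonneg (by positivity)]
    exact inv_le_one_of_one_le₀ (by linarith [Nat.cast_nonneg (α := ℝ) n])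
  have h1 := (((n : ℝ) + 1)⁻¹ • ContinuousLinearMap.id ℝ R2).iteratedFDeriv_comp_right
    (bump.smooth ⊤) x (i := i) (by exact_mod_cast le_top)
  change ‖iteratedFDeriv ℝ i (bump ∘ (((n : ℝ) + 1)⁻¹ • ContinuousLinearMap.id ℝ R2)) x‖ ≤ _
  rw [h1]
  refine (ContinuousMultilinearMap.norm_compContinuousLinearMap_le _ _).trans ?_
  rw [Finset.prod_const]
  refine (mul_le_of_le_one_right (norm_nonneg _) (pow_le_one₀ (norm_nonneg _) h0)).trans ?_
  exact SchwartzMap.norm_iteratedFDeriv_le_seminorm ℝ bump i _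

/-- A Schwartz function, cut off outside a ball. -/
def cutS (n : ℕ) (g : 𝓢(R2, ℂ)) : 𝓢(R2, ℂ) :=
  ((hasCompactSupport_dilBump n).mul_right (f' := g)).toSchwartzMap
    ((contDiff_dilBump n).mul (g.smooth ⊤))

lemma cutS_apply (n : ℕ) (g : 𝓢(R2, ℂ)) (x : R2) : cutS n g x = dilBump n x * g x := rfl

lemma hasCompactSupport_cutS (n : ℕ) (g : 𝓢(R2, ℂ)) : HasCompactSupport (cutS n g) :=
  (hasCompactSupport_dilBump n).mul_right (f' := g)

lemma cutS_eventuallyEq (g : 𝓢(R2, ℂ)) (x : R2) :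
    ∀ᶠ n in atTop, (cutS n g : R2 → ℂ) =ᶠ[𝓝 x] g := by
  obtain ⟨N, hN⟩ := exists_nat_gt (‖x‖ + 1)
  filter_upwards [eventually_ge_atTop N] with n hn
  filter_upwards [Metric.ball_mem_nhds x one_pos] with y hy
  rw [cutS_apply, dilBump, bump_eq_one, one_mul]
  have h1 : ‖y‖ < N := by
    have := norm_sub_norm_le y x
    rw [Metric.mem_ball, dist_eq_norm] at hy
    linarith
  have h2 : (N : ℝ) ≤ n := by exact_mod_cast hn
  rw [norm_smul, Real.norm_of_nonneg (by positivity), inv_mul_lt_iff₀ (by positivity)]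
  linarith

lemma natCast_le_infty (N : ℕ) : (N : ℕ∞ω) ≤ ((⊤ : ℕ∞) : ℕ∞ω) := by exact_mod_cast le_top

lemma norm_laplacian_le (f : R2 → ℂ) (x : R2) :
    ‖Laplacian.laplacian f x‖ ≤ 2 * ‖iteratedFDeriv ℝ 2 f x‖ := by
  rw [InnerProductSpace.laplacian_eq_iteratedFDeriv_orthonormalBasis f
    (EuclideanSpace.basisFun (Fin 2) ℝ)]
  have h1 : ∀ i : Fin 2, ‖iteratedFDeriv ℝ 2 f x ![EuclideanSpace.basisFun (Fin 2) ℝ i,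
      EuclideanSpace.basisFun (Fin 2) ℝ i]‖ ≤ ‖iteratedFDeriv ℝ 2 f x‖ := fun i => by
    refine (ContinuousMultilinearMap.le_opNorm _ _).trans ?_
    simp
  refine (norm_sum_le _ _).trans ((Finset.sum_le_sum fun i _ => h1 i).trans ?_)
  simp

/-- A majorant of the functions `(1 + ν - Δ)(χ_n g)`. -/
def cutBound (ν : ℝ) (g : 𝓢(R2, ℂ)) (x : R2) : ℝ :=
  |1 + ν| * (SchwartzMap.seminorm ℝ 0 0 bump * ‖iteratedFDeriv ℝ 0 g x‖) +
    2 * ∑ i ∈ Finset.range 3, ((2 : ℕ).choose i : ℝ) * SchwartzMap.seminorm ℝ 0 i bump *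
      ‖iteratedFDeriv ℝ (2 - i) g x‖

lemma norm_helm_cutS_le (ν : ℝ) (g : 𝓢(R2, ℂ)) (n : ℕ) (x : R2) :
    ‖helm ν (cutS n g) x‖ ≤ cutBound ν g x := by
  rw [helm_apply]
  refine (norm_sub_le _ _).trans (add_le_add ?_ ?_)
  · rw [norm_mul, Complex.norm_real, Real.norm_eq_abs, cutS_apply, norm_mul, norm_iteratedFDeriv_zero]
    gcongr
    have := norm_iteratedFDeriv_dilBump_le n 0 x
    rwa [norm_iteratedFDeriv_zero] at this
  · refine (norm_laplacian_le _ x).trans (mul_le_mul_of_nonneg_left ?_ zero_le_two)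
    refine (norm_iteratedFDeriv_mul_le (contDiff_dilBump n) (g.smooth ⊤) x (n := 2)
      (natCast_le_infty 2)).trans ?_
    refine Finset.sum_le_sum fun i _ => ?_
    gcongr
    exact norm_iteratedFDeriv_dilBump_le n i x

lemma memLp_norm_iteratedFDeriv (g : 𝓢(R2, ℂ)) (i : ℕ) :
    MemLp (fun x => ‖iteratedFDeriv ℝ i g x‖) 2 := by
  have hc : Continuous fun x => ‖iteratedFDeriv ℝ i g x‖ :=
    ((g.smooth ⊤).continuous_iteratedFDeriv (by exact_mod_cast le_top)).norm
  have hi : Integrable fun x => ‖iteratedFDeriv ℝ i g x‖ := by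
    simpa using SchwartzMap.integrable_pow_mul_iteratedFDeriv volume g 0 i
  refine (memLp_two_iff_integrable_sq hc.aestronglyMeasurable).2 ?_
  simp only [sq]
  refine hi.bdd_mul (c := SchwartzMap.seminorm ℝ 0 i g) hc.aestronglyMeasurable (Eventually.of_forall fun x => ?_)
  rw [norm_norm]
  exact SchwartzMap.norm_iteratedFDeriv_le_seminorm ℝ g i x

lemma memLp_cutBound (ν : ℝ) (g : 𝓢(R2, ℂ)) : MemLp (cutBound ν g) 2 := by
  have h := memLp_norm_iteratedFDeriv g
  have h1 : MemLp (fun x => |1 + ν| * (SchwartzMap.seminorm ℝ 0 0 bump *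
    ‖iteratedFDeriv ℝ 0 g x‖)) 2 := ((h 0).const_mul _).const_mul _
  have h2 : MemLp (fun x => ∑ i ∈ Finset.range 3, ((2 : ℕ).choose i : ℝ) *
      SchwartzMap.seminorm ℝ 0 i bump * ‖iteratedFDeriv ℝ (2 - i) g x‖) 2 :=
    memLp_finsetSum _ fun i _ => (h (2 - i)).const_mul _
  exact h1.add (h2.const_mul 2)

/-- Dominated convergence along `cutS n g`: near each point these functions are eventually equal to
`g`, and `cutBound` is a square integrable majorant independent of `n`. -/
lemma integral_mul_helm_eq_zero {Y : Lp ℂ 2 (volume : Measure R2)} {ν : ℝ}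
    (h : ∀ g : 𝓢(R2, ℂ), HasCompactSupport g → ∫ x, Y x * helm ν g x = 0) (g : 𝓢(R2, ℂ)) :
    ∫ x, Y x * helm ν g x = 0 := by
  have h1 : Tendsto (fun n => ∫ x, Y x * helm ν (cutS n g) x) atTop
      (𝓝 (∫ x, Y x * helm ν g x)) := by
    refine tendsto_integral_of_dominated_convergence (fun x => ‖Y x‖ * cutBound ν g x)
      (fun n => ?_) ((Lp.memLp Y).norm.integrable_mul (memLp_cutBound ν g)) (fun n => ?_) ?_
    · exact (Lp.memLp Y).1.mul (helm ν (cutS n g)).continuous.aestronglyMeasurable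
    · refine Eventually.of_forall fun x => ?_
      rw [norm_mul]
      exact mul_le_mul_of_nonneg_left (norm_helm_cutS_le ν g n x) (norm_nonneg _)
    · refine Eventually.of_forall fun x => tendsto_const_nhds.congr' ?_
      filter_upwards [cutS_eventuallyEq g x] with n hn
      rw [helm_apply, helm_apply, (InnerProductSpace.laplacian_congr_nhds hn).eq_of_nhds,
        hn.eq_of_nhds]
  simp only [h _ (hasCompactSupport_cutS _ g)] at h1
  exact tendsto_nhds_unique h1 tendsto_const_nhds

lemma wt_pos {ν : ℝ} (hν : 0 ≤ ν) (ξ : R2) : 1 ≤ wt ν ξ := by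
  rw [wt]
  have : 0 ≤ (2 * Real.pi) ^ 2 * ‖ξ‖ ^ 2 := by positivity
  linarith

lemma continuous_wt (ν : ℝ) : Continuous (wt ν) := by
  unfold wt
  fun_prop

/-- On the Fourier side the product of `𝓕 Y` with the symbol annihilates all Schwartz functions, and
the symbol is at least one. This provides the density of the range of `I - Δ`. -/
lemma eq_zero_of_integral_mul_helm {Y : Lp ℂ 2 (volume : Measure R2)} {ν : ℝ} (hν : 0 ≤ ν)
    (h : ∀ g : 𝓢(R2, ℂ), HasCompactSupport g → ∫ x, Y x * helm ν g x = 0) : Y = 0 := by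
  have h1 : ∀ k : 𝓢(R2, ℂ), ∫ ξ, ((wt ν ξ : ℂ) * (𝓕 Y) ξ) * k ξ = 0 := fun k => by
    have h2 := integral_mul_helm_eq_zero h (𝓕 k)
    rw [← integral_fourier_mul_fourierInv] at h2
    rw [← h2]
    refine integral_congr_ae (Eventually.of_forall fun ξ => ?_)
    simp only [fourierInv_helm, FourierTransform.fourierInv_fourier_eq]
    ring
  have hloc : LocallyIntegrable (fun ξ => (wt ν ξ : ℂ) * (𝓕 Y) ξ) := by
    have h2 := (Lp.memLp (𝓕 Y)).locallyIntegrable one_le_two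
    rw [locallyIntegrable_iff] at h2 ⊢
    exact fun K hK => (h2 K hK).continuousOn_mul
      (Complex.continuous_ofReal.comp (continuous_wt ν)).continuousOn hK
  have h3 := ae_eq_zero_of_integral_mul_schwartz hloc fun k _ => h1 k
  have h4 : 𝓕 Y = 0 := by
    refine Lp.eq_zero_iff_ae_eq_zero.2 ?_
    filter_upwards [h3] with ξ hξ
    have := wt_pos hν ξ
    exact (mul_eq_zero.1 hξ).resolve_left (Complex.ofReal_ne_zero.2 (by linarith))
  have h5 := congrArg (fun Z => 𝓕⁻ Z) h4
  simpa using h5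

end Cutoff

/-! ### Angular and ordinary frequencies -/

section AngularFrequency

open FourierTransform

lemma two_pi_ne_zero : (2 * Real.pi : ℝ) ≠ 0 := by positivity

lemma locallyIntegrable_comp_smul {G : R2 → ℂ} (hG : LocallyIntegrable G) {r : ℝ} (hr : r ≠ 0) :
    LocallyIntegrable fun x => G (r • x) := by
  rw [locallyIntegrable_iff] at hG ⊢
  intro K hK
  have h1 := hG _ (hK.image (continuous_const_smul r))
  rw [← integrable_indicator_iff (hK.image (continuous_const_smul r)).measurableSet,
    ← integrable_comp_smul_iff volume _ hr] at h1
  rw [← integrable_indicator_iff hK.measurableSet]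
  refine h1.congr (Eventually.of_forall fun x => ?_)
  have h2 : r • x ∈ (fun x => r • x) '' K ↔ x ∈ K :=
    (smul_right_injective R2 hr).mem_set_image
  beta_reduce
  by_cases hx : x ∈ K
  · rw [Set.indicator_of_mem hx, Set.indicator_of_mem (h2.2 hx)]
  · rw [Set.indicator_of_notMem hx, Set.indicator_of_notMem (mt h2.1 hx)]

/-- The passage from angular to ordinary frequencies. -/
def toFreq (G : R2 → ℂ) (η : R2) : ℂ := ((2 * Real.pi : ℝ) : ℂ) * G ((2 * Real.pi) • η)

/-- The passage from ordinary to angular frequencies. -/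
def toAngular (G : R2 → ℂ) (ξ : R2) : ℂ :=
  (((2 * Real.pi)⁻¹ : ℝ) : ℂ) * G ((2 * Real.pi)⁻¹ • ξ)

lemma toFreq_toAngular (G : R2 → ℂ) : toFreq (toAngular G) = G := by
  funext η
  rw [toFreq, toAngular, smul_smul, inv_mul_cancel₀ two_pi_ne_zero, one_smul, ← mul_assoc,
    ← Complex.ofReal_mul, mul_inv_cancel₀ two_pi_ne_zero, Complex.ofReal_one, one_mul]

lemma locallyIntegrable_toFreq {G : R2 → ℂ} (hG : LocallyIntegrable G) :
    LocallyIntegrable (toFreq G) :=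
  (locallyIntegrable_comp_smul hG two_pi_ne_zero).smul ((2 * Real.pi : ℝ) : ℂ)

lemma locallyIntegrable_toAngular {G : R2 → ℂ} (hG : LocallyIntegrable G) :
    LocallyIntegrable (toAngular G) :=
  (locallyIntegrable_comp_smul hG (inv_ne_zero two_pi_ne_zero)).smul (((2 * Real.pi)⁻¹ : ℝ) : ℂ)

/-- `toFreq` on Schwartz functions. -/
def toFreqS (g : 𝓢(R2, ℂ)) : 𝓢(R2, ℂ) :=
  ((2 * Real.pi : ℝ) : ℂ) • SchwartzMap.compCLMOfContinuousLinearEquiv ℂ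
    (ContinuousLinearEquiv.smulLeft (R₁ := ℝ) (Units.mk0 (2 * Real.pi) two_pi_ne_zero)) g

lemma toFreqS_apply (g : 𝓢(R2, ℂ)) (η : R2) : toFreqS g η = toFreq g η := rfl

/-- `toAngular` on Schwartz functions. -/
def toAngularS (g : 𝓢(R2, ℂ)) : 𝓢(R2, ℂ) :=
  (((2 * Real.pi)⁻¹ : ℝ) : ℂ) • SchwartzMap.compCLMOfContinuousLinearEquiv ℂ
    (ContinuousLinearEquiv.smulLeft (R₁ := ℝ)
      (Units.mk0 (2 * Real.pi)⁻¹ (inv_ne_zero two_pi_ne_zero))) g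

lemma toFreqS_toAngularS (g : 𝓢(R2, ℂ)) : toFreqS (toAngularS g) = g := by
  ext η
  exact congrFun (toFreq_toAngular g) η

/-- In dimension two the Jacobian is `(2π)⁻²`, so each of two transformed factors carries one `2π`.
-/
lemma integral_comp_two_pi (f : R2 → ℂ) :
    ∫ η, ((2 * Real.pi : ℝ) : ℂ) * (((2 * Real.pi : ℝ) : ℂ) * f ((2 * Real.pi) • η)) =
      ∫ ξ, f ξ := by
  rw [integral_const_mul, integral_const_mul, Measure.integral_comp_smul, finrank_euclideanSpace_fin,
    abs_of_pos (by positivity), Complex.real_smul, ← mul_assoc, ← mul_assoc, ← Complex.ofReal_mul,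
    ← Complex.ofReal_mul, ← sq, mul_inv_cancel₀ (by positivity), Complex.ofReal_one, one_mul]

lemma fourier_toFreqS (g : 𝓢(R2, ℂ)) (x : R2) :
    𝓕 (toFreqS g) x = (2 * (Real.pi : ℂ))⁻¹ *
      ∫ ξ : R2, Complex.exp (-(Complex.I * ((inner ℝ x ξ : ℝ) : ℂ))) * g ξ := by
  rw [← integral_const_mul, ← integral_comp_two_pi, SchwartzMap.fourier_coe, Real.fourier_eq']
  refine integral_congr_ae (Eventually.of_forall fun η => ?_)
  have h1 : ((-2 * Real.pi * inner ℝ η x : ℝ) : ℂ) * Complex.I =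
      -(Complex.I * ((inner ℝ x ((2 * Real.pi) • η) : ℝ) : ℂ)) := by
    rw [real_inner_smul_right, real_inner_comm]
    push_cast
    ring
  have hpi : (Real.pi : ℂ) ≠ 0 := Complex.ofReal_ne_zero.2 Real.pi_ne_zero
  simp only [smul_eq_mul, toFreqS_apply, toFreq]
  rw [h1]
  push_cast
  field_simp

/-- Test functions `g` for the angular transform correspond to `𝓕⁻ f = toFreqS g`, and then the `k`
of the definition is `f`. From here on ordinary frequencies can be used. -/
lemma isFourier_iff {c : 𝓢'(R2, ℂ)} {G : R2 → ℂ} :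
    IsFourier c G ↔ LocallyIntegrable G ∧ ∀ f : 𝓢(R2, ℂ),
      Integrable (fun η => toFreq G η * 𝓕⁻ f η) ∧ c f = ∫ η, toFreq G η * 𝓕⁻ f η := by
  have h1 : ∀ g : 𝓢(R2, ℂ), (fun η => toFreq G η * toFreqS g η) = fun η =>
      ((2 * Real.pi : ℝ) : ℂ) * (((2 * Real.pi : ℝ) : ℂ) *
        (fun ξ => G ξ * g ξ) ((2 * Real.pi) • η)) := fun g => by
    funext η
    simp only [toFreqS_apply, toFreq]
    ring
  have hne : ((2 * Real.pi : ℝ) : ℂ) ≠ 0 := Complex.ofReal_ne_zero.2 two_pi_ne_zero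
  have h2 : ∀ g : 𝓢(R2, ℂ), (Integrable (fun η => toFreq G η * toFreqS g η) ↔
      Integrable fun ξ => G ξ * g ξ) := fun g => by
    rw [h1, integrable_const_mul_iff hne.isUnit, integrable_const_mul_iff hne.isUnit]
    exact integrable_comp_smul_iff volume (fun ξ => G ξ * g ξ) two_pi_ne_zero
  have h3 : ∀ g : 𝓢(R2, ℂ), ∫ η, toFreq G η * toFreqS g η = ∫ ξ, G ξ * g ξ := fun g => by
    rw [h1]
    exact integral_comp_two_pi fun ξ => G ξ * g ξ
  refine and_congr_right fun _ => ⟨fun h f => ?_, fun h g k hk => ?_⟩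
  · have h4 : toFreqS (toAngularS (𝓕⁻ f)) = 𝓕⁻ f := toFreqS_toAngularS _
    obtain ⟨h5, h6⟩ := h (toAngularS (𝓕⁻ f)) f fun x => by
      rw [← fourier_toFreqS, h4, FourierTransform.fourier_fourierInv_eq]
    rw [← h2, h4] at h5
    rw [← h3, h4] at h6
    exact ⟨h5, h6⟩
  · have h4 : 𝓕⁻ k = toFreqS g := by
      have : k = 𝓕 (toFreqS g) := by
        ext x
        rw [hk, fourier_toFreqS]
      rw [this, FourierTransform.fourierInv_fourier_eq]
    obtain ⟨h5, h6⟩ := h k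
    rw [h4] at h5 h6
    exact ⟨(h2 g).1 h5, h6.trans (h3 g)⟩

lemma lintegral_comp_two_pi (f : R2 → ℝ≥0∞) :
    ∫⁻ η, f ((2 * Real.pi) • η) = ENNReal.ofReal ((2 * Real.pi) ^ 2)⁻¹ * ∫⁻ ξ, f ξ := by
  have h := Measure.map_addHaar_smul (volume : Measure R2) two_pi_ne_zero
  rw [finrank_euclideanSpace_fin, abs_of_pos (by positivity)] at h
  rw [← smul_eq_mul (ENNReal.ofReal _), ← lintegral_smul_measure, ← h]
  exact ((Homeomorph.smulOfNeZero (2 * Real.pi) two_pi_ne_zero).measurableEmbedding.lintegral_map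
    _).symm

/-- Comparable positive numbers have comparable powers; the exponent `|s|` covers both signs. -/
lemma rpow_le_const_mul_rpow {A B C s : ℝ} (hA : 0 < A) (hB : 0 < B) (hAB : A ≤ C * B)
    (hBA : B ≤ C * A) (hC : 0 < C) : A ^ s ≤ C ^ |s| * B ^ s := by
  rcases le_total 0 s with hs | hs
  · rw [abs_of_nonneg hs, ← Real.mul_rpow hC.le hB.le]
    exact Real.rpow_le_rpow hA.le hAB hs
  · rw [abs_of_nonpos hs, Real.rpow_neg hC.le, ← Real.inv_rpow hC.le, ← Real.mul_rpow
      (inv_pos.2 hC).le hB.le]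
    refine Real.rpow_le_rpow_of_nonpos (by positivity) ?_ hs
    rwa [inv_mul_le_iff₀ hC]

end AngularFrequency

/-! ### The spectral representation and its weighted pairing -/

section SpectralSide

open FourierTransform unitInterval

lemma partialPair_tens {X Y : Type*} [MeasurableSpace X] [MeasurableSpace Y] {μ : Measure X}
    {ν : Measure Y} [SigmaFinite μ] [SigmaFinite ν] (c A : Lp ℂ 2 ν) (f : Lp ℂ 2 μ) :
    partialPair μ c (tens f A) = inner ℂ c A • f := by
  refine ext_inner_left ℂ fun f' => ?_
  rw [inner_partialPair_right, inner_tens_tens, inner_smul_right, mul_comm]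

lemma continuous_tens_right {X Y : Type*} [MeasurableSpace X] [MeasurableSpace Y] {μ : Measure X}
    {ν : Measure Y} [SigmaFinite μ] [SigmaFinite ν] (f : Lp ℂ 2 μ) :
    Continuous fun A : Lp ℂ 2 ν => tens f A := (tensCLM f).continuous

lemma continuous_map_tens {X Y V : Type*} [MeasurableSpace X] [MeasurableSpace Y] {μ : Measure X}
    {ν : Measure Y} [SigmaFinite μ] [SigmaFinite ν] [NormedAddCommGroup V] [NormedSpace ℂ V]
    (F : Lp ℂ 2 (μ.prod ν) ≃ₗᵢ[ℂ] V) (f : Lp ℂ 2 μ) :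
    Continuous fun A : Lp ℂ 2 ν => F (tens f A) :=
  F.continuous.comp (continuous_tens_right f)

/-- Square integrable functions of a frequency and an index. -/
abbrev KS (ι : Type*) [MeasurableSpace ι] : Type _ :=
  Lp ℂ 2 ((volume : Measure R2).prod (Measure.count : Measure ι))

variable {Y ι : Type*} [MeasurableSpace Y] {ν : Measure Y} [SigmaFinite ν] [MeasurableSpace ι]
  [MeasurableSingletonClass ι] [Countable ι] (b : HilbertBasis ι ℂ (Lp ℂ 2 ν)) {nu : ι → ℝ}

/-- The Fourier transform in the plane, and the expansion in a basis in the other variables. -/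
def spT : Lp ℂ 2 ((volume : Measure R2).prod ν) ≃ₗᵢ[ℂ] KS ι :=
  spec (Lp.fourierTransformₗᵢ R2 ℂ) b

lemma spT_ae (U : Lp ℂ 2 ((volume : Measure R2).prod ν)) (i : ι) :
    (fun ξ => spT b U (ξ, i)) =ᵐ[volume]
      (𝓕 (partialPair volume (b i) U) : Lp ℂ 2 (volume : Measure R2)) :=
  spec_ae _ b U i

/-- The inverse Fourier transform of `g ⊗ A` in the plane, expanded in a basis in the other
variables. -/
def gam (g : 𝓢(R2, ℂ)) (A : Lp ℂ 2 ν) : KS ι :=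
  spec (Lp.fourierTransformₗᵢ R2 ℂ).symm b (tens (g.toLp 2) A)

lemma gam_ae (g : 𝓢(R2, ℂ)) (A : Lp ℂ 2 ν) :
    gam b g A =ᵐ[(volume : Measure R2).prod Measure.count]
      fun p => 𝓕⁻ g p.1 * inner ℂ (b p.2) A := by
  refine ae_prod_count.2 fun i => ?_
  have h1 := spec_ae (Lp.fourierTransformₗᵢ R2 ℂ).symm b (tens (g.toLp 2) A) i
  rw [partialPair_tens, map_smul] at h1
  have h2 : (Lp.fourierTransformₗᵢ R2 ℂ).symm (g.toLp 2) = (𝓕⁻ g).toLp 2 :=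
    SchwartzMap.toLp_fourierInv_eq g
  rw [h2] at h1
  filter_upwards [h1, Lp.coeFn_smul (inner ℂ (b i) A) ((𝓕⁻ g).toLp 2),
    (𝓕⁻ g).coeFn_toLp 2] with ξ k1 k2 k3
  change gam b g A (ξ, i) = _ at k1
  rw [k1, k2, Pi.smul_apply, k3, smul_eq_mul, mul_comm]

lemma spT_tens_ae (g : 𝓢(R2, ℂ)) (A : Lp ℂ 2 ν) :
    spT b (tens (g.toLp 2) A) =ᵐ[(volume : Measure R2).prod Measure.count]
      fun p => 𝓕 g p.1 * inner ℂ (b p.2) A := by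
  refine ae_prod_count.2 fun i => ?_
  have h1 := spT_ae b (tens (g.toLp 2) A) i
  rw [partialPair_tens, FourierTransform.fourier_smul, SchwartzMap.toLp_fourier_eq] at h1
  filter_upwards [h1, Lp.coeFn_smul (inner ℂ (b i) A) ((𝓕 g).toLp 2),
    (𝓕 g).coeFn_toLp 2] with ξ k1 k2 k3
  rw [k1, k2, Pi.smul_apply, k3, smul_eq_mul, mul_comm]

lemma inner_star_right {c : Lp ℂ 2 ν} (hc : ∀ᵐ q ∂ν, starRingEnd ℂ (c q) = c q) (A : Lp ℂ 2 ν) :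
    inner ℂ c (star A) = starRingEnd ℂ (inner ℂ c A) := by
  rw [inner_eq_integral, inner_eq_integral, ← integral_conj]
  refine integral_congr_ae ?_
  filter_upwards [hc, Lp.coeFn_star A] with q h1 h2
  rw [h2, map_mul, Complex.conj_conj, h1]
  rfl

/-- Parseval's identity for the bilinear pairing. -/
lemma integral_mul_tensor (hb : ∀ i, ∀ᵐ q ∂ν, starRingEnd ℂ (b i q) = b i q)
    (U : Lp ℂ 2 ((volume : Measure R2).prod ν)) (g : 𝓢(R2, ℂ)) (A : Lp ℂ 2 ν) :
    ∫ p, U p * (g p.1 * A p.2) ∂((volume : Measure R2).prod ν) =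
      ∫ p, spT b U p * gam b g A p ∂((volume : Measure R2).prod Measure.count) := by
  have h1 : ∫ p, U p * (g p.1 * A p.2) ∂((volume : Measure R2).prod ν) =
      inner ℂ (tens ((conjS g).toLp 2) (star A)) U := by
    rw [inner_eq_integral]
    refine integral_congr_ae ?_
    filter_upwards [tens_eq_of_ae ((conjS g).coeFn_toLp 2 volume) (Lp.coeFn_star A)] with p hp
    rw [hp, map_mul, conjS_apply, Complex.conj_conj, Pi.star_apply, RCLike.star_def,
      Complex.conj_conj, mul_comm]
  rw [h1, ← (spT b).inner_map_map, inner_eq_integral]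
  refine integral_congr_ae ?_
  -- The conjugate required by the inner product turns `𝓕` into `𝓕⁻`; because the basis is real, the
  -- conjugations of the coefficients of `A` cancel.
  filter_upwards [spT_tens_ae b (conjS g) (star A), gam_ae b g A] with p k1 k2
  rw [k1, k2, fourier_conjS, inner_star_right (hb p.2), map_mul, Complex.conj_conj,
    Complex.conj_conj, mul_comm]

/-- The symbol of `1 - Δ` on the spectral side. -/
def wtI (nu : ι → ℝ) (p : R2 × ι) : ℝ := wt (nu p.2) p.1

lemma measurable_wtI (nu : ι → ℝ) : Measurable (wtI nu) := by
  have h1 : Measurable nu := measurable_of_countable nu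
  unfold wtI wt
  fun_prop

lemma one_le_wtI (hnu : ∀ i, 0 ≤ nu i) (p : R2 × ι) : 1 ≤ wtI nu p := wt_pos (hnu p.2) p.1

/-- The inverse of the symbol. -/
def invI (hnu : ∀ i, 0 ≤ nu i) (p : R2 × ι) : I :=
  ⟨(wtI nu p)⁻¹, inv_nonneg.2 (zero_le_one.trans (one_le_wtI hnu p)),
    inv_le_one_of_one_le₀ (one_le_wtI hnu p)⟩

lemma measurable_invI (hnu : ∀ i, 0 ≤ nu i) : Measurable (invI hnu) :=
  (measurable_wtI nu).inv.subtype_mk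

/-- Multiplication with the power `-β` of the symbol. -/
def mulPow (hnu : ∀ i, 0 ≤ nu i) (β : ℝ) (hβ : 0 ≤ β) : KS ι →L[ℂ] KS ι :=
  mult _ (measurable_invI hnu) (powI β hβ)

lemma mulPow_ae (hnu : ∀ i, 0 ≤ nu i) {β : ℝ} (hβ : 0 ≤ β) (y : KS ι) :
    mulPow hnu β hβ y =ᵐ[(volume : Measure R2).prod Measure.count]
      fun p => ((wtI nu p ^ (-β) : ℝ) : ℂ) * y p := by
  refine (coeFn_mult _ _ y).trans (Eventually.of_forall fun p => ?_)
  change (((wtI nu p)⁻¹ ^ β : ℝ) : ℂ) * y p = ((wtI nu p ^ (-β) : ℝ) : ℂ) * y p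
  rw [Real.rpow_neg (zero_le_one.trans (one_le_wtI hnu p)),
    Real.inv_rpow (zero_le_one.trans (one_le_wtI hnu p))]

/-- `B` is the image of `A` under the diagonal operator with eigenvalues `-ν i`. -/
def IsDiag (nu : ι → ℝ) (A B : Lp ℂ 2 ν) : Prop :=
  ∀ i, inner ℂ (b i) B = -(nu i : ℂ) * inner ℂ (b i) A

/-- The spectral representation of `(1 - Δ)(g ⊗ A)`. -/
def dgam (g : 𝓢(R2, ℂ)) (A B : Lp ℂ 2 ν) : KS ι := gam b (helm 0 g) A - gam b g B

/-- `dgam` is square integrable by construction, so the transform of `g ⊗ A` times the symbol is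
square integrable as soon as `A` has a Laplacian `B` in `L²`. These two orders are what pairings of
negative order consume. -/
lemma dgam_ae {A B : Lp ℂ 2 ν} (h : IsDiag b nu A B) (g : 𝓢(R2, ℂ)) :
    dgam b g A B =ᵐ[(volume : Measure R2).prod Measure.count]
      fun p => (wtI nu p : ℂ) * (𝓕⁻ g p.1 * inner ℂ (b p.2) A) := by
  filter_upwards [Lp.coeFn_sub (gam b (helm 0 g) A) (gam b g B), gam_ae b (helm 0 g) A,
    gam_ae b g B] with p k1 k2 k3
  rw [dgam, k1, Pi.sub_apply, k2, k3, fourierInv_helm, h p.2, wtI, wt, wt]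
  push_cast
  ring

lemma wtI_rpow_mul (hnu : ∀ i, 0 ≤ nu i) (s : ℝ) (p : R2 × ι) :
    wtI nu p ^ (-(1 + s / 2)) * wtI nu p = wtI nu p ^ (-(s / 2)) := by
  have h0 : 0 < wtI nu p := zero_lt_one.trans_le (one_le_wtI hnu p)
  rw [← Real.rpow_add_one h0.ne']
  congr 1
  ring

/-- One factor of the symbol comes from `dgam`, the rest from a bounded multiplier; its exponent has
the right sign precisely when `-2 ≤ s`. -/
lemma mulPow_dgam_ae (hnu : ∀ i, 0 ≤ nu i) {A B : Lp ℂ 2 ν} (h : IsDiag b nu A B) (g : 𝓢(R2, ℂ))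
    {s : ℝ} (hs : 0 ≤ 1 + s / 2) :
    mulPow hnu (1 + s / 2) hs (dgam b g A B) =ᵐ[(volume : Measure R2).prod Measure.count]
      fun p => ((wtI nu p ^ (-(s / 2)) : ℝ) : ℂ) * (𝓕⁻ g p.1 * inner ℂ (b p.2) A) := by
  filter_upwards [mulPow_ae hnu hs (dgam b g A B), dgam_ae b h g] with p k1 k2
  rw [k1, k2, ← mul_assoc, ← Complex.ofReal_mul, wtI_rpow_mul hnu]

/-- The bilinear pairing with the function `y` of the weighted spectral representation of
`g ⊗ A`. -/
def pairS (nu : ι → ℝ) (s : ℝ) (y : KS ι) (g : 𝓢(R2, ℂ)) (A : Lp ℂ 2 ν) : ℂ :=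
  ∫ p, y p * (((wtI nu p ^ (-(s / 2)) : ℝ) : ℂ) * (𝓕⁻ g p.1 * inner ℂ (b p.2) A))
    ∂((volume : Measure R2).prod Measure.count)

/-- The bilinear pairing of two square integrable functions. -/
lemma integral_mul_star_inner {X : Type*} [MeasurableSpace X] {μ : Measure X} (y z : Lp ℂ 2 μ) :
    ∫ p, y p * z p ∂μ = inner ℂ (star y) z := by
  rw [inner_eq_integral]
  refine integral_congr_ae ?_
  filter_upwards [Lp.coeFn_star y] with p hp
  rw [hp, Pi.star_apply, RCLike.star_def, Complex.conj_conj]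

/-- As an inner product with `dgam`, the pairing is visibly continuous in `y` and, for the graph
norm, in `(A, B)`. -/
lemma pairS_eq_inner (hnu : ∀ i, 0 ≤ nu i) {A B : Lp ℂ 2 ν} (h : IsDiag b nu A B)
    (g : 𝓢(R2, ℂ)) {s : ℝ} (hs : 0 ≤ 1 + s / 2) (y : KS ι) :
    pairS b nu s y g A = inner ℂ (star y) (mulPow hnu (1 + s / 2) hs (dgam b g A B)) := by
  rw [← integral_mul_star_inner, pairS]
  refine integral_congr_ae ?_
  filter_upwards [mulPow_dgam_ae b hnu h g hs] with p hp
  rw [hp]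

lemma integrable_pairS (hnu : ∀ i, 0 ≤ nu i) {A B : Lp ℂ 2 ν} (h : IsDiag b nu A B)
    (g : 𝓢(R2, ℂ)) {s : ℝ} (hs : 0 ≤ 1 + s / 2) (y : KS ι) :
    Integrable (fun p => y p * (((wtI nu p ^ (-(s / 2)) : ℝ) : ℂ) *
      (𝓕⁻ g p.1 * inner ℂ (b p.2) A))) ((volume : Measure R2).prod Measure.count) := by
  refine ((Lp.memLp y).integrable_mul (Lp.memLp (mulPow hnu (1 + s / 2) hs
    (dgam b g A B)))).congr ?_
  filter_upwards [mulPow_dgam_ae b hnu h g hs] with p hp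
  rw [Pi.mul_apply, hp]

lemma continuous_dgam (g : 𝓢(R2, ℂ)) :
    Continuous fun p : Lp ℂ 2 ν × Lp ℂ 2 ν => dgam b g p.1 p.2 := by
  have h : ∀ g : 𝓢(R2, ℂ), Continuous fun A => gam b g A := fun g => by
    simp only [gam]
    exact continuous_map_tens _ _
  exact Continuous.sub ((h _).comp continuous_fst) ((h _).comp continuous_snd)

lemma isClosed_isDiag (nu : ι → ℝ) :
    IsClosed {p : Lp ℂ 2 ν × Lp ℂ 2 ν | IsDiag b nu p.1 p.2} := by
  simp only [IsDiag, Set.ofPred_forall]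
  refine isClosed_iInter fun i => isClosed_eq ?_ ?_
  · exact continuous_const.inner continuous_snd
  · exact continuous_const.mul (continuous_const.inner continuous_fst)

end SpectralSide

/-! ### Test functions on `ℝ² × Σ²` -/

section TestFunctions

open Laplacian

variable {S : Type*} [TopologicalSpace S] [ChartedSpace R3 S] [T2Space S] [CompactSpace S]
  [SecondCountableTopology S] [IsManifold (𝓡 3) ∞ S] [MeasurableSpace S] [BorelSpace S]
  {h : Bundle.RiemannianMetric (fun p : S => TangentSpace (𝓡 3) p)}
  {f f' : R2 × S × S → ℂ}

lemma two_le_infty : (2 : ℕ∞ω) ≤ ((⊤ : ℕ∞) : ℕ∞ω) := by exact_mod_cast natCast_le_infty 2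

lemma contMDiff_of_mem_testM (hf : f ∈ testM S) :
    ContMDiff ((𝓡 2).prod ((𝓡 3).prod (𝓡 3))) 𝓘(ℝ, ℂ) ∞ f := hf.1

lemma slice_mem_smooth2 (hf : f ∈ testM S) (z : R2) : (fun q => f (z, q)) ∈ smooth2 S :=
  (contMDiff_of_mem_testM hf).comp (contMDiff_const.prodMk contMDiff_id)

lemma contDiff_slice (hf : f ∈ testM S) (q : S × S) : ContDiff ℝ ∞ fun z => f (z, q) :=
  contMDiff_iff_contDiff.1
    ((contMDiff_of_mem_testM hf).comp (contMDiff_id.prodMk contMDiff_const))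

/-- The projection to the plane of the support of a function. -/
def planeSupp (f : R2 × S × S → ℂ) : Set R2 := Prod.fst '' tsupport f

lemma isCompact_planeSupp (hf : f ∈ testM S) : IsCompact (planeSupp f) :=
  IsCompact.image hf.2 continuous_fst

lemma eq_zero_of_notMem_planeSupp {z : R2} (hz : z ∉ planeSupp f) (q : S × S) : f (z, q) = 0 :=
  image_eq_zero_of_notMem_tsupport fun h => hz ⟨_, h, rfl⟩

/-- A smooth function with compact support, restricted to a plane. -/
def sliceS (hf : f ∈ testM S) (q : S × S) : 𝓢(R2, ℂ) :=
  (HasCompactSupport.intro (isCompact_planeSupp hf) fun _ hz =>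
    eq_zero_of_notMem_planeSupp hz q : HasCompactSupport fun z => f (z, q)).toSchwartzMap
    (contDiff_slice hf q)

/-- The part of `laplM` that acts in the plane. -/
def laplPlane (f : R2 × S × S → ℂ) (p : R2 × S × S) : ℂ :=
  Laplacian.laplacian (fun z : R2 => f (z, p.2)) p.1

/-- The part of `laplM` that acts in `S × S`. -/
def laplFibre (h : Bundle.RiemannianMetric (fun p : S => TangentSpace (𝓡 3) p))
    (f : R2 × S × S → ℂ) (p : R2 × S × S) : ℂ := lapl2 h (fun q => f (p.1, q)) p.2

lemma laplM_eq (f : R2 × S × S → ℂ) (p : R2 × S × S) :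
    laplM h f p = laplPlane f p + laplFibre h f p := rfl

lemma laplacian_eq_sum_fderiv {u : R2 → ℂ} (hu : ContDiff ℝ ∞ u) (z : R2) :
    Laplacian.laplacian u z = ∑ i : Fin 2,
      fderiv ℝ (fun y => fderiv ℝ u y (EuclideanSpace.single i 1)) z
        (EuclideanSpace.single i 1) := by
  rw [InnerProductSpace.laplacian_eq_iteratedFDeriv_orthonormalBasis u
    (EuclideanSpace.basisFun (Fin 2) ℝ)]
  refine Finset.sum_congr rfl fun i _ => ?_
  have hd : DifferentiableAt ℝ (fderiv ℝ u) z :=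
    ((hu.fderiv_right (m := ∞) (by simp)).differentiable (by simp)) z
  rw [iteratedFDeriv_two_apply, fderiv_clm_apply hd (differentiableAt_const _)]
  simp

lemma continuous_laplPlane (hf : f ∈ testM S) : Continuous (laplPlane f) := by
  have h0 : ContMDiff (((𝓡 3).prod (𝓡 3)).prod (𝓡 2)) 𝓘(ℝ, ℂ) ∞
      fun p : (S × S) × R2 => f (p.2, p.1) :=
    (contMDiff_of_mem_testM hf).comp (contMDiff_snd.prodMk contMDiff_fst)
  have h1 : ∀ i : Fin 2, ContMDiff (((𝓡 3).prod (𝓡 3)).prod (𝓡 2)) 𝓘(ℝ, ℂ) ∞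
      fun p : (S × S) × R2 => fderiv ℝ (fun y => f (y, p.1)) p.2 (EuclideanSpace.single i 1) :=
    fun i p => contMDiffAt_fderiv_param (h0 p) _
  have h2 : ∀ i : Fin 2, ContMDiff (((𝓡 3).prod (𝓡 3)).prod (𝓡 2)) 𝓘(ℝ, ℂ) ∞
      fun p : (S × S) × R2 => fderiv ℝ (fun z => fderiv ℝ (fun y => f (y, p.1)) z
        (EuclideanSpace.single i 1)) p.2 (EuclideanSpace.single i 1) :=
    fun i p => contMDiffAt_fderiv_param (h1 i p) _
  have h3 : laplPlane f = fun p => ∑ i : Fin 2, fderiv ℝ (fun z => fderiv ℝ (fun y => f (y, p.2)) z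
        (EuclideanSpace.single i 1)) p.1 (EuclideanSpace.single i 1) := by
    funext p
    exact laplacian_eq_sum_fderiv (contDiff_slice hf p.2) p.1
  rw [h3]
  exact continuous_finsetSum _ fun i _ => (h2 i).continuous.comp continuous_swap

lemma continuous_laplFibre (hh : IsC11 h) (hf : f ∈ testM S) : Continuous (laplFibre h f) := by
  have hf' := contMDiff_of_mem_testM hf
  have h1 : ContMDiff (((𝓡 2).prod (𝓡 3)).prod (𝓡 3)) 𝓘(ℝ, ℂ) ∞
      fun p : (R2 × S) × S => f (p.1.1, (p.2, p.1.2)) :=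
    hf'.comp (contMDiff_fst.fst.prodMk (contMDiff_snd.prodMk contMDiff_fst.snd))
  have h2 : ContMDiff (((𝓡 2).prod (𝓡 3)).prod (𝓡 3)) 𝓘(ℝ, ℂ) ∞
      fun p : (R2 × S) × S => f (p.1.1, (p.1.2, p.2)) :=
    hf'.comp (contMDiff_fst.fst.prodMk (contMDiff_fst.snd.prodMk contMDiff_snd))
  have c1 := (continuous_lapl_param hh h1).comp
    (g := fun p : (R2 × S) × S => lapl h (fun x => f (p.1.1, (x, p.1.2))) p.2)
    (f := fun p : R2 × S × S => ((p.1, p.2.2), p.2.1)) (by fun_prop)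
  have c2 := (continuous_lapl_param hh h2).comp
    (g := fun p : (R2 × S) × S => lapl h (fun x => f (p.1.1, (p.1.2, x))) p.2)
    (f := fun p : R2 × S × S => ((p.1, p.2.1), p.2.2)) (by fun_prop)
  exact c1.add c2

lemma lapl2_zero (q : S × S) : lapl2 h (fun _ => 0) q = 0 := by
  have := lapl2_smul (h := h) 0 (fun _ => 0) q
  simpa using this

/-- The fibre `S × S` is compact, so only the support in the plane matters. -/
lemma hasCompactSupport_of_plane (hf : f ∈ testM S) {k : R2 × S × S → ℂ}
    (hk : ∀ z ∉ planeSupp f, ∀ q, k (z, q) = 0) : HasCompactSupport k :=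
  HasCompactSupport.intro ((isCompact_planeSupp hf).prod isCompact_univ) fun p hp =>
    hk p.1 (fun h1 => hp ⟨h1, Set.mem_univ _⟩) p.2

lemma hasCompactSupport_laplPlane (hf : f ∈ testM S) : HasCompactSupport (laplPlane f) := by
  refine hasCompactSupport_of_plane hf fun z hz q => ?_
  have h1 : (fun z => f (z, q)) =ᶠ[𝓝 z] fun _ => 0 := by
    filter_upwards [(isCompact_planeSupp hf).isClosed.isOpen_compl.mem_nhds hz] with y hy
    exact eq_zero_of_notMem_planeSupp hy q
  rw [laplPlane, (InnerProductSpace.laplacian_congr_nhds h1).eq_of_nhds]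
  simp

lemma hasCompactSupport_laplFibre (hf : f ∈ testM S) : HasCompactSupport (laplFibre h f) := by
  refine hasCompactSupport_of_plane hf fun z hz q => ?_
  have h1 : (fun q => f (z, q)) = fun _ => 0 := funext fun q => eq_zero_of_notMem_planeSupp hz q
  rw [laplFibre, h1, lapl2_zero]

lemma laplM_smul (c : ℂ) (hf : f ∈ testM S) (p : R2 × S × S) :
    laplM h (fun p => c * f p) p = c * laplM h f p := by
  rw [laplM, laplM, lapl2_smul, mul_add]
  congr 1
  have := (contDiff_slice hf p.2).contDiffAt (x := p.1)
  exact InnerProductSpace.laplacian_smul c (this.of_le two_le_infty)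

lemma laplM_add (hh : IsC11 h) (hf : f ∈ testM S) (hf' : f' ∈ testM S) (p : R2 × S × S) :
    laplM h (fun p => f p + f' p) p = laplM h f p + laplM h f' p := by
  rw [laplM, laplM, laplM, lapl2_add hh (slice_mem_smooth2 hf p.1) (slice_mem_smooth2 hf' p.1)]
  have e1 := (contDiff_slice hf p.2).contDiffAt (x := p.1)
  have e2 := (contDiff_slice hf' p.2).contDiffAt (x := p.1)
  have e3 : Laplacian.laplacian (fun z => f (z, p.2) + f' (z, p.2)) p.1 = _ :=
    ContDiffAt.laplacian_add (e1.of_le two_le_infty) (e2.of_le two_le_infty)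
  rw [e3]
  ring

lemma tensor_mem_testM {g : 𝓢(R2, ℂ)} (hg : HasCompactSupport g) {a : S × S → ℂ}
    (ha : a ∈ smooth2 S) : (fun p : R2 × S × S => g p.1 * a p.2) ∈ testM S := by
  refine ⟨?_, HasCompactSupport.intro (IsCompact.prod hg isCompact_univ) fun p hp => ?_⟩
  · have h1 : ContMDiff (𝓡 2) 𝓘(ℝ, ℂ) ∞ g := (g.smooth ⊤).contMDiff
    have h2 : ContMDiff ((𝓡 3).prod (𝓡 3)) 𝓘(ℝ, ℂ) ∞ a := ha
    exact (contDiff_fst.mul contDiff_snd :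
      ContDiff ℝ ∞ fun p : ℂ × ℂ => p.1 * p.2).contMDiff.comp
      ((h1.comp contMDiff_fst).prodMk_space (h2.comp contMDiff_snd))
  · rw [image_eq_zero_of_notMem_tsupport fun h1 => hp ⟨h1, Set.mem_univ _⟩, zero_mul]

lemma sub_laplM_tensor (g : 𝓢(R2, ℂ)) (a : S × S → ℂ) (p : R2 × S × S) :
    g p.1 * a p.2 - laplM h (fun p => g p.1 * a p.2) p =
      helm 0 g p.1 * a p.2 - g p.1 * lapl2 h a p.2 := by
  have h1 : Laplacian.laplacian (fun z => g z * a p.2) p.1 =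
      a p.2 * Laplacian.laplacian (g : R2 → ℂ) p.1 := by
    simp only [mul_comm (g _)]
    exact InnerProductSpace.laplacian_smul (a p.2) ((g.smooth ⊤).contDiffAt.of_le two_le_infty)
  have h2 : laplM h (fun p => g p.1 * a p.2) p =
      Laplacian.laplacian (fun z => g z * a p.2) p.1 + lapl2 h (fun q => g p.1 * a q) p.2 := rfl
  rw [h2, lapl2_smul, h1, helm_apply]
  push_cast
  ring

end TestFunctions

/-! ### Closures of graphs -/

section Closures

lemma of_mem_closure {X : Type*} [TopologicalSpace X] {A : Set X} {P : X → Prop}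
    (hP : IsClosed {x | P x}) (hA : ∀ x ∈ A, P x) {x : X} (hx : x ∈ closure A) : P x :=
  closure_minimal hA hP hx

lemma apply_eq_of_mem_closure {V : Type*} [NormedAddCommGroup V] [NormedSpace ℂ V]
    (R : V →L[ℂ] V) {A : Set (V × V)} (hA : ∀ w v, (w, v) ∈ A → R v = w) {w v : V}
    (hwv : (w, v) ∈ closure A) : R v = w :=
  of_mem_closure (P := fun p : V × V => R p.2 = p.1)
    (isClosed_eq (R.continuous.comp continuous_snd) continuous_fst) (fun p hp => hA p.1 p.2 hp) hwv

/-- The vectors `v` with `(R v, v)` in the closure of `G` form a closed subspace, since `R` is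
continuous. It contains `D`, whose orthogonal complement is zero. -/
lemma mem_closure_of_dense {V : Type*} [NormedAddCommGroup V] [InnerProductSpace ℂ V]
    [CompleteSpace V] {R : V →L[ℂ] V} {G : Submodule ℂ (V × V)} {D : Set V}
    (hD : ∀ v ∈ D, (R v, v) ∈ closure (G : Set (V × V)))
    (hdense : ∀ U : V, (∀ v ∈ D, inner ℂ v U = 0) → U = 0) (v : V) :
    (R v, v) ∈ closure (G : Set (V × V)) := by
  let L : V →L[ℂ] V × V := R.prod (ContinuousLinearMap.id ℂ V)
  let K : Submodule ℂ V := G.topologicalClosure.comap L.toLinearMap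
  have hK : IsClosed (K : Set V) := G.isClosed_topologicalClosure.preimage L.continuous
  have hbot : Kᗮ = ⊥ := by
    rw [Submodule.eq_bot_iff]
    exact fun U hU => hdense U fun v hv => hU v (hD v hv)
  have htop : K = ⊤ := by
    have := (Submodule.topologicalClosure_eq_top_iff (K := K)).2 hbot
    rwa [hK.submodule_topologicalClosure_eq] at this
  have hv : v ∈ K := htop ▸ Submodule.mem_top
  exact hv

end Closures

/-! ### The resolvent and essential self-adjointness of `I - Δ` -/

section Resolvent

open FourierTransform

/-- Test with `𝓕 k`: the symbol comes out of `𝓕⁻ (helm ν (𝓕 k))`, and Schwartz functions separate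
locally integrable functions. -/
lemma fourier_ae_eq_of_weak {v w : Lp ℂ 2 (volume : Measure R2)} {ν : ℝ}
    (h : ∀ g : 𝓢(R2, ℂ), ∫ x, v x * g x = ∫ x, w x * helm ν g x) :
    (𝓕 v : Lp ℂ 2 (volume : Measure R2)) =ᵐ[volume] fun ξ => (wt ν ξ : ℂ) * (𝓕 w) ξ := by
  have hv := (Lp.memLp (𝓕 v)).locallyIntegrable one_le_two
  have hw : LocallyIntegrable (fun ξ => (wt ν ξ : ℂ) * (𝓕 w) ξ) := by
    have h2 := (Lp.memLp (𝓕 w)).locallyIntegrable one_le_two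
    rw [locallyIntegrable_iff] at h2 ⊢
    exact fun K hK => (h2 K hK).continuousOn_mul
      (Complex.continuous_ofReal.comp (continuous_wt ν)).continuousOn hK
  have h0 := ae_eq_zero_of_integral_mul_schwartz (hv.sub hw) fun k hk => by
    have h1 := h (𝓕 k)
    rw [← integral_fourier_mul_fourierInv v, ← integral_fourier_mul_fourierInv w] at h1
    simp only [fourierInv_helm, FourierTransform.fourierInv_fourier_eq] at h1
    have i1 : Integrable fun ξ => (𝓕 v) ξ * k ξ :=
      (Lp.memLp (𝓕 v)).integrable_mul (k.memLp 2)
    have i2 : Integrable fun ξ => (wt ν ξ : ℂ) * (𝓕 w) ξ * k ξ := by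
      refine ((Lp.memLp (𝓕 w)).integrable_mul ((𝓕 (helm ν (𝓕⁻ k))).memLp 2)).congr
        (Eventually.of_forall fun ξ => ?_)
      simp only [Pi.mul_apply, fourier_helm, FourierTransform.fourier_fourierInv_eq]
      ring
    simp only [Pi.sub_apply, sub_mul]
    rw [integral_sub i1 i2, h1, sub_eq_zero]
    refine integral_congr_ae (Eventually.of_forall fun ξ => ?_)
    ring
  filter_upwards [h0] with ξ hξ
  exact sub_eq_zero.1 hξ

lemma integral_partialPair_mul {Y : Type*} [MeasurableSpace Y] {ν : Measure Y} [SigmaFinite ν]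
    {c : Lp ℂ 2 ν} (hc : ∀ᵐ q ∂ν, starRingEnd ℂ (c q) = c q)
    (U : Lp ℂ 2 ((volume : Measure R2).prod ν)) (g : 𝓢(R2, ℂ)) :
    ∫ z, (partialPair volume c U) z * g z =
      ∫ p, U p * (g p.1 * c p.2) ∂((volume : Measure R2).prod ν) := by
  have h1 : ∫ z, (partialPair volume c U) z * g z =
      inner ℂ ((conjS g).toLp 2) (partialPair volume c U) := by
    rw [inner_eq_integral]
    refine integral_congr_ae ?_
    filter_upwards [(conjS g).coeFn_toLp 2] with z hz
    rw [hz, conjS_apply, Complex.conj_conj, mul_comm]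
  have hc' : (fun q => starRingEnd ℂ (c q)) =ᵐ[ν] c := hc
  rw [h1, inner_partialPair_right, inner_eq_integral]
  refine integral_congr_ae ?_
  filter_upwards [tens_eq_of_ae ((conjS g).coeFn_toLp 2 volume) hc'.symm] with p h2
  rw [h2, map_mul, conjS_apply, Complex.conj_conj, Complex.conj_conj, mul_comm]

lemma helm_conjS (r : ℝ) (g : 𝓢(R2, ℂ)) (x : R2) :
    helm r (conjS g) x = starRingEnd ℂ (helm r g x) := by
  have h1 : Laplacian.laplacian (conjS g : R2 → ℂ) x =
      starRingEnd ℂ (Laplacian.laplacian (g : R2 → ℂ) x) :=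
    ContDiffAt.laplacian_CLM_comp_left (l := (Complex.conjCLE : ℂ →L[ℝ] ℂ))
      ((g.smooth ⊤).contDiffAt.of_le two_le_infty)
  rw [helm_apply, helm_apply, h1, map_sub, map_mul, Complex.conj_ofReal, conjS_apply]

lemma inner_tens_helm {Y : Type*} [MeasurableSpace Y] {ν : Measure Y} [SigmaFinite ν] (r : ℝ)
    (g : 𝓢(R2, ℂ)) (c : Lp ℂ 2 ν) (U : Lp ℂ 2 ((volume : Measure R2).prod ν)) :
    inner ℂ (tens ((helm r (conjS g)).toLp 2 volume) c) U =
      ∫ z, (partialPair volume c U) z * helm r g z := by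
  rw [← inner_partialPair_right, inner_eq_integral]
  refine integral_congr_ae ?_
  filter_upwards [(helm r (conjS g)).coeFn_toLp 2 volume] with x hx
  rw [hx, helm_conjS, Complex.conj_conj, mul_comm]

variable {S : Type*} [TopologicalSpace S] [ChartedSpace R3 S] [T2Space S] [CompactSpace S]
  [SecondCountableTopology S] [IsManifold (𝓡 3) ∞ S] [MeasurableSpace S] [BorelSpace S]
  {h : Bundle.RiemannianMetric (fun p : S => TangentSpace (𝓡 3) p)} [IsFiniteMeasure (vol h)]
  {ι : Type*} [MeasurableSpace ι] [MeasurableSingletonClass ι] [Countable ι]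
  {b : HilbertBasis ι ℂ (Lp ℂ 2 (vol2 h))} {nu : ι → ℝ} {f f' : R2 × S × S → ℂ}

lemma integrable_mul_tensor_basis {k : R2 × S × S → ℂ} (hk : Continuous k)
    (hkc : HasCompactSupport k) (g : 𝓢(R2, ℂ)) (A : Lp ℂ 2 (vol2 h)) :
    Integrable (fun p => k p * (g p.1 * A p.2)) (volM h) :=
  (hk.memLp_of_hasCompactSupport (p := 2) hkc).integrable_mul (memLp_tensor (g.memLp 2) (Lp.memLp A))

lemma integral_laplPlane_mul (hf : f ∈ testM S) (g : 𝓢(R2, ℂ)) (A : Lp ℂ 2 (vol2 h)) :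
    ∫ p, laplPlane f p * (g p.1 * A p.2) ∂(volM h) =
      ∫ p, f p * (Laplacian.laplacian g p.1 * A p.2) ∂(volM h) := by
  have hcf := (contMDiff_of_mem_testM hf).continuous
  rw [integral_prod_symm _ (integrable_mul_tensor_basis (continuous_laplPlane hf)
    (hasCompactSupport_laplPlane hf) g A), integral_prod_symm _ (integrable_mul_tensor_basis hcf hf.2
    (Laplacian.laplacian g) A)]
  refine integral_congr_ae (Eventually.of_forall fun q => ?_)
  have h1 : ∫ z, sliceS hf q z * Laplacian.laplacian g z =
      ∫ z, Laplacian.laplacian (sliceS hf q) z * g z :=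
    SchwartzMap.integral_mul_laplacian_right_eq_left (sliceS hf q) g
  have h2 : ∀ z, laplPlane f (z, q) = Laplacian.laplacian (sliceS hf q) z := fun z => by
    rw [SchwartzMap.laplacian_apply]
    rfl
  simp only [h2, ← mul_assoc, integral_mul_const]
  congr 1
  exact h1.symm

lemma integral_laplFibre_mul (hh : IsC11 h) (hb : IsEigenBasis h b nu) (hf : f ∈ testM S)
    (g : 𝓢(R2, ℂ)) (i : ι) :
    ∫ p, laplFibre h f p * (g p.1 * b i p.2) ∂(volM h) =
      -(nu i : ℂ) * ∫ p, f p * (g p.1 * b i p.2) ∂(volM h) := by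
  have hcf := (contMDiff_of_mem_testM hf).continuous
  rw [integral_prod _ (integrable_mul_tensor_basis (continuous_laplFibre hh hf)
    (hasCompactSupport_laplFibre hf) g (b i)), integral_prod _ (integrable_mul_tensor_basis hcf hf.2
    g (b i)), ← integral_const_mul]
  refine integral_congr_ae (Eventually.of_forall fun z => ?_)
  have h1 := hb.integral_lapl2_mul i _ (slice_mem_smooth2 hf z)
  simp only [laplFibre, mul_left_comm _ (g z), integral_const_mul]
  rw [h1]

lemma integral_sub_laplM_mul (hh : IsC11 h) (hb : IsEigenBasis h b nu) (hf : f ∈ testM S)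
    (g : 𝓢(R2, ℂ)) (i : ι) :
    ∫ p, (f p - laplM h f p) * (g p.1 * b i p.2) ∂(volM h) =
      ∫ p, f p * (helm (nu i) g p.1 * b i p.2) ∂(volM h) := by
  have hcf := (contMDiff_of_mem_testM hf).continuous
  have i0 := fun g' : 𝓢(R2, ℂ) => integrable_mul_tensor_basis (h := h) hcf hf.2 g' (b i)
  have i1 := integrable_mul_tensor_basis (h := h) (continuous_laplPlane hf)
    (hasCompactSupport_laplPlane hf) g (b i)
  have i2 := integrable_mul_tensor_basis (continuous_laplFibre hh hf)
    (hasCompactSupport_laplFibre hf) g (b i)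
  have e1 : ∫ p, (f p - laplM h f p) * (g p.1 * b i p.2) ∂(volM h) =
      ∫ p, (f p * (g p.1 * b i p.2) - (laplPlane f p * (g p.1 * b i p.2) +
        laplFibre h f p * (g p.1 * b i p.2))) ∂(volM h) := by
    refine integral_congr_ae (Eventually.of_forall fun p => ?_)
    simp only [laplM_eq]
    ring
  have e2 : ∫ p, f p * (helm (nu i) g p.1 * b i p.2) ∂(volM h) =
      ∫ p, (((1 + nu i : ℝ) : ℂ) * (f p * (g p.1 * b i p.2)) -
        f p * (Laplacian.laplacian g p.1 * b i p.2)) ∂(volM h) := by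
    refine integral_congr_ae (Eventually.of_forall fun p => ?_)
    simp only [helm_apply, SchwartzMap.laplacian_apply]
    ring
  have e3 : ∫ p, (laplPlane f p * (g p.1 * b i p.2) +
        laplFibre h f p * (g p.1 * b i p.2)) ∂(volM h) =
      ∫ p, laplPlane f p * (g p.1 * b i p.2) ∂(volM h) +
        ∫ p, laplFibre h f p * (g p.1 * b i p.2) ∂(volM h) := integral_add i1 i2
  have e4 : ∫ p, (f p * (g p.1 * b i p.2) - (laplPlane f p * (g p.1 * b i p.2) +
        laplFibre h f p * (g p.1 * b i p.2))) ∂(volM h) =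
      ∫ p, f p * (g p.1 * b i p.2) ∂(volM h) - ∫ p, (laplPlane f p * (g p.1 * b i p.2) +
        laplFibre h f p * (g p.1 * b i p.2)) ∂(volM h) := integral_sub (i0 g) (i1.add i2)
  rw [e1, e2, e4, integral_sub ((i0 g).const_mul _)
    (i0 (Laplacian.laplacian g)), integral_const_mul, e3,
    integral_laplPlane_mul hf, integral_laplFibre_mul hh hb hf]
  push_cast
  ring

/-- Integration by parts shows that the coefficient of `f - Δf` at `i` is, weakly, `1 + ν i - Δ`
applied to the coefficient of `f`; the Fourier transform in the plane makes this a product. -/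
lemma spT_sub_laplM (hh : IsC11 h) (hb : IsEigenBasis h b nu) (hf : f ∈ testM S)
    {w v : Lp ℂ 2 (volM h)} (hw : w =ᵐ[volM h] f) (hv : v =ᵐ[volM h] fun p => f p - laplM h f p) :
    spT b v =ᵐ[(volume : Measure R2).prod Measure.count]
      fun p => (wtI nu p : ℂ) * spT b w p := by
  refine ae_prod_count.2 fun i => ?_
  have h1 := fourier_ae_eq_of_weak (v := partialPair volume (b i) v)
    (w := partialPair volume (b i) w) (ν := nu i) fun g => by
      rw [integral_partialPair_mul (hb.conj_eq i), integral_partialPair_mul (hb.conj_eq i)]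
      refine (integral_congr_ae ?_).trans
        ((integral_sub_laplM_mul hh hb hf g i).trans (integral_congr_ae ?_))
      · filter_upwards [hv] with p hp
        rw [hp]
      · filter_upwards [hw] with p hp
        rw [hp]
  filter_upwards [h1, spT_ae b v i, spT_ae b w i] with ξ k1 k2 k3
  rw [k2, k3, k1]
  rfl

/-- The resolvent on the spectral side. -/
def resolvent (hnu : ∀ i, 0 ≤ nu i) (b : HilbertBasis ι ℂ (Lp ℂ 2 (vol2 h))) :
    Lp ℂ 2 (volM h) →L[ℂ] Lp ℂ 2 (volM h) :=
  ((spT b).symm.toContinuousLinearEquiv : KS ι →L[ℂ] Lp ℂ 2 (volM h)) ∘L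
    (mulPow hnu 1 zero_le_one) ∘L
    ((spT b).toContinuousLinearEquiv : Lp ℂ 2 (volM h) →L[ℂ] KS ι)

lemma resolvent_apply (hnu : ∀ i, 0 ≤ nu i) (v : Lp ℂ 2 (volM h)) :
    resolvent hnu b v = (spT b).symm (mulPow hnu 1 zero_le_one (spT b v)) := rfl

lemma mulPow_one_eq (hnu : ∀ i, 0 ≤ nu i) {x y : KS ι}
    (hxy : x =ᵐ[(volume : Measure R2).prod Measure.count] fun p => (wtI nu p : ℂ) * y p) :
    mulPow hnu 1 zero_le_one x = y := by
  refine Lp.ext ?_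
  filter_upwards [mulPow_ae hnu zero_le_one x, hxy] with p k1 k2
  have h0 : wtI nu p ≠ 0 := (zero_lt_one.trans_le (one_le_wtI hnu p)).ne'
  rw [k1, k2, Real.rpow_neg_one, ← mul_assoc, ← Complex.ofReal_mul, inv_mul_cancel₀ h0,
    Complex.ofReal_one, one_mul]

/-- The graph of `I - Δ` on test functions. -/
def graphM (h : Bundle.RiemannianMetric (fun p : S => TangentSpace (𝓡 3) p)) :
    Set (Lp ℂ 2 (volM h) × Lp ℂ 2 (volM h)) :=
  opGraph (volM h) (testM S) fun f p => f p - laplM h f p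

lemma resolvent_of_mem_graphM (hh : IsC11 h) (hb : IsEigenBasis h b nu)
    {w v : Lp ℂ 2 (volM h)} (hwv : (w, v) ∈ graphM h) : resolvent hb.nonneg b v = w := by
  obtain ⟨f, hf, hw, hv⟩ := hwv
  have h1 : mulPow hb.nonneg 1 zero_le_one (spT b v) = spT b w :=
    mulPow_one_eq hb.nonneg (spT_sub_laplM hh hb hf hw hv)
  rw [resolvent_apply, h1]
  exact (spT b).symm_apply_apply w

attribute [irreducible] resolvent

lemma resolvent_of_mem_closure (hh : IsC11 h) (hb : IsEigenBasis h b nu)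
    {w v : Lp ℂ 2 (volM h)} (hwv : (w, v) ∈ closure (graphM h)) :
    resolvent hb.nonneg b v = w :=
  apply_eq_of_mem_closure _ (fun _ _ => resolvent_of_mem_graphM hh hb) hwv

lemma zero_mem_testM : (fun _ => 0 : R2 × S × S → ℂ) ∈ testM S :=
  ⟨contMDiff_const, HasCompactSupport.zero⟩

lemma add_mem_testM (hf : f ∈ testM S) (hf' : f' ∈ testM S) : (fun p => f p + f' p) ∈ testM S :=
  ⟨(contMDiff_of_mem_testM hf).add (contMDiff_of_mem_testM hf'), hf.2.add hf'.2⟩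

lemma smul_mem_testM (c : ℂ) (hf : f ∈ testM S) : (fun p => c * f p) ∈ testM S :=
  ⟨(smoothFunctions ((𝓡 2).prod ((𝓡 3).prod (𝓡 3))) (R2 × S × S)).smul_mem c hf.1,
    hf.2.mul_left (f := fun _ => c)⟩

/-- The graph of `I - Δ` on test functions, as a subspace. -/
def graphSub (hh : IsC11 h) : Submodule ℂ (Lp ℂ 2 (volM h) × Lp ℂ 2 (volM h)) where
  carrier := graphM h
  zero_mem' := by
    refine ⟨_, zero_mem_testM, Lp.coeFn_zero _ _ _, ?_⟩
    have h1 : ∀ p, laplM h (fun _ : R2 × S × S => (0 : ℂ)) p = 0 := fun p => by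
      have := laplM_smul (h := h) 0 zero_mem_testM p
      simpa using this
    filter_upwards [Lp.coeFn_zero ℂ 2 (volM h)] with p hp
    rw [h1, sub_zero]
    exact hp
  add_mem' := by
    rintro ⟨w, v⟩ ⟨w', v'⟩ ⟨f, hf, h1, h2⟩ ⟨f', hf', h1', h2'⟩
    refine ⟨_, add_mem_testM hf hf', ?_, ?_⟩
    · filter_upwards [Lp.coeFn_add w w', h1, h1'] with p k1 k2 k3
      exact k1.trans (congrArg₂ (· + ·) k2 k3)
    · filter_upwards [Lp.coeFn_add v v', h2, h2'] with p k1 k2 k3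
      refine k1.trans ((congrArg₂ (· + ·) k2 k3).trans ?_)
      rw [laplM_add hh hf hf']
      ring
  smul_mem' := by
    rintro c ⟨w, v⟩ ⟨f, hf, h1, h2⟩
    refine ⟨_, smul_mem_testM c hf, ?_, ?_⟩
    · filter_upwards [Lp.coeFn_smul c w, h1] with p k1 k2
      exact k1.trans (congrArg (c * ·) k2)
    · filter_upwards [Lp.coeFn_smul c v, h2] with p k1 k2
      refine k1.trans ((congrArg (c * ·) k2).trans ?_)
      rw [laplM_smul c hf]
      ring

lemma tens_helm {Y : Type*} [MeasurableSpace Y] {ν : Measure Y} [SigmaFinite ν] (r : ℝ)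
    (g : 𝓢(R2, ℂ)) (A : Lp ℂ 2 ν) :
    tens ((helm r g).toLp 2 volume) A =
      tens ((helm 0 g).toLp 2 volume) A - tens (g.toLp 2 volume) (-(r : ℂ) • A) := by
  have h2 : (helm r g).toLp 2 volume = (helm 0 g).toLp 2 volume + (r : ℂ) • g.toLp 2 volume := by
    rw [helm_eq]
    exact ((SchwartzMap.toLpCLM ℂ ℂ 2 volume).map_add _ _).trans
      (congrArg₂ (· + ·) rfl ((SchwartzMap.toLpCLM ℂ ℂ 2 volume).map_smul _ _))
  have h3 : tens ((helm 0 g).toLp 2 volume + (r : ℂ) • g.toLp 2 volume) A =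
      tens ((helm 0 g).toLp 2 volume) A + tens ((r : ℂ) • g.toLp 2 volume) A :=
    tensBilin.map_add₂ _ _ _
  rw [h2, h3, tens_smul_right, tens_smul_left, neg_smul, sub_neg_eq_add]

/-- `b i` need not be smooth, so `g ⊗ b i` need not be a test function; it is approximated by `g ⊗
a` with smooth `a` tending to `b i` in the graph norm. -/
lemma tens_mem_closure_graphM (hb : IsEigenBasis h b nu) {g : 𝓢(R2, ℂ)} (hg : HasCompactSupport g)
    (i : ι) : (tens (g.toLp 2 volume) (b i), tens ((helm (nu i) g).toLp 2 volume) (b i)) ∈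
      closure (graphM h) := by
  have hF : Continuous fun p : Lp ℂ 2 (vol2 h) × Lp ℂ 2 (vol2 h) =>
      ((tens (g.toLp 2 volume) p.1, tens ((helm 0 g).toLp 2 volume) p.1 -
        tens (g.toLp 2 volume) p.2) : Lp ℂ 2 (volM h) × Lp ℂ 2 (volM h)) := by
    refine Continuous.prodMk ?_ (Continuous.sub ?_ ?_)
    · exact (continuous_tens_right _).comp continuous_fst
    · exact (continuous_tens_right _).comp continuous_fst
    · exact (continuous_tens_right _).comp continuous_snd
  have h1 := map_mem_closure hF (hb.mem_closure i) (t := graphM h) (by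
    rintro ⟨A, B⟩ ⟨a, ha, hA, hB⟩
    refine ⟨_, tensor_mem_testM hg ha, tens_eq_of_ae (g.coeFn_toLp 2 volume) hA, ?_⟩
    filter_upwards [Lp.coeFn_sub (tens ((helm 0 g).toLp 2 volume) A) (tens (g.toLp 2 volume) B),
      tens_eq_of_ae ((helm 0 g).coeFn_toLp 2 volume) hA,
      tens_eq_of_ae (g.coeFn_toLp 2 volume) hB] with p k1 k2 k3
    refine k1.trans ?_
    rw [Pi.sub_apply, k2, k3, sub_laplM_tensor])
  rw [tens_helm]
  exact h1

lemma eq_zero_of_inner_helm (hnu : ∀ i, 0 ≤ nu i) (U : Lp ℂ 2 (volM h))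
    (hU : ∀ (g : 𝓢(R2, ℂ)) (i : ι), HasCompactSupport g →
      inner ℂ (tens ((helm (nu i) g).toLp 2 volume) (b i)) U = 0) : U = 0 := by
  refine eq_zero_of_partialPair b U fun i => ?_
  have key : ∀ g : 𝓢(R2, ℂ), HasCompactSupport g →
      ∫ z, (partialPair volume (b i) U) z * helm (nu i) g z = 0 := fun g hg =>
    (inner_tens_helm (nu i) g (b i) U).symm.trans
      (hU (conjS g) i (hg.comp_left (map_zero (starRingEnd ℂ))))
  exact eq_zero_of_integral_mul_helm (hnu i) key

lemma resolvent_tens_mem (hh : IsC11 h) (hb : IsEigenBasis h b nu) {g : 𝓢(R2, ℂ)}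
    (hg : HasCompactSupport g) (i : ι) :
    (resolvent hb.nonneg b (tens ((helm (nu i) g).toLp 2 volume) (b i)),
      tens ((helm (nu i) g).toLp 2 volume) (b i)) ∈ closure (graphM h) := by
  have h1 := tens_mem_closure_graphM hb hg i
  rw [resolvent_of_mem_closure hh hb h1]
  exact h1

/-- Surjectivity of the closed operator: the vectors `(1 + ν i - Δ)g ⊗ b i` lie in its range, and
only zero is orthogonal to all of them. -/
lemma mem_closure_graphM (hh : IsC11 h) (hb : IsEigenBasis h b nu) (v : Lp ℂ 2 (volM h)) :
    (resolvent hb.nonneg b v, v) ∈ closure (graphM h) :=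
  mem_closure_of_dense (R := resolvent hb.nonneg b) (G := graphSub hh)
    (D := {v | ∃ (g : 𝓢(R2, ℂ)) (i : ι), HasCompactSupport g ∧
      v = tens ((helm (nu i) g).toLp 2 volume) (b i)})
    (by
      rintro _ ⟨g, i, hg, rfl⟩
      exact resolvent_tens_mem hh hb hg i)
    (fun U hU => eq_zero_of_inner_helm hb.nonneg U fun g i hg => hU _ ⟨g, i, hg, rfl⟩) v

/-- The resolvent inverts the closure on both sides, and an everywhere defined inverse is unique.
The operator in `IsFracPow` is thereby explicit. -/
theorem isInverse_iff (hh : IsC11 h) (hb : IsEigenBasis h b nu)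
    (R : Lp ℂ 2 (volM h) →L[ℂ] Lp ℂ 2 (volM h)) : IsInverse h R ↔ R = resolvent hb.nonneg b := by
  constructor
  · intro hR
    ext1 v
    exact (hR _ v).1 (mem_closure_graphM hh hb v)
  · rintro rfl w v
    exact ⟨resolvent_of_mem_closure hh hb, fun hw => hw ▸ mem_closure_graphM hh hb v⟩

end Resolvent

/-! ### Fractional powers as multiplication operators -/

section FractionalPowers

open unitInterval

/-- The conjugate of an operator by a unitary. -/
def conjU {V K : Type*} [NormedAddCommGroup V] [InnerProductSpace ℂ V] [NormedAddCommGroup K]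
    [InnerProductSpace ℂ K] (T : V ≃ₗᵢ[ℂ] K) (A : K →L[ℂ] K) : V →L[ℂ] V :=
  (T.symm.toContinuousLinearEquiv : K →L[ℂ] V) ∘L A ∘L (T.toContinuousLinearEquiv : V →L[ℂ] K)

variable {V K : Type*} [NormedAddCommGroup V] [InnerProductSpace ℂ V] [NormedAddCommGroup K]
  [InnerProductSpace ℂ K]

lemma conjU_apply (T : V ≃ₗᵢ[ℂ] K) (A : K →L[ℂ] K) (v : V) : conjU T A v = T.symm (A (T v)) := rfl

lemma norm_conjU_le (T : V ≃ₗᵢ[ℂ] K) (A : K →L[ℂ] K) : ‖conjU T A‖ ≤ ‖A‖ := by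
  refine ContinuousLinearMap.opNorm_le_bound _ (norm_nonneg _) fun v => ?_
  rw [conjU_apply, LinearIsometryEquiv.norm_map, ← T.norm_map v]
  exact A.le_opNorm _

/-- Conjugation by a unitary, as a homomorphism of algebras. -/
def conjHom (T : V ≃ₗᵢ[ℂ] K) : (K →L[ℂ] K) →ₐ[ℝ] (V →L[ℂ] V) :=
  AlgHom.ofLinearMap
    { toFun := conjU T
      map_add' := fun A B => by ext v; simp [conjU_apply]
      map_smul' := fun c A => by
        ext v
        have h1 : T.symm (c • A (T v)) = c • T.symm (A (T v)) := by
          rw [← Complex.coe_smul, map_smul, Complex.coe_smul]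
        simpa [conjU_apply] using h1 }
    (by ext v; simp [conjU_apply])
    (fun A B => by ext v; simp [conjU_apply])

lemma powI_one : powI 1 zero_le_one = inclI := by
  ext x
  exact Real.rpow_one _

lemma inclI_nonneg : 0 ≤ inclI := fun x => x.2.1

lemma isPositive_conjU [CompleteSpace V] (T : V ≃ₗᵢ[ℂ] K) {A : K →L[ℂ] K}
    (h1 : ∀ u v, inner ℂ (A u) v = inner ℂ u (A v)) (h2 : ∀ u, 0 ≤ (inner ℂ (A u) u).re) :
    (conjU T A).IsPositive := by
  refine ⟨fun u v => ?_, fun u => ?_⟩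
  · change inner ℂ (T.symm (A (T u))) v = inner ℂ u (T.symm (A (T v)))
    rw [← T.inner_map_map, ← T.inner_map_map u, T.apply_symm_apply, T.apply_symm_apply, h1]
  · change 0 ≤ (inner ℂ (T.symm (A (T u))) u).re
    rw [← T.inner_map_map, T.apply_symm_apply]
    exact h2 _

/-- Conjugation by a unitary composed with the multiplier calculus is again a contractive algebra
homomorphism from continuous functions, and powers can be computed in any such calculus. -/
lemma opRpow_conjU [CompleteSpace V] {X : Type*} [MeasurableSpace X] {κ : Measure X} {t : X → I}
    (ht : Measurable t) (T : V ≃ₗᵢ[ℂ] Lp ℂ 2 κ) (α : ℝ) (hα : 0 ≤ α) :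
    opRpow (conjU T (mult κ ht inclI)) α = conjU T (mult κ ht (powI α hα)) :=
  opRpow_eq_of_algHom ((conjHom T).comp (multHom κ ht))
    (fun f => (norm_conjU_le T _).trans (norm_mult_le ht f))
    (isPositive_conjU T (inner_mult_left ht inclI) (inner_mult_self_nonneg ht inclI_nonneg)) α hα

variable {S : Type*} [TopologicalSpace S] [ChartedSpace R3 S] [T2Space S] [CompactSpace S]
  [SecondCountableTopology S] [IsManifold (𝓡 3) ∞ S] [MeasurableSpace S] [BorelSpace S]
  {h : Bundle.RiemannianMetric (fun p : S => TangentSpace (𝓡 3) p)} [IsFiniteMeasure (vol h)]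
  {ι : Type*} [MeasurableSpace ι] [MeasurableSingletonClass ι] [Countable ι]
  {b : HilbertBasis ι ℂ (Lp ℂ 2 (vol2 h))} {nu : ι → ℝ}

lemma resolvent_eq_conjU (hnu : ∀ i, 0 ≤ nu i) : resolvent hnu b =
    conjU (spT b) (mult _ (measurable_invI hnu) inclI) := by
  ext1 v
  rw [resolvent_apply, conjU_apply, mulPow, powI_one]

lemma opRpow_resolvent (hnu : ∀ i, 0 ≤ nu i) {α : ℝ} (hα : 0 ≤ α) (v : Lp ℂ 2 (volM h)) :
    opRpow (resolvent hnu b) α v = (spT b).symm (mulPow hnu α hα (spT b v)) := by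
  rw [resolvent_eq_conjU, opRpow_conjU _ _ α hα, conjU_apply, mulPow]

lemma isFracPow_iff_of_nonneg (hh : IsC11 h) (hb : IsEigenBasis h b nu) {α : ℝ} (hα : 0 ≤ α)
    (w v : Lp ℂ 2 (volM h)) :
    IsFracPow h α w v ↔ spT b w = mulPow hb.nonneg α hα (spT b v) := by
  have key : opRpow (resolvent hb.nonneg b) α v = w ↔
      spT b w = mulPow hb.nonneg α hα (spT b v) := by
    rw [opRpow_resolvent hb.nonneg hα, LinearIsometryEquiv.symm_apply_eq, eq_comm]
  constructor
  · rintro ⟨R, hR, h1 | h1⟩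
    · rw [(isInverse_iff hh hb R).1 hR] at h1
      exact key.1 h1.2
    · exact absurd h1.1 hα.not_gt
  · exact fun h1 => ⟨_, (isInverse_iff hh hb _).2 rfl, Or.inl ⟨hα, key.2 h1⟩⟩

lemma isFracPow_iff_of_neg (hh : IsC11 h) (hb : IsEigenBasis h b nu) {α : ℝ} (hα : α < 0)
    (w v : Lp ℂ 2 (volM h)) :
    IsFracPow h α w v ↔
      spT b v = mulPow hb.nonneg (-α) (neg_nonneg.2 hα.le) (spT b w) := by
  have key : opRpow (resolvent hb.nonneg b) (-α) w = v ↔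
      spT b v = mulPow hb.nonneg (-α) (neg_nonneg.2 hα.le) (spT b w) := by
    rw [opRpow_resolvent hb.nonneg (neg_nonneg.2 hα.le), LinearIsometryEquiv.symm_apply_eq,
      eq_comm]
  constructor
  · rintro ⟨R, hR, h1 | h1⟩
    · exact absurd h1.1 hα.not_ge
    · rw [(isInverse_iff hh hb R).1 hR] at h1
      exact key.1 h1.2
  · exact fun h1 => ⟨_, (isInverse_iff hh hb _).2 rfl, Or.inr ⟨hα, key.2 h1⟩⟩

/-- Fractional powers act as multiplication operators on the spectral side. -/
theorem isFracPow_iff (hh : IsC11 h) (hb : IsEigenBasis h b nu) (α : ℝ)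
    (w v : Lp ℂ 2 (volM h)) :
    IsFracPow h α w v ↔ spT b w =ᵐ[(volume : Measure R2).prod Measure.count]
      fun p => ((wtI nu p ^ (-α) : ℝ) : ℂ) * spT b v p := by
  rcases le_or_gt 0 α with hα | hα
  · rw [isFracPow_iff_of_nonneg hh hb hα]
    constructor
    · intro h1
      rw [h1]
      exact mulPow_ae hb.nonneg hα _
    · exact fun h1 => Lp.ext (h1.trans (mulPow_ae hb.nonneg hα _).symm)
  · rw [isFracPow_iff_of_neg hh hb hα]
    have h2 := mulPow_ae hb.nonneg (neg_nonneg.2 hα.le) (spT b w)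
    have h3 : ∀ p : R2 × ι, ((wtI nu p ^ (-α) : ℝ) : ℂ) * ((wtI nu p ^ α : ℝ) : ℂ) = 1 := fun p => by
      have h0 : 0 < wtI nu p := zero_lt_one.trans_le (one_le_wtI hb.nonneg p)
      rw [← Complex.ofReal_mul, ← Real.rpow_add h0, neg_add_cancel, Real.rpow_zero,
        Complex.ofReal_one]
    constructor
    · intro h1
      rw [h1]
      filter_upwards [h2] with p hp
      rw [hp, neg_neg, ← mul_assoc, h3, one_mul]
    · intro h1
      refine Lp.ext ?_
      filter_upwards [h1, h2] with p k1 k2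
      rw [k2, k1, neg_neg, ← mul_assoc, mul_comm (_ : ℂ) (((wtI nu p ^ (-α) : ℝ) : ℂ)), h3, one_mul]

end FractionalPowers

/-! ### Operators with dense range -/

section DenseRange

/-- A vector `v` orthogonal to the range satisfies `‖A v‖² = ⟨A (A v), v⟩ = 0`. -/
lemma denseRange_of_selfAdjoint {V : Type*} [NormedAddCommGroup V] [InnerProductSpace ℂ V]
    [CompleteSpace V] (A : V →L[ℂ] V) (hA : ∀ u v, inner ℂ (A u) v = inner ℂ u (A v))
    (hinj : ∀ v, A v = 0 → v = 0) : DenseRange A := by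
  have hbot : A.rangeᗮ = ⊥ := by
    rw [Submodule.eq_bot_iff]
    refine fun v hv => hinj v ?_
    have h1 := hv (A (A v)) ⟨A v, rfl⟩
    rw [hA] at h1
    exact inner_self_eq_zero.1 h1
  have htop := (Submodule.topologicalClosure_eq_top_iff (K := A.range)).2 hbot
  exact (Submodule.dense_iff_topologicalClosure_eq_top (s := A.range)).2 htop

lemma dense_snd_of_mem_closure {V : Type*} [TopologicalSpace V] {G : Set (V × V)} {R : V → V}
    (h : ∀ v, (R v, v) ∈ closure G) : Dense (Prod.snd '' G) := fun v =>
  image_closure_subset_closure_image continuous_snd ⟨_, h v, rfl⟩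

/-- The multiplier vanishes nowhere, so this symmetric operator is injective. -/
lemma denseRange_mulPow {ι : Type*} [MeasurableSpace ι] [MeasurableSingletonClass ι] [Countable ι]
    {nu : ι → ℝ} (hnu : ∀ i, 0 ≤ nu i) {β : ℝ} (hβ : 0 ≤ β) : DenseRange (mulPow hnu β hβ) := by
  refine denseRange_of_selfAdjoint _ (inner_mult_left _ _) fun y hy => ?_
  have h1 := mulPow_ae hnu hβ y
  rw [hy] at h1
  refine Lp.ext ?_
  filter_upwards [h1, Lp.coeFn_zero ℂ 2 ((volume : Measure R2).prod (Measure.count : Measure ι))]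
    with p k1 k2
  rw [k2] at k1 ⊢
  have h0 : 0 < wtI nu p ^ (-β) := Real.rpow_pos_of_pos (zero_lt_one.trans_le (one_le_wtI hnu p)) _
  exact (mul_eq_zero.1 k1.symm).resolve_left (Complex.ofReal_ne_zero.2 h0.ne')

end DenseRange

/-! ### Sobolev spaces on the spectral side -/

section SobolevSpaces

open FourierTransform

variable {S : Type*} [TopologicalSpace S] [ChartedSpace R3 S] [T2Space S] [CompactSpace S]
  [SecondCountableTopology S] [IsManifold (𝓡 3) ∞ S] [MeasurableSpace S] [BorelSpace S]
  {h : Bundle.RiemannianMetric (fun p : S => TangentSpace (𝓡 3) p)} [IsFiniteMeasure (vol h)]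
  {ι : Type*} [MeasurableSpace ι] [MeasurableSingletonClass ι] [Countable ι]
  {b : HilbertBasis ι ℂ (Lp ℂ 2 (vol2 h))} {nu : ι → ℝ}

lemma memLp_smooth2 (h : Bundle.RiemannianMetric (fun p : S => TangentSpace (𝓡 3) p))
    [IsFiniteMeasure (vol h)] (a : smooth2 S) : MemLp a.1 2 (vol2 h) :=
  memLp_of_continuous (continuous_of_mem_smooth2 a.2)

lemma memLp_lapl2 (hh : IsC11 h) (a : smooth2 S) : MemLp (lapl2 h a.1) 2 (vol2 h) :=
  memLp_of_continuous (by
    obtain ⟨hx, hy, -⟩ := continuous_lapl2 hh a.2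
    exact hx.add hy)

/-- The class of a smooth function. -/
def cls (h : Bundle.RiemannianMetric (fun p : S => TangentSpace (𝓡 3) p))
    [IsFiniteMeasure (vol h)] (a : smooth2 S) : Lp ℂ 2 (vol2 h) := (memLp_smooth2 h a).toLp

/-- The class of the Laplacian of a smooth function. -/
def clsLap (hh : IsC11 h) (a : smooth2 S) : Lp ℂ 2 (vol2 h) := (memLp_lapl2 hh a).toLp

lemma coeFn_cls (a : smooth2 S) : cls h a =ᵐ[vol2 h] a.1 := MemLp.coeFn_toLp _

lemma coeFn_clsLap (hh : IsC11 h) (a : smooth2 S) : clsLap hh a =ᵐ[vol2 h] lapl2 h a.1 :=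
  MemLp.coeFn_toLp _

lemma cls_mem_opGraph (hh : IsC11 h) (a : smooth2 S) :
    (cls h a, clsLap hh a) ∈ opGraph (vol2 h) (smooth2 S : Set (S × S → ℂ)) (lapl2 h) :=
  ⟨a.1, a.2, coeFn_cls a, coeFn_clsLap hh a⟩

lemma eq_cls_of_mem_opGraph (hh : IsC11 h) {A B : Lp ℂ 2 (vol2 h)}
    (hAB : (A, B) ∈ opGraph (vol2 h) (smooth2 S : Set (S × S → ℂ)) (lapl2 h)) :
    ∃ a : smooth2 S, A = cls h a ∧ B = clsLap hh a := by
  obtain ⟨a, ha, h1, h2⟩ := hAB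
  exact ⟨⟨a, ha⟩, Lp.ext (h1.trans (coeFn_cls ⟨a, ha⟩).symm),
    Lp.ext (h2.trans (coeFn_clsLap hh ⟨a, ha⟩).symm)⟩

lemma inner_eq_integral_mul {Y : Type*} [MeasurableSpace Y] {ν : Measure Y} {c A : Lp ℂ 2 ν}
    (hc : ∀ᵐ q ∂ν, starRingEnd ℂ (c q) = c q) {a : Y → ℂ} (ha : A =ᵐ[ν] a) :
    inner ℂ c A = ∫ q, a q * c q ∂ν := by
  rw [inner_eq_integral]
  refine integral_congr_ae ?_
  filter_upwards [hc, ha] with q h1 h2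
  rw [h1, h2, mul_comm]

lemma isDiag_cls (hh : IsC11 h) (hb : IsEigenBasis h b nu) (a : smooth2 S) :
    IsDiag b nu (cls h a) (clsLap hh a) := fun i => by
  rw [inner_eq_integral_mul (hb.conj_eq i) (coeFn_cls a),
    inner_eq_integral_mul (hb.conj_eq i) (coeFn_clsLap hh a)]
  exact hb.integral_lapl2_mul i a.1 a.2

lemma isDiag_of_mem_closure (hh : IsC11 h) (hb : IsEigenBasis h b nu) {A B : Lp ℂ 2 (vol2 h)}
    (hAB : (A, B) ∈ closure (opGraph (vol2 h) (smooth2 S : Set (S × S → ℂ)) (lapl2 h))) :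
    IsDiag b nu A B := by
  refine of_mem_closure (isClosed_isDiag b nu) (fun p hp => ?_) hAB
  obtain ⟨a, h1, h2⟩ := eq_cls_of_mem_opGraph hh (A := p.1) (B := p.2) hp
  rw [h1, h2]
  exact isDiag_cls hh hb a

lemma continuous_pairS (hnu : ∀ i, 0 ≤ nu i) {A B : Lp ℂ 2 (vol2 h)} (hAB : IsDiag b nu A B)
    (g : 𝓢(R2, ℂ)) {s : ℝ} (hs : 0 ≤ 1 + s / 2) : Continuous fun y => pairS b nu s y g A :=
  continuous_integral_mul ((memLp_congr_ae (mulPow_dgam_ae b hnu hAB g hs)).1 (Lp.memLp _))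

lemma pairM_eq (hb : IsEigenBasis h b nu) {f : R2 × S × S → ℂ} {w : Lp ℂ 2 (volM h)}
    (hw : w =ᵐ[volM h] f) (g : 𝓢(R2, ℂ)) (a : smooth2 S) :
    pairM h f g a = ∫ p, spT b w p * (𝓕⁻ g p.1 * inner ℂ (b p.2) (cls h a))
      ∂((volume : Measure R2).prod Measure.count) := by
  have h1 : pairM h f g a = ∫ p, w p * (g p.1 * cls h a p.2) ∂(volM h) := by
    refine integral_congr_ae ?_
    filter_upwards [hw, ae_prod_mk (ae_eq_refl (μ := (volume : Measure R2)) g) (coeFn_cls a)]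
      with p k1 k2
    rw [k1, k2]
  rw [h1, integral_mul_tensor b hb.conj_eq w g]
  refine integral_congr_ae ?_
  filter_upwards [gam_ae b g (cls h a)] with p k1
  rw [k1]

lemma pairM_eq_pairS (hh : IsC11 h) (hb : IsEigenBasis h b nu) {f : R2 × S × S → ℂ}
    {w v : Lp ℂ 2 (volM h)} {s : ℝ} (hw : w =ᵐ[volM h] f) (hwv : IsFracPow h (s / 2) w v)
    (g : 𝓢(R2, ℂ)) (a : smooth2 S) : pairM h f g a = pairS b nu s (spT b v) g (cls h a) := by
  rw [pairM_eq hb hw]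
  refine integral_congr_ae ?_
  filter_upwards [(isFracPow_iff hh hb _ w v).1 hwv] with p k1
  rw [k1]
  ring

/-- The images of the test functions under `(I - Δ)^α`. -/
def testPow (h : Bundle.RiemannianMetric (fun p : S => TangentSpace (𝓡 3) p)) (α : ℝ) :
    Set (Lp ℂ 2 (volM h)) :=
  {v | ∃ f ∈ testM S, ∃ w : Lp ℂ 2 (volM h), w =ᵐ[volM h] f ∧ IsFracPow h α w v}

/-- `(I - Δ)^α f` is the bounded operator `(I - Δ)^{α - 1}`, which has dense range, applied to `(I -
Δ) f`, and the latter functions are dense. This needs `α ≤ 1`, the source of the upper bound `s ≤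
2`. -/
lemma dense_testPow (hh : IsC11 h) (hb : IsEigenBasis h b nu) {α : ℝ} (hα : 0 ≤ 1 - α) :
    Dense (testPow h α) := by
  have h1 : Dense (Prod.snd '' graphM h) := dense_snd_of_mem_closure (mem_closure_graphM hh hb)
  have h2 : DenseRange fun v => (spT b).symm (mulPow hb.nonneg (1 - α) hα (spT b v)) :=
    (spT b).symm.surjective.denseRange.comp ((denseRange_mulPow hb.nonneg hα).comp
      (spT b).surjective.denseRange (mulPow hb.nonneg (1 - α) hα).continuous)
      (spT b).symm.continuous
  have h3 : Continuous fun v => (spT b).symm (mulPow hb.nonneg (1 - α) hα (spT b v)) :=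
    (spT b).symm.continuous.comp ((mulPow hb.nonneg (1 - α) hα).continuous.comp (spT b).continuous)
  refine (h2.dense_image h3 h1).mono ?_
  rintro _ ⟨_, ⟨⟨w, z⟩, ⟨f, hf, hw, hz⟩, rfl⟩, rfl⟩
  refine ⟨f, hf, w, hw, (isFracPow_iff hh hb _ _ _).2 ?_⟩
  rw [LinearIsometryEquiv.apply_symm_apply]
  filter_upwards [spT_sub_laplM hh hb hf hw hz, mulPow_ae hb.nonneg hα (spT b z)] with p k1 k2
  have h0 : 0 < wtI nu p := zero_lt_one.trans_le (one_le_wtI hb.nonneg p)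
  change spT b z p = _ at k1
  rw [k2, k1, ← mul_assoc, ← mul_assoc, ← Complex.ofReal_mul, ← Complex.ofReal_mul,
    ← Real.rpow_add h0, ← Real.rpow_add_one h0.ne']
  have : -α + -(1 - α) + 1 = 0 := by ring
  rw [this, Real.rpow_zero, Complex.ofReal_one, one_mul]

/-- The elements of the Sobolev spaces are the weighted square integrable functions on the spectral
side. -/
theorem memH_iff (hh : IsC11 h) (hb : IsEigenBasis h b nu) {s : ℝ} (hs : -2 ≤ s) (hs' : s ≤ 2)
    (u : TemperedM S) :
    MemH h s u ↔ ∃ y : KS ι, ∀ g a, u.form g a = pairS b nu s y g (cls h a) := by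
  have hs1 : 0 ≤ 1 + s / 2 := by linarith
  have hc : ∀ (g : 𝓢(R2, ℂ)) (a : smooth2 S),
      Continuous fun y => pairS b nu s y g (cls h a) := fun g a =>
    continuous_pairS hb.nonneg (isDiag_cls hh hb a) g hs1
  constructor
  · rintro ⟨f, w, v, hf, hv, hlim⟩
    -- The `f n` need not converge in `L²`, but their images under `(I - Δ)^{s/2}` do, and the
    -- pairings depend continuously on these images.
    obtain ⟨v₀, hv₀⟩ := cauchySeq_tendsto_of_complete hv
    refine ⟨spT b v₀, fun g a => tendsto_nhds_unique (hlim g a) ?_⟩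
    simp only [fun n => pairM_eq_pairS hh hb (hf n).2.1 (hf n).2.2 g a]
    exact ((hc g a).tendsto _).comp (((spT b).continuous.tendsto _).comp hv₀)
  · rintro ⟨y, hy⟩
    -- Density supplies test functions whose images under `(I - Δ)^{s/2}` approach the vector
    -- represented by `y`.
    obtain ⟨v, hv, hlim⟩ := mem_closure_iff_seq_limit.1
      (dense_testPow hh hb (α := s / 2) (by linarith) ((spT b).symm y))
    choose f hf w hw hwv using hv
    refine ⟨f, w, v, fun n => ⟨hf n, hw n, hwv n⟩, hlim.cauchySeq, fun g a => ?_⟩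
    simp only [fun n => pairM_eq_pairS hh hb (hw n) (hwv n) g a]
    rw [hy]
    have h1 := ((spT b).continuous.tendsto _).comp hlim
    rw [LinearIsometryEquiv.apply_symm_apply] at h1
    exact ((hc g a).tendsto _).comp h1

end SobolevSpaces

/-! ### The coefficients as tempered distributions -/

section Coefficients

open FourierTransform

variable {ι : Type*} [MeasurableSpace ι] [MeasurableSingletonClass ι] [Countable ι] {nu : ι → ℝ}

lemma aestronglyMeasurable_prod_count {f : R2 × ι → ℂ}
    (hf : ∀ i, AEStronglyMeasurable (fun x => f (x, i)) (volume : Measure R2)) :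
    AEStronglyMeasurable f ((volume : Measure R2).prod Measure.count) := by
  rw [prod_count]
  exact AEStronglyMeasurable.sum_measure fun i =>
    (measurableEmbedding_prod_mk_right i).aestronglyMeasurable_map_iff.2 (hf i)

/-- A component of a square integrable function, with weight `-(1 + s / 2)`. -/
def weightedSlice (hnu : ∀ i, 0 ≤ nu i) {s : ℝ} (hs : 0 ≤ 1 + s / 2) (y : KS ι) (i : ι) :
    Lp ℂ 2 (volume : Measure R2) :=
  (memLp_slice (Lp.memLp (mulPow hnu (1 + s / 2) hs y)) i).toLp

lemma weightedSlice_ae (hnu : ∀ i, 0 ≤ nu i) {s : ℝ} (hs : 0 ≤ 1 + s / 2) (y : KS ι) (i : ι) :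
    weightedSlice hnu hs y i =ᵐ[volume]
      fun ξ => ((wtI nu (ξ, i) ^ (-(1 + s / 2)) : ℝ) : ℂ) * y (ξ, i) :=
  (MemLp.coeFn_toLp _).trans (ae_prod_count.1 (mulPow_ae hnu hs y) i)

/-- The tempered distribution whose Fourier transform is the component of index `i` of a square
integrable function, with weight `-s / 2`. -/
def coef (hnu : ∀ i, 0 ≤ nu i) {s : ℝ} (hs : 0 ≤ 1 + s / 2) (y : KS ι) (i : ι) : 𝓢'(R2, ℂ) :=
  -- For `s < 0` the weight `-s/2` is a growing one. The weight `-(1 + s/2)` keeps the function in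
  -- `L²`, and `1 + ν - Δ`, moved onto the test function, restores the missing factor of the symbol.
  PointwiseConvergenceCLM.precomp ℂ (helm (nu i))
    (𝓕⁻ (Lp.toTemperedDistribution (weightedSlice hnu hs y i)))

lemma weightedSlice_mul (hnu : ∀ i, 0 ≤ nu i) {s : ℝ} (hs : 0 ≤ 1 + s / 2) (y : KS ι) (i : ι)
    (g : 𝓢(R2, ℂ)) : (fun ξ => weightedSlice hnu hs y i ξ * 𝓕⁻ (helm (nu i) g) ξ) =ᵐ[volume]
      fun ξ => y (ξ, i) * (((wtI nu (ξ, i) ^ (-(s / 2)) : ℝ) : ℂ) * 𝓕⁻ g ξ) := by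
  filter_upwards [weightedSlice_ae hnu hs y i] with ξ k1
  rw [k1, fourierInv_helm, ← wtI_rpow_mul hnu s (ξ, i), Complex.ofReal_mul, wtI]
  ring

lemma coef_apply (hnu : ∀ i, 0 ≤ nu i) {s : ℝ} (hs : 0 ≤ 1 + s / 2) (y : KS ι) (i : ι)
    (g : 𝓢(R2, ℂ)) : coef hnu hs y i g =
      ∫ ξ, y (ξ, i) * (((wtI nu (ξ, i) ^ (-(s / 2)) : ℝ) : ℂ) * 𝓕⁻ g ξ) := by
  have h1 : coef hnu hs y i g =
      Lp.toTemperedDistribution (weightedSlice hnu hs y i) (𝓕⁻ (helm (nu i) g)) := rfl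
  rw [h1, Lp.toTemperedDistribution_apply, ← integral_congr_ae (weightedSlice_mul hnu hs y i g)]
  simp only [smul_eq_mul, mul_comm]

lemma integrable_coef (hnu : ∀ i, 0 ≤ nu i) {s : ℝ} (hs : 0 ≤ 1 + s / 2) (y : KS ι) (i : ι)
    (g : 𝓢(R2, ℂ)) :
    Integrable fun ξ => y (ξ, i) * (((wtI nu (ξ, i) ^ (-(s / 2)) : ℝ) : ℂ) * 𝓕⁻ g ξ) :=
  ((Lp.memLp (weightedSlice hnu hs y i)).integrable_mul ((𝓕⁻ (helm (nu i) g)).memLp 2)).congr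
    (weightedSlice_mul hnu hs y i g)

lemma continuous_wtI_rpow (hnu : ∀ i, 0 ≤ nu i) (s : ℝ) (i : ι) :
    Continuous fun ξ : R2 => ((wtI nu (ξ, i) ^ s : ℝ) : ℂ) := by
  refine Complex.continuous_ofReal.comp ((continuous_wt (nu i)).rpow_const fun ξ => Or.inl ?_)
  exact (zero_lt_one.trans_le (wt_pos (hnu i) ξ)).ne'

lemma locallyIntegrable_wtI_mul (hnu : ∀ i, 0 ≤ nu i) (s : ℝ) (y : KS ι) (i : ι) :
    LocallyIntegrable fun ξ : R2 => ((wtI nu (ξ, i) ^ s : ℝ) : ℂ) * y (ξ, i) := by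
  have h2 := (memLp_slice (Lp.memLp y) i).locallyIntegrable one_le_two
  rw [locallyIntegrable_iff] at h2 ⊢
  exact fun K hK => (h2 K hK).continuousOn_mul (continuous_wtI_rpow hnu s i).continuousOn hK

lemma isFourier_coef (hnu : ∀ i, 0 ≤ nu i) {s : ℝ} (hs : 0 ≤ 1 + s / 2) (y : KS ι) (i : ι) :
    IsFourier (coef hnu hs y i)
      (toAngular fun ξ => ((wtI nu (ξ, i) ^ (-(s / 2)) : ℝ) : ℂ) * y (ξ, i)) := by
  have h1 : ∀ g : 𝓢(R2, ℂ), (fun ξ => ((wtI nu (ξ, i) ^ (-(s / 2)) : ℝ) : ℂ) * y (ξ, i) * 𝓕⁻ g ξ) =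
      fun ξ => y (ξ, i) * (((wtI nu (ξ, i) ^ (-(s / 2)) : ℝ) : ℂ) * 𝓕⁻ g ξ) := fun g => by
    funext ξ
    ring
  rw [isFourier_iff, toFreq_toAngular]
  refine ⟨locallyIntegrable_toAngular (locallyIntegrable_wtI_mul hnu _ y i), fun g => ?_⟩
  rw [h1, coef_apply]
  exact ⟨integrable_coef hnu hs y i g, rfl⟩

end Coefficients

/-! ### The energy condition -/

section Energy

open FourierTransform

/-- Substituting `ξ = 2πη`: the Jacobian cancels the factor `(2π)²` in `‖toFreq G η‖²`. -/
lemma lintegral_energy (l s : ℝ) (G : R2 → ℂ) :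
    ∫⁻ ξ : R2, ENNReal.ofReal ((ξ 0 ^ 2 + ξ 1 ^ 2 + l) ^ s * ‖G ξ‖ ^ 2) =
      ∫⁻ η : R2, ENNReal.ofReal (((2 * Real.pi) ^ 2 * ‖η‖ ^ 2 + l) ^ s * ‖toFreq G η‖ ^ 2) := by
  have hc : (0 : ℝ) < (2 * Real.pi) ^ 2 := by positivity
  have h1 := lintegral_comp_two_pi fun ξ : R2 =>
    ENNReal.ofReal ((ξ 0 ^ 2 + ξ 1 ^ 2 + l) ^ s * ‖G ξ‖ ^ 2)
  have h2 : ∀ η : R2, ENNReal.ofReal (((2 * Real.pi) ^ 2 * ‖η‖ ^ 2 + l) ^ s * ‖toFreq G η‖ ^ 2) =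
      ENNReal.ofReal ((2 * Real.pi) ^ 2) * ENNReal.ofReal (((((2 * Real.pi) • η : R2) 0) ^ 2 +
        (((2 * Real.pi) • η : R2) 1) ^ 2 + l) ^ s * ‖G ((2 * Real.pi) • η)‖ ^ 2) := fun η => by
    have h3 : ‖toFreq G η‖ ^ 2 = (2 * Real.pi) ^ 2 * ‖G ((2 * Real.pi) • η)‖ ^ 2 := by
      rw [toFreq, norm_mul, mul_pow, Complex.norm_real, Real.norm_eq_abs, sq_abs]
    rw [← ENNReal.ofReal_mul hc.le, EuclideanSpace.real_norm_sq_eq, Fin.sum_univ_two, h3]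
    simp only [PiLp.smul_apply, smul_eq_mul]
    congr 1
    ring_nf
  simp only [h2]
  rw [lintegral_const_mul' _ _ ENNReal.ofReal_ne_top, h1, ← mul_assoc, ← ENNReal.ofReal_mul hc.le,
    mul_inv_cancel₀ hc.ne', ENNReal.ofReal_one, one_mul]

variable {ι : Type*} [MeasurableSpace ι] [MeasurableSingletonClass ι] [Countable ι] {nu : ι → ℝ}

lemma lintegral_lt_top_of_le {X : Type*} [MeasurableSpace X] {μ : Measure X} {f g : X → ℝ} (C : ℝ)
    (hC : 0 ≤ C) (hfg : ∀ x, f x ≤ C * g x) (hg : ∫⁻ x, ENNReal.ofReal (g x) ∂μ < ⊤) :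
    ∫⁻ x, ENNReal.ofReal (f x) ∂μ < ⊤ := by
  calc _ ≤ ∫⁻ x, ENNReal.ofReal C * ENNReal.ofReal (g x) ∂μ :=
        lintegral_mono fun x => by
          rw [← ENNReal.ofReal_mul hC]
          exact ENNReal.ofReal_le_ofReal (hfg x)
    _ = ENNReal.ofReal C * ∫⁻ x, ENNReal.ofReal (g x) ∂μ :=
        lintegral_const_mul' _ _ ENNReal.ofReal_ne_top
    _ < ⊤ := ENNReal.mul_lt_top ENNReal.ofReal_lt_top hg

/-- Shifting the spectrum gives an equivalent energy. -/
lemma energy_shift (hnu : ∀ i, 0 ≤ nu i) {m : ℝ} (hm : 0 < m) (s : ℝ) (H : ι → R2 → ℂ) :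
    ∑' i, ∫⁻ η : R2, ENNReal.ofReal
        (((2 * Real.pi) ^ 2 * ‖η‖ ^ 2 + (nu i + 2 * m)) ^ s * ‖H i η‖ ^ 2) < ⊤ ↔
      ∫⁻ p, ENNReal.ofReal (wtI nu p ^ s * ‖H p.2 p.1‖ ^ 2)
        ∂((volume : Measure R2).prod Measure.count) < ⊤ := by
  -- Let `E = W - 1 + 2m` with `W ≥ 1` and `E ≥ 2m`. Then `E ≤ (1 + 2m) W` and `W ≤ E + 1 ≤ (1 +
  -- (2m)⁻¹) E`, so this one constant works both ways.
  have hC : 0 < 1 + 2 * m + (2 * m)⁻¹ := by positivity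
  have hm' : 0 < (2 * m)⁻¹ := by positivity
  have hW : ∀ p : R2 × ι, 1 ≤ wtI nu p := one_le_wtI hnu
  have hE : ∀ p : R2 × ι, 2 * m ≤ (2 * Real.pi) ^ 2 * ‖p.1‖ ^ 2 + (nu p.2 + 2 * m) := fun p => by
    have h1 : 0 ≤ (2 * Real.pi) ^ 2 * ‖p.1‖ ^ 2 := by positivity
    linarith [hnu p.2]
  have hEW : ∀ p : R2 × ι, (2 * Real.pi) ^ 2 * ‖p.1‖ ^ 2 + (nu p.2 + 2 * m) =
      wtI nu p - 1 + 2 * m := fun p => by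
    rw [wtI, wt]
    ring
  have h1 : ∀ p : R2 × ι, (2 * Real.pi) ^ 2 * ‖p.1‖ ^ 2 + (nu p.2 + 2 * m) ≤
      (1 + 2 * m + (2 * m)⁻¹) * wtI nu p := fun p => by
    rw [hEW]
    nlinarith [hW p, mul_nonneg hm'.le (zero_le_one.trans (hW p)),
      mul_le_mul_of_nonneg_left (hW p) hm.le]
  have h2 : ∀ p : R2 × ι, wtI nu p ≤ (1 + 2 * m + (2 * m)⁻¹) *
      ((2 * Real.pi) ^ 2 * ‖p.1‖ ^ 2 + (nu p.2 + 2 * m)) := fun p => by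
    have h3 := mul_le_mul_of_nonneg_left (hE p) hm'.le
    rw [inv_mul_cancel₀ (by positivity)] at h3
    have h4 := mul_nonneg hm.le ((by positivity : 0 ≤ 2 * m).trans (hE p))
    have h5 := hEW p
    nlinarith
  rw [← lintegral_prod_count (μ := (volume : Measure R2)) fun p : R2 × ι => ENNReal.ofReal
    (((2 * Real.pi) ^ 2 * ‖p.1‖ ^ 2 + (nu p.2 + 2 * m)) ^ s * ‖H p.2 p.1‖ ^ 2)]
  have hEpos := fun p => (by positivity : 0 < 2 * m).trans_le (hE p)
  have hWpos := fun p => zero_lt_one.trans_le (hW p)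
  constructor
  · refine lintegral_lt_top_of_le ((1 + 2 * m + (2 * m)⁻¹) ^ |s|) (by positivity) fun p => ?_
    rw [← mul_assoc]
    exact mul_le_mul_of_nonneg_right (rpow_le_const_mul_rpow (hWpos p) (hEpos p) (h2 p) (h1 p) hC)
      (by positivity)
  · refine lintegral_lt_top_of_le ((1 + 2 * m + (2 * m)⁻¹) ^ |s|) (by positivity) fun p => ?_
    rw [← mul_assoc]
    exact mul_le_mul_of_nonneg_right (rpow_le_const_mul_rpow (hEpos p) (hWpos p) (h1 p) (h2 p) hC)
      (by positivity)

lemma norm_sq_wtI_mul (hnu : ∀ i, 0 ≤ nu i) (s : ℝ) (p : R2 × ι) (z : ℂ) :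
    ‖((wtI nu p ^ (s / 2) : ℝ) : ℂ) * z‖ ^ 2 = wtI nu p ^ s * ‖z‖ ^ 2 := by
  have h0 : 0 ≤ wtI nu p := zero_le_one.trans (one_le_wtI hnu p)
  rw [norm_mul, Complex.norm_real, mul_pow, Real.norm_of_nonneg (Real.rpow_nonneg h0 _),
    ← Real.rpow_mul_natCast h0]
  congr 2
  push_cast
  ring

/-- Finite energy of order `s` means that the distributions come from a square integrable
function on the spectral side. -/
theorem finiteEnergy_iff {lam : ℕ → ℝ} {m : ℝ} (hm : 0 < m) {nu : ℕ × ℕ → ℝ}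
    (hnu : ∀ i, 0 ≤ nu i) (hlam : ∀ i : ℕ × ℕ, nu i = lam i.1 ^ 2 - m + (lam i.2 ^ 2 - m))
    {s : ℝ} (hs : 0 ≤ 1 + s / 2) (c : ℕ → ℕ → 𝓢'(R2, ℂ)) :
    FiniteEnergy lam s c ↔ ∃ y : KS (ℕ × ℕ), ∀ j k, c j k = coef hnu hs y (j, k) := by
  have key : ∀ G : ℕ → ℕ → R2 → ℂ,
      ∑' jk : ℕ × ℕ, ∫⁻ ξ : R2, ENNReal.ofReal
        ((ξ 0 ^ 2 + ξ 1 ^ 2 + lam jk.1 ^ 2 + lam jk.2 ^ 2) ^ s * ‖G jk.1 jk.2 ξ‖ ^ 2) < ⊤ ↔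
      ∫⁻ p : R2 × ℕ × ℕ, ENNReal.ofReal (wtI nu p ^ s * ‖toFreq (G p.2.1 p.2.2) p.1‖ ^ 2)
        ∂((volume : Measure R2).prod Measure.count) < ⊤ := fun G => by
    rw [← energy_shift hnu hm s fun i => toFreq (G i.1 i.2)]
    have h1 : ∀ jk : ℕ × ℕ, ∫⁻ ξ : R2, ENNReal.ofReal
        ((ξ 0 ^ 2 + ξ 1 ^ 2 + lam jk.1 ^ 2 + lam jk.2 ^ 2) ^ s * ‖G jk.1 jk.2 ξ‖ ^ 2) =
        ∫⁻ η : R2, ENNReal.ofReal (((2 * Real.pi) ^ 2 * ‖η‖ ^ 2 + (nu jk + 2 * m)) ^ s *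
          ‖toFreq (G jk.1 jk.2) η‖ ^ 2) := fun jk => by
      have h2 : nu jk + 2 * m = lam jk.1 ^ 2 + lam jk.2 ^ 2 := by
        rw [hlam]
        ring
      rw [h2, ← lintegral_energy]
      simp only [add_assoc]
    simp only [h1]
  constructor
  · rintro ⟨G, hG, hfin⟩
    simp only [isFourier_iff] at hG
    rw [key] at hfin
    -- The function sought is `W^{s/2}` times the transform, whose squared norm is the energy with
    -- weight `W^s`.
    have hmeas : AEStronglyMeasurable (fun p : R2 × ℕ × ℕ =>
        ((wtI nu p ^ (s / 2) : ℝ) : ℂ) * toFreq (G p.2.1 p.2.2) p.1)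
        ((volume : Measure R2).prod Measure.count) :=
      aestronglyMeasurable_prod_count fun i =>
        (continuous_wtI_rpow hnu _ i).aestronglyMeasurable.mul
          (locallyIntegrable_toFreq (hG i.1 i.2).1).aestronglyMeasurable
    have hL : MemLp (fun p : R2 × ℕ × ℕ =>
        ((wtI nu p ^ (s / 2) : ℝ) : ℂ) * toFreq (G p.2.1 p.2.2) p.1) 2
        ((volume : Measure R2).prod Measure.count) := by
      rw [memLp_two_iff_integrable_sq_norm hmeas]
      simp only [norm_sq_wtI_mul hnu]
      refine ⟨?_, ?_⟩
      · simp only [← norm_sq_wtI_mul hnu]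
        exact hmeas.norm.pow 2
      · rw [hasFiniteIntegral_iff_ofReal (Eventually.of_forall fun p => by
          have := zero_le_one.trans (one_le_wtI hnu p)
          positivity)]
        exact hfin
    refine ⟨hL.toLp, fun j k => DFunLike.ext _ _ fun g => ?_⟩
    rw [coef_apply, ((hG j k).2 g).2]
    refine integral_congr_ae ?_
    filter_upwards [ae_prod_count.1 hL.coeFn_toLp (j, k)] with ξ k1
    have h0 : 0 < wtI nu (ξ, (j, k)) := zero_lt_one.trans_le (one_le_wtI hnu _)
    have h1 : ((wtI nu (ξ, (j, k)) ^ (s / 2) : ℝ) : ℂ) *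
        ((wtI nu (ξ, (j, k)) ^ (-(s / 2)) : ℝ) : ℂ) = 1 := by
      rw [← Complex.ofReal_mul, ← Real.rpow_add h0, add_neg_cancel, Real.rpow_zero,
        Complex.ofReal_one]
    rw [k1]
    linear_combination -(toFreq (G j k) ξ * 𝓕⁻ g ξ) * h1
  · rintro ⟨y, hy⟩
    let G : ℕ → ℕ → R2 → ℂ := fun j k =>
      toAngular fun ξ => ((wtI nu (ξ, (j, k)) ^ (-(s / 2)) : ℝ) : ℂ) * y (ξ, (j, k))
    have hG : ∀ j k, IsFourier (c j k) (G j k) := fun j k => by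
      rw [hy]
      exact isFourier_coef hnu hs y (j, k)
    have hfreq : ∀ p : R2 × ℕ × ℕ, toFreq (G p.2.1 p.2.2) p.1 =
        ((wtI nu p ^ (-(s / 2)) : ℝ) : ℂ) * y p := fun p => congrFun (toFreq_toAngular _) p.1
    refine ⟨G, hG, (key G).2 ?_⟩
    have h1 := (memLp_two_iff_integrable_sq_norm (Lp.memLp y).1).1 (Lp.memLp y)
    have h2 := (hasFiniteIntegral_iff_ofReal (Eventually.of_forall fun p => by positivity)).1 h1.2
    have h3 : ∀ p : R2 × ℕ × ℕ, wtI nu p ^ s *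
        ‖((wtI nu p ^ (-(s / 2)) : ℝ) : ℂ) * y p‖ ^ 2 = ‖y p‖ ^ 2 := fun p => by
      rw [← norm_sq_wtI_mul hnu, ← mul_assoc, ← Complex.ofReal_mul,
        ← Real.rpow_add (zero_lt_one.trans_le (one_le_wtI hnu p)), add_neg_cancel, Real.rpow_zero,
        Complex.ofReal_one, one_mul]
    simp only [hfreq, h3]
    exact h2

end Energy

/-! ### A uniqueness principle for closable functionals -/

section NullSequences

variable {M W : Type*} [AddCommGroup M] [Module ℂ M] [NormedAddCommGroup W] [NormedSpace ℂ W]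

/-- A linear functional vanishes if it is closable and annihilates, in the limit, a family that
spans. -/
lemma eq_zero_of_closable (j : M →ₗ[ℂ] W) (δ : M →ₗ[ℂ] ℂ)
    (h0 : ∀ a : ℕ → M, Tendsto (fun n => j (a n)) atTop (𝓝 0) →
      Tendsto (fun n => δ (a n)) atTop (𝓝 0))
    {ι : Type*} {w : ι → W} (hw : ∀ i, ∃ a : ℕ → M, Tendsto (fun n => j (a n)) atTop (𝓝 (w i)) ∧
      Tendsto (fun n => δ (a n)) atTop (𝓝 0)) {a : M} {α : ι → ℂ}
    (hs : HasSum (fun i => α i • w i) (j a)) : δ a = 0 := by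
  -- `Γ` is the closed graph of `δ` over `j`. It contains `(j a, δ a)` and, summing the `(w i, 0)`,
  -- also `(j a, 0)`; hence `(0, δ a)`, and closability leaves only zero.
  let Γ : Submodule ℂ (W × ℂ) := (LinearMap.range (j.prod δ)).topologicalClosure
  have hmem : ∀ a : M, (j a, δ a) ∈ Γ := fun a =>
    (LinearMap.range (j.prod δ)).le_topologicalClosure ⟨a, rfl⟩
  have hw' : ∀ i, (w i, (0 : ℂ)) ∈ Γ := fun i => by
    obtain ⟨a, h1, h2⟩ := hw i
    exact (LinearMap.range (j.prod δ)).isClosed_topologicalClosure.mem_of_tendsto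
      (h1.prodMk_nhds h2) (Eventually.of_forall fun n => hmem (a n))
  have hs' : HasSum (fun i => α i • (w i, (0 : ℂ))) (j a, 0) := by
    simp only [Prod.smul_mk, smul_zero]
    exact hs.prodMk hasSum_zero
  have h1 : (j a, (0 : ℂ)) ∈ Γ :=
    (LinearMap.range (j.prod δ)).isClosed_topologicalClosure.mem_of_tendsto hs'
      (Eventually.of_forall fun F => Γ.sum_mem fun i _ => Γ.smul_mem _ (hw' i))
  have h2 : ((0 : W), δ a) ∈ Γ := by
    have := Γ.sub_mem (hmem a) h1
    rwa [Prod.mk_sub_mk, sub_self, sub_zero] at this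
  obtain ⟨x, hx, hlim⟩ := mem_closure_iff_seq_limit.1 h2
  choose a' ha' using hx
  have h3 : ∀ n, x n = (j (a' n), δ (a' n)) := fun n => (ha' n).symm
  simp only [funext h3] at hlim
  exact tendsto_nhds_unique ((continuous_snd.tendsto _).comp hlim)
    (h0 a' ((continuous_fst.tendsto _).comp hlim))

end NullSequences

/-! ### Pairing a distribution with nonsmooth eigenfunctions -/

section Pairings

open FourierTransform

lemma tendsto_iff_eLpNorm {X : Type*} [MeasurableSpace X] {μ : Measure X} {c : ℕ → Lp ℂ 2 μ}
    {f : ℕ → X → ℂ} {C : Lp ℂ 2 μ} {f₀ : X → ℂ} (hc : ∀ n, c n =ᵐ[μ] f n) (hC : C =ᵐ[μ] f₀) :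
    Tendsto c atTop (𝓝 C) ↔
      Tendsto (fun n => eLpNorm (fun x => f n x - f₀ x) 2 μ) atTop (𝓝 0) := by
  rw [Lp.tendsto_Lp_iff_tendsto_eLpNorm']
  have : ∀ n, eLpNorm (⇑(c n) - ⇑C) 2 μ = eLpNorm (fun x => f n x - f₀ x) 2 μ := fun n =>
    eLpNorm_congr_ae ((hc n).sub hC)
  simp only [this]

lemma tendsto_inner_comp {V K : Type*} [TopologicalSpace V] [NormedAddCommGroup K]
    [InnerProductSpace ℂ K] (z : K) (A : K →L[ℂ] K) {F : V × V → K} (hF : Continuous F)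
    {x y : ℕ → V} {x₀ y₀ : V} (hx : Tendsto x atTop (𝓝 x₀)) (hy : Tendsto y atTop (𝓝 y₀)) :
    Tendsto (fun n => (inner ℂ z (A (F (x n, y n))) : ℂ)) atTop (𝓝 (inner ℂ z (A (F (x₀, y₀))))) :=
  ((continuous_const.inner (A.continuous.comp hF)).tendsto (x₀, y₀)).comp (hx.prodMk_nhds hy)

variable {S : Type*} [TopologicalSpace S] [ChartedSpace R3 S] [T2Space S] [CompactSpace S]
  [SecondCountableTopology S] [IsManifold (𝓡 3) ∞ S] [MeasurableSpace S] [BorelSpace S]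
  {h : Bundle.RiemannianMetric (fun p : S => TangentSpace (𝓡 3) p)} [IsFiniteMeasure (vol h)]
  {ι : Type*} [MeasurableSpace ι] [MeasurableSingletonClass ι] [Countable ι]
  {b : HilbertBasis ι ℂ (Lp ℂ 2 (vol2 h))} {nu : ι → ℝ} {u : TemperedM S}

lemma isPairing_iff (hh : IsC11 h) {B₀ : Lp ℂ 2 (vol2 h)} {b₀ : S × S → ℂ}
    (hb₀ : B₀ =ᵐ[vol2 h] b₀) (c : 𝓢'(R2, ℂ)) :
    IsPairing h u b₀ c ↔ ∀ (a : ℕ → smooth2 S) (B : Lp ℂ 2 (vol2 h)),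
      Tendsto (fun n => cls h (a n)) atTop (𝓝 B₀) →
      Tendsto (fun n => clsLap hh (a n)) atTop (𝓝 B) →
      ∀ g : 𝓢(R2, ℂ), Tendsto (fun n => u.form g (a n)) atTop (𝓝 (c g)) := by
  constructor
  · intro hc a B h1 h2
    exact hc a B (Lp.memLp B) ((tendsto_iff_eLpNorm (fun n => coeFn_cls (a n)) hb₀).1 h1)
      ((tendsto_iff_eLpNorm (fun n => coeFn_clsLap hh (a n)) (ae_eq_refl _)).1 h2)
  · intro hc a b' hb' h1 h2
    exact hc a hb'.toLp ((tendsto_iff_eLpNorm (fun n => coeFn_cls (a n)) hb₀).2 h1)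
      ((tendsto_iff_eLpNorm (fun n => coeFn_clsLap hh (a n)) hb'.coeFn_toLp).2 h2)

lemma isDiag_of_tendsto (hh : IsC11 h) (hb : IsEigenBasis h b nu) {a : ℕ → smooth2 S}
    {A B : Lp ℂ 2 (vol2 h)} (h1 : Tendsto (fun n => cls h (a n)) atTop (𝓝 A))
    (h2 : Tendsto (fun n => clsLap hh (a n)) atTop (𝓝 B)) : IsDiag b nu A B :=
  isDiag_of_mem_closure hh hb (mem_closure_of_tendsto (h1.prodMk_nhds h2)
    (Eventually.of_forall fun n => cls_mem_opGraph hh (a n)))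

/-- Graph norm convergence controls `dgam`, through which the pairing is an inner product; this
yields the limits demanded in `IsPairing`. -/
lemma tendsto_pairS (hh : IsC11 h) (hb : IsEigenBasis h b nu) {s : ℝ} (hs : 0 ≤ 1 + s / 2)
    (y : KS ι) (g : 𝓢(R2, ℂ)) {a : ℕ → smooth2 S} {A B : Lp ℂ 2 (vol2 h)}
    (h1 : Tendsto (fun n => cls h (a n)) atTop (𝓝 A))
    (h2 : Tendsto (fun n => clsLap hh (a n)) atTop (𝓝 B)) :
    Tendsto (fun n => pairS b nu s y g (cls h (a n))) atTop (𝓝 (pairS b nu s y g A)) := by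
  rw [pairS_eq_inner b hb.nonneg (isDiag_of_tendsto hh hb h1 h2) g hs y]
  simp only [fun n => pairS_eq_inner b hb.nonneg (isDiag_cls hh hb (a n)) g hs y]
  exact tendsto_inner_comp (star y) (mulPow hb.nonneg (1 + s / 2) hs)
    (F := fun p => dgam b g p.1 p.2) (continuous_dgam b g) h1 h2

lemma isDiag_basis (b : HilbertBasis ι ℂ (Lp ℂ 2 (vol2 h))) (nu : ι → ℝ) (i : ι) :
    IsDiag b nu (b i) (-(nu i : ℂ) • b i) := fun k => by
  classical
  rw [inner_smul_right]
  rcases eq_or_ne k i with rfl | hk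
  · rfl
  · rw [b.orthonormal.2 hk, mul_zero, mul_zero]

/-- The expansion of a distribution is integration over the counting variable in an absolutely
convergent integral. -/
lemma hasSum_pairS (hnu : ∀ i, 0 ≤ nu i) {s : ℝ} (hs : 0 ≤ 1 + s / 2) (y : KS ι) (g : 𝓢(R2, ℂ))
    {A B : Lp ℂ 2 (vol2 h)} (hAB : IsDiag b nu A B) :
    HasSum (fun i => coef hnu hs y i g * inner ℂ (b i) A) (pairS b nu s y g A) := by
  refine (hasSum_integral_prod_count (integrable_pairS b hnu hAB g hs y)).congr_fun fun i => ?_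
  rw [coef_apply, ← integral_mul_const]
  simp only [mul_assoc]

lemma pairS_basis (hnu : ∀ i, 0 ≤ nu i) {s : ℝ} (hs : 0 ≤ 1 + s / 2) (y : KS ι) (g : 𝓢(R2, ℂ))
    (i : ι) : pairS b nu s y g (b i) = coef hnu hs y i g := by
  classical
  refine (hasSum_pairS hnu hs y g (isDiag_basis b nu i)).unique ?_
  have h1 : coef hnu hs y i g = coef hnu hs y i g * inner ℂ (b i) (b i) := by
    rw [inner_self_eq_norm_sq_to_K, b.orthonormal.1 i]
    simp
  rw [h1]
  exact hasSum_single i fun k hk => by rw [b.orthonormal.2 hk, mul_zero]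

/-- The coefficients of a distribution that is given by a function on the spectral side. -/
theorem isPairing_coef (hh : IsC11 h) (hb : IsEigenBasis h b nu) {s : ℝ} (hs : 0 ≤ 1 + s / 2)
    {y : KS ι} (hy : ∀ g a, u.form g a = pairS b nu s y g (cls h a)) {i : ι} {b₀ : S × S → ℂ}
    (hb₀ : b i =ᵐ[vol2 h] b₀) : IsPairing h u b₀ (coef hb.nonneg hs y i) := by
  rw [isPairing_iff hh hb₀]
  intro a B h1 h2 g
  rw [← pairS_basis (b := b) hb.nonneg hs y g i]
  simp only [hy]
  exact tendsto_pairS hh hb hs y g h1 h2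

lemma exists_tendsto_basis (hh : IsC11 h) (hb : IsEigenBasis h b nu) (i : ι) :
    ∃ a : ℕ → smooth2 S, Tendsto (fun n => cls h (a n)) atTop (𝓝 (b i)) ∧
      Tendsto (fun n => clsLap hh (a n)) atTop (𝓝 (-(nu i : ℂ) • b i)) := by
  obtain ⟨x, hx, hlim⟩ := mem_closure_iff_seq_limit.1 (hb.mem_closure i)
  choose a h1 h2 using fun n => eq_cls_of_mem_opGraph hh (A := (x n).1) (B := (x n).2) (hx n)
  refine ⟨a, ?_, ?_⟩
  · simp only [← h1]
    exact (continuous_fst.tendsto _).comp hlim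
  · simp only [← h2]
    exact (continuous_snd.tendsto _).comp hlim

/-- Each basis vector is a graph norm limit of smooth functions, so the condition on sequences is
not vacuous. -/
lemma isPairing_unique (hh : IsC11 h) (hb : IsEigenBasis h b nu) {i : ι} {b₀ : S × S → ℂ}
    (hb₀ : b i =ᵐ[vol2 h] b₀) {c c' : 𝓢'(R2, ℂ)} (hc : IsPairing h u b₀ c)
    (hc' : IsPairing h u b₀ c') : c = c' := by
  obtain ⟨a, h1, h2⟩ := exists_tendsto_basis hh hb i
  exact DFunLike.ext _ _ fun g => tendsto_nhds_unique
    ((isPairing_iff hh hb₀ c).1 hc a _ h1 h2 g) ((isPairing_iff hh hb₀ c').1 hc' a _ h1 h2 g)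

lemma cls_add (a a' : smooth2 S) : cls h (a + a') = cls h a + cls h a' := by
  refine Lp.ext ?_
  filter_upwards [coeFn_cls (h := h) (a + a'), coeFn_cls (h := h) a, coeFn_cls (h := h) a',
    Lp.coeFn_add (cls h a) (cls h a')] with q k1 k2 k3 k4
  rw [k1, k4, Pi.add_apply, k2, k3]
  rfl

lemma cls_smul (r : ℂ) (a : smooth2 S) : cls h (r • a) = r • cls h a := by
  refine Lp.ext ?_
  filter_upwards [coeFn_cls (h := h) (r • a), coeFn_cls (h := h) a,
    Lp.coeFn_smul r (cls h a)] with q k1 k2 k4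
  rw [k1, k4, Pi.smul_apply, k2]
  rfl

lemma clsLap_add (hh : IsC11 h) (a a' : smooth2 S) :
    clsLap hh (a + a') = clsLap hh a + clsLap hh a' := by
  refine Lp.ext ?_
  filter_upwards [coeFn_clsLap hh (a + a'), coeFn_clsLap hh a, coeFn_clsLap hh a',
    Lp.coeFn_add (clsLap hh a) (clsLap hh a')] with q k1 k2 k3 k4
  rw [k1, k4, Pi.add_apply, k2, k3]
  exact lapl2_add hh a.2 a'.2 q

lemma clsLap_smul (hh : IsC11 h) (r : ℂ) (a : smooth2 S) :
    clsLap hh (r • a) = r • clsLap hh a := by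
  refine Lp.ext ?_
  filter_upwards [coeFn_clsLap hh (r • a), coeFn_clsLap hh a,
    Lp.coeFn_smul r (clsLap hh a)] with q k1 k2 k4
  rw [k1, k4, Pi.smul_apply, k2]
  exact lapl2_smul r a.1 q

/-- A smooth function and its Laplacian. -/
def clsGraph (hh : IsC11 h) : smooth2 S →ₗ[ℂ] Lp ℂ 2 (vol2 h) × Lp ℂ 2 (vol2 h) where
  toFun a := (cls h a, clsLap hh a)
  map_add' a a' := Prod.ext (cls_add a a') (clsLap_add hh a a')
  map_smul' r a := Prod.ext (cls_smul r a) (clsLap_smul hh r a)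

/-- `pairS` on smooth functions. -/
def pairSLin (hh : IsC11 h) (hb : IsEigenBasis h b nu) {s : ℝ} (hs : 0 ≤ 1 + s / 2)
    (y : KS ι) (g : 𝓢(R2, ℂ)) : smooth2 S →ₗ[ℂ] ℂ where
  toFun a := pairS b nu s y g (cls h a)
  map_add' a a' := by
    have h1 := integrable_pairS b hb.nonneg (isDiag_cls hh hb a) g hs y
    have h2 := integrable_pairS b hb.nonneg (isDiag_cls hh hb a') g hs y
    rw [pairS, pairS, pairS, ← integral_add h1 h2, cls_add]
    refine integral_congr_ae (Eventually.of_forall fun p => ?_)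
    simp only [inner_add_right]
    ring
  map_smul' r a := by
    rw [pairS, pairS, RingHom.id_apply, smul_eq_mul, ← integral_const_mul, cls_smul]
    refine integral_congr_ae (Eventually.of_forall fun p => ?_)
    simp only [inner_smul_right]
    ring

/-- The coefficients of the Laplacian are `-ν i` times those of the function, so both series
converge at once: the expansion converges in the graph norm. -/
lemma hasSum_clsGraph (hh : IsC11 h) (hb : IsEigenBasis h b nu) (a : smooth2 S) :
    HasSum (fun i => (inner ℂ (b i) (cls h a) : ℂ) • (b i, -(nu i : ℂ) • b i))
      (clsGraph hh a) := by
  have h1 : ∀ A : Lp ℂ 2 (vol2 h), HasSum (fun i => (inner ℂ (b i) A : ℂ) • b i) A := fun A => by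
    simpa only [HilbertBasis.repr_apply_apply] using b.hasSum_repr A
  refine (h1 (cls h a)).prodMk ?_
  refine (h1 (clsLap hh a)).congr_fun fun i => ?_
  rw [isDiag_cls hh hb a i, smul_smul, mul_comm]

/-- A distribution is determined by its coefficients. -/
theorem form_eq_of_isPairing [Nonempty ι] (hh : IsC11 h) (hb : IsEigenBasis h b nu) {s : ℝ}
    (hs : 0 ≤ 1 + s / 2) {y : KS ι} {b₀ : ι → S × S → ℂ} (hb₀ : ∀ i, b i =ᵐ[vol2 h] b₀ i)
    (hc : ∀ i, IsPairing h u (b₀ i) (coef hb.nonneg hs y i)) (g : 𝓢(R2, ℂ)) (a : smooth2 S) :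
    u.form g a = pairS b nu s y g (cls h a) := by
  have key : ∀ (i : ι) (a : ℕ → smooth2 S) (B : Lp ℂ 2 (vol2 h)),
      Tendsto (fun n => cls h (a n)) atTop (𝓝 (b i)) →
      Tendsto (fun n => clsLap hh (a n)) atTop (𝓝 B) →
      Tendsto (fun n => (u.form g - pairSLin hh hb hs y g) (a n)) atTop (𝓝 0) :=
    fun i a B h1 h2 => by
      have h3 := ((isPairing_iff hh (hb₀ i) _).1 (hc i) a B h1 h2 g).sub
        (tendsto_pairS hh hb hs y g h1 h2)
      rw [pairS_basis hb.nonneg hs, sub_self] at h3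
      exact h3
  refine sub_eq_zero.1 (eq_zero_of_closable (clsGraph hh) (u.form g - pairSLin hh hb hs y g)
    (fun a' ha' => ?_) (w := fun i => (b i, -(nu i : ℂ) • b i)) (fun i => ?_)
    (hasSum_clsGraph hh hb a))
  -- The hypothesis concerns sequences tending to a basis vector. A null sequence is treated by
  -- adding it to one of these and subtracting.
  · obtain ⟨i⟩ := ‹Nonempty ι›
    obtain ⟨a₀, h1, h2⟩ := exists_tendsto_basis hh hb i
    have h3 : Tendsto (fun n => cls h (a' n)) atTop (𝓝 0) := (continuous_fst.tendsto _).comp ha'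
    have h4 : Tendsto (fun n => clsLap hh (a' n)) atTop (𝓝 0) :=
      (continuous_snd.tendsto _).comp ha'
    have h5 := h1.add h3
    have h6 := h2.add h4
    simp only [← cls_add, ← clsLap_add, add_zero] at h5 h6
    have h7 := (key i (fun n => a₀ n + a' n) _ h5 h6).sub (key i a₀ _ h1 h2)
    simpa only [map_add, add_sub_cancel_left, sub_zero] using h7
  · obtain ⟨a₀, h1, h2⟩ := exists_tendsto_basis hh hb i
    exact ⟨a₀, h1.prodMk_nhds h2, key i a₀ _ h1 h2⟩

end Pairings

/-! ### Expansion of square integrable functions -/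

section Expansion

open FourierTransform

/-- The component at `i` of the Hilbert sum decomposition is the adjoint of `f ↦ f ⊗ b i`, that is,
the partial pairing. -/
lemma hasSum_tens_partialPair {X Y ι : Type*} [MeasurableSpace X] [MeasurableSpace Y]
    {μ : Measure X} {ν : Measure Y} [SigmaFinite μ] [SigmaFinite ν] [Countable ι]
    (b : HilbertBasis ι ℂ (Lp ℂ 2 ν)) (U : Lp ℂ 2 (μ.prod ν)) :
    HasSum (fun i => tens (partialPair μ (b i) U) (b i)) U := by
  classical
  have hV := isHilbertSum_tens (μ := μ) b
  have h1 := hV.hasSum_linearIsometryEquiv_symm (hV.linearIsometryEquiv U)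
  rw [LinearIsometryEquiv.symm_apply_apply] at h1
  have h2 : ∀ i, hV.linearIsometryEquiv U i = partialPair μ (b i) U := fun i => by
    refine ext_inner_left ℂ fun f => ?_
    rw [inner_partialPair_right]
    refine (lp.inner_single_left (𝕜 := ℂ) i f (hV.linearIsometryEquiv U)).symm.trans ?_
    rw [← hV.linearIsometryEquiv.symm.inner_map_map, LinearIsometryEquiv.symm_apply_apply,
      hV.linearIsometryEquiv_symm_apply_single, tensIsometry_apply]
  simpa only [h2, tensIsometry_apply] using h1

lemma coeFn_partialPair_of_ae {X Y : Type*} [MeasurableSpace X] [MeasurableSpace Y]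
    {μ : Measure X} {ν : Measure Y} [SigmaFinite μ] [SigmaFinite ν] {c : Lp ℂ 2 ν} {c₀ : Y → ℂ}
    (hc : ∀ᵐ q ∂ν, starRingEnd ℂ (c q) = c q) (hc₀ : c =ᵐ[ν] c₀) (U : Lp ℂ 2 (μ.prod ν)) :
    ∀ᵐ z ∂μ, partialPair μ c U z = ∫ q, U (z, q) * c₀ q ∂ν := by
  filter_upwards [coeFn_partialPair c U] with z hz
  rw [hz]
  refine integral_congr_ae ?_
  filter_upwards [hc, hc₀] with q k1 k2
  rw [k1, k2, mul_comm]

variable {S : Type*} [TopologicalSpace S] [ChartedSpace R3 S] [T2Space S] [CompactSpace S]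
  [SecondCountableTopology S] [IsManifold (𝓡 3) ∞ S] [MeasurableSpace S] [BorelSpace S]
  {h : Bundle.RiemannianMetric (fun p : S => TangentSpace (𝓡 3) p)} [IsFiniteMeasure (vol h)]
  {ι : Type*} [MeasurableSpace ι] [MeasurableSingletonClass ι] [Countable ι]
  {b : HilbertBasis ι ℂ (Lp ℂ 2 (vol2 h))} {nu : ι → ℝ} {u : TemperedM S}

lemma toTemperedDistribution_partialPair (hnu : ∀ i, 0 ≤ nu i) {s : ℝ} (hs : 0 ≤ 1 + s / 2)
    {U : Lp ℂ 2 (volM h)} {y : KS ι}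
    (hy : spT b U =ᵐ[(volume : Measure R2).prod Measure.count]
      fun p => ((wtI nu p ^ (-(s / 2)) : ℝ) : ℂ) * y p) (i : ι) :
    Lp.toTemperedDistribution (partialPair volume (b i) U) = coef hnu hs y i := by
  refine DFunLike.ext _ _ fun g => ?_
  rw [coef_apply, Lp.toTemperedDistribution_apply]
  simp only [smul_eq_mul, mul_comm (g _)]
  rw [← integral_fourier_mul_fourierInv]
  refine integral_congr_ae ?_
  filter_upwards [spT_ae b U i, ae_prod_count.1 hy i] with ξ k1 k2
  rw [← k1, k2]
  ring

lemma pairM_eq_pairS_of_ae (hh : IsC11 h) (hb : IsEigenBasis h b nu) {s : ℝ}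
    {U : Lp ℂ 2 (volM h)} {y : KS ι}
    (hy : spT b U =ᵐ[(volume : Measure R2).prod Measure.count]
      fun p => ((wtI nu p ^ (-(s / 2)) : ℝ) : ℂ) * y p) (g : 𝓢(R2, ℂ)) (a : smooth2 S) :
    pairM h U g a = pairS b nu s y g (cls h a) := by
  have h1 : IsFracPow h (s / 2) U ((spT b).symm y) := by
    rw [isFracPow_iff hh hb, LinearIsometryEquiv.apply_symm_apply]
    exact hy
  rw [pairM_eq_pairS hh hb (ae_eq_refl _) h1, LinearIsometryEquiv.apply_symm_apply]

end Expansion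

/-! ### Duality, with the reflection of frequencies -/

section Duality

open FourierTransform

/-- The reflection of a Schwartz function. -/
def reflS (g : 𝓢(R2, ℂ)) : 𝓢(R2, ℂ) :=
  SchwartzMap.compCLMOfContinuousLinearEquiv ℂ (ContinuousLinearEquiv.neg ℝ) g

lemma reflS_apply (g : 𝓢(R2, ℂ)) (x : R2) : reflS g x = g (-x) := rfl

/-- The unitary `spT` produces `𝓕 g`, while the bilinear pairing involves `𝓕⁻ g`; the reflection
mediates between them. -/
lemma fourierInv_reflS (g : 𝓢(R2, ℂ)) (ξ : R2) : 𝓕⁻ (reflS g) ξ = 𝓕 g ξ := by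
  rw [SchwartzMap.fourier_coe, SchwartzMap.fourierInv_coe, Real.fourierInv_eq_fourier_comp_neg]
  simp only [reflS_apply, neg_neg]

lemma fourierInv_reflS_neg (g : 𝓢(R2, ℂ)) (ξ : R2) : 𝓕⁻ (reflS g) ξ = 𝓕⁻ g (-ξ) := by
  rw [fourierInv_reflS, SchwartzMap.fourier_coe, SchwartzMap.fourierInv_coe,
    Real.fourierInv_eq_fourier_neg, neg_neg]

variable {ι : Type*} [MeasurableSpace ι] [MeasurableSingletonClass ι] [Countable ι] {nu : ι → ℝ}

lemma measurePreserving_neg_fst : MeasurePreserving (fun p : R2 × ι => (-p.1, p.2))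
    ((volume : Measure R2).prod Measure.count) ((volume : Measure R2).prod Measure.count) :=
  (Measure.measurePreserving_neg (volume : Measure R2)).prod (MeasurePreserving.id _)

/-- The reflection of the frequency. -/
def reflK (y : KS ι) : KS ι := Lp.compMeasurePreserving _ measurePreserving_neg_fst y

lemma reflK_ae (y : KS ι) : reflK y =ᵐ[(volume : Measure R2).prod Measure.count]
    fun p => y (-p.1, p.2) := Lp.coeFn_compMeasurePreserving y measurePreserving_neg_fst

lemma reflK_reflK (y : KS ι) : reflK (reflK y) = y := by
  refine Lp.ext ?_
  filter_upwards [reflK_ae (reflK y),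
    measurePreserving_neg_fst.quasiMeasurePreserving.ae (reflK_ae y)] with p k1 k2
  rw [k1, k2]
  simp only [neg_neg]

/-- The symbol is even in the frequency, so reflecting both arguments is a change of variables. -/
lemma pairS_reflK {Y : Type*} [MeasurableSpace Y] {ν : Measure Y} [SigmaFinite ν]
    (b : HilbertBasis ι ℂ (Lp ℂ 2 ν)) (s : ℝ) (y : KS ι) (g : 𝓢(R2, ℂ)) (A : Lp ℂ 2 ν) :
    pairS b nu s (reflK y) (reflS g) A = pairS b nu s y g A := by
  have hme : MeasurableEmbedding fun p : R2 × ι => (-p.1, p.2) :=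
    ((MeasurableEquiv.neg R2).prodCongr (MeasurableEquiv.refl ι)).measurableEmbedding
  rw [pairS, pairS, ← measurePreserving_neg_fst.integral_comp hme]
  refine integral_congr_ae ?_
  filter_upwards [measurePreserving_neg_fst.quasiMeasurePreserving.ae (reflK_ae y)] with p k1
  rw [k1, fourierInv_reflS_neg, wtI, wtI, wt_neg]
  simp only [neg_neg]

variable {S : Type*} [TopologicalSpace S] [ChartedSpace R3 S] [T2Space S] [CompactSpace S]
  [SecondCountableTopology S] [IsManifold (𝓡 3) ∞ S] [MeasurableSpace S] [BorelSpace S]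
  {h : Bundle.RiemannianMetric (fun p : S => TangentSpace (𝓡 3) p)} [IsFiniteMeasure (vol h)]
  {b : HilbertBasis ι ℂ (Lp ℂ 2 (vol2 h))} {u : TemperedM S}

lemma isFracPow_tensor_iff (hh : IsC11 h) (hb : IsEigenBasis h b nu) {s : ℝ}
    (hs : 0 ≤ 1 + s / 2) (g : 𝓢(R2, ℂ)) (a : smooth2 S) {w v : Lp ℂ 2 (volM h)}
    (hw : w =ᵐ[volM h] fun p => g p.1 * a.1 p.2) :
    IsFracPow h (-s / 2) w v ↔ spT b v =
      mulPow hb.nonneg (1 + s / 2) hs (dgam b (reflS g) (cls h a) (clsLap hh a)) := by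
  have h1 : w = tens (g.toLp 2 volume) (cls h a) :=
    Lp.ext (hw.trans (tens_eq_of_ae (g.coeFn_toLp 2 volume) (coeFn_cls a)).symm)
  have h2 := spT_tens_ae b g (cls h a)
  rw [← h1] at h2
  have h3 := mulPow_dgam_ae b hb.nonneg (isDiag_cls hh hb a) (reflS g) hs
  have h4 : ∀ p : R2 × ι, ((wtI nu p ^ (-(-s / 2)) : ℝ) : ℂ) *
      ((wtI nu p ^ (-(s / 2)) : ℝ) : ℂ) = 1 := fun p => by
    rw [← Complex.ofReal_mul, ← Real.rpow_add (zero_lt_one.trans_le (one_le_wtI hb.nonneg p))]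
    have : -(-s / 2) + -(s / 2) = 0 := by ring
    rw [this, Real.rpow_zero, Complex.ofReal_one]
  rw [isFracPow_iff hh hb]
  constructor
  · intro h5
    refine Lp.ext ?_
    filter_upwards [h2, h3, h5] with p k2 k3 k5
    rw [k3, fourierInv_reflS, ← k2, k5, ← mul_assoc, mul_comm (_ : ℂ)
      ((wtI nu p ^ (-(-s / 2)) : ℝ) : ℂ), h4, one_mul]
  · intro h5
    rw [h5]
    filter_upwards [h2, h3] with p k2 k3
    rw [k3, fourierInv_reflS, ← k2, ← mul_assoc, h4, one_mul]

/-- The Sobolev spaces of negative order are the dual spaces of those of positive order. -/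
theorem memH_iff_memDualH (hh : IsC11 h) (hb : IsEigenBasis h b nu) {s : ℝ} (hs : -2 ≤ s)
    (hs' : s ≤ 0) (u : TemperedM S) : MemH h s u ↔ MemDualH h (-s) u := by
  have hs1 : 0 ≤ 1 + s / 2 := by linarith
  rw [memH_iff hh hb hs (by linarith)]
  constructor
  · rintro ⟨y, hy⟩
    -- The conjugate makes the inner product bilinear in `y`, and the reflection compensates for `𝓕
    -- g` in place of `𝓕⁻ g`.
    refine ⟨(innerSL ℂ (star (reflK y))) ∘L
      ((spT b).toContinuousLinearEquiv : Lp ℂ 2 (volM h) →L[ℂ] KS ι), fun g a => ?_⟩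
    refine ⟨tens (g.toLp 2 volume) (cls h a), (spT b).symm (mulPow hb.nonneg (1 + s / 2) hs1
      (dgam b (reflS g) (cls h a) (clsLap hh a))),
      tens_eq_of_ae (g.coeFn_toLp 2 volume) (coeFn_cls a), ?_, ?_⟩
    · rw [isFracPow_tensor_iff hh hb hs1 g a
        (tens_eq_of_ae (g.coeFn_toLp 2 volume) (coeFn_cls a)),
        LinearIsometryEquiv.apply_symm_apply]
    · change u.form g a = inner ℂ (star (reflK y)) (spT b _)
      rw [LinearIsometryEquiv.apply_symm_apply, ← pairS_eq_inner b hb.nonneg (isDiag_cls hh hb a),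
        pairS_reflK, hy]
  · rintro ⟨L, hL⟩
    -- Riesz representation of `L`; the element of the spectral side is the reflected conjugate of
    -- the representing vector.
    obtain ⟨l, hl⟩ := (InnerProductSpace.toDual ℂ (Lp ℂ 2 (volM h))).surjective L
    refine ⟨reflK (star (spT b l)), fun g a => ?_⟩
    obtain ⟨w, v, hw, hwv, hu⟩ := hL g a
    rw [isFracPow_tensor_iff hh hb hs1 g a hw] at hwv
    rw [hu, ← hl, InnerProductSpace.toDual_apply_apply, ← (spT b).inner_map_map, hwv,
      ← pairS_reflK, reflK_reflK, pairS_eq_inner b hb.nonneg (isDiag_cls hh hb a) _ hs1, star_star]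

end Duality

/-! ### The claims for the given eigenfunctions -/

section EigenExpansions

variable {S : Type*} [TopologicalSpace S] [ChartedSpace R3 S] [T2Space S] [CompactSpace S]
  [SecondCountableTopology S] [IsManifold (𝓡 3) ∞ S] [MeasurableSpace S] [BorelSpace S]
  {h : Bundle.RiemannianMetric (fun p : S => TangentSpace (𝓡 3) p)} [IsFiniteMeasure (vol h)]
  {m : ℝ} {φ : HilbertBasis ℕ ℂ (Lp ℂ 2 (vol h))} {lam : ℕ → ℝ} {nu : ℕ × ℕ → ℝ}

lemma prodBasis_ae (φ : HilbertBasis ℕ ℂ (Lp ℂ 2 (vol h))) (jk : ℕ × ℕ) :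
    prodBasis φ φ jk =ᵐ[vol2 h] fun q => φ jk.1 q.1 * φ jk.2 q.2 := by
  rw [prodBasis_apply]
  exact coeFn_tens _ _

theorem exists_hasSum_expansion (hb : IsEigenBasis h (prodBasis φ φ) nu) (U : Lp ℂ 2 (volM h)) :
    ∃ (V : ℕ → ℕ → Lp ℂ 2 (volume : Measure R2)) (e : ℕ × ℕ → Lp ℂ 2 (volM h)),
      (∀ j k, ∀ᵐ z, V j k z = ∫ q : S × S, U (z, q) * (φ j q.1 * φ k q.2) ∂(vol2 h)) ∧
      (∀ jk : ℕ × ℕ, e jk =ᵐ[volM h]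
        fun p => V jk.1 jk.2 p.1 * (φ jk.1 p.2.1 * φ jk.2 p.2.2)) ∧
      HasSum e U :=
  ⟨fun j k => partialPair volume (prodBasis φ φ (j, k)) U, _,
    fun j k => coeFn_partialPair_of_ae (hb.conj_eq (j, k)) (prodBasis_ae φ (j, k)) U,
    fun jk => tens_eq_of_ae (ae_eq_refl _) (prodBasis_ae φ jk),
    hasSum_tens_partialPair (prodBasis φ φ) U⟩

/-- For `0 ≤ s` the weight `W^{-s/2}` is bounded, so the distribution represented by `y` is the `L²`
function with transform `W^{-s/2} y`. -/
theorem memH_iff_of_nonneg (hh : IsC11 h) (hm : 0 < m)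
    (hb : IsEigenBasis h (prodBasis φ φ) nu)
    (hlam : ∀ i : ℕ × ℕ, nu i = lam i.1 ^ 2 - m + (lam i.2 ^ 2 - m)) {s : ℝ} (hs : 0 ≤ s)
    (hs' : s ≤ 2) (u : TemperedM S) :
    MemH h s u ↔
      ∃ (U : Lp ℂ 2 (volM h)) (V : ℕ → ℕ → Lp ℂ 2 (volume : Measure R2)),
        (∀ g a, u.form g a = pairM h U g a) ∧
        (∀ j k, ∀ᵐ z, V j k z = ∫ q : S × S, U (z, q) * (φ j q.1 * φ k q.2) ∂(vol2 h)) ∧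
        FiniteEnergy lam s fun j k => Lp.toTemperedDistribution (V j k) := by
  have hs1 : 0 ≤ 1 + s / 2 := by linarith
  have hs2 : 0 ≤ s / 2 := by linarith
  rw [memH_iff hh hb (by linarith) hs']
  constructor
  · rintro ⟨y, hy⟩
    have hU : spT (prodBasis φ φ) ((spT (prodBasis φ φ)).symm (mulPow hb.nonneg (s / 2) hs2 y))
        =ᵐ[(volume : Measure R2).prod Measure.count]
        fun p => ((wtI nu p ^ (-(s / 2)) : ℝ) : ℂ) * y p := by
      rw [LinearIsometryEquiv.apply_symm_apply]
      exact mulPow_ae hb.nonneg hs2 y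
    refine ⟨(spT (prodBasis φ φ)).symm (mulPow hb.nonneg (s / 2) hs2 y),
      fun j k => partialPair volume (prodBasis φ φ (j, k)) _, fun g a => ?_,
      fun j k => coeFn_partialPair_of_ae (hb.conj_eq (j, k)) (prodBasis_ae φ (j, k)) _, ?_⟩
    · rw [hy, pairM_eq_pairS_of_ae hh hb hU]
    · rw [finiteEnergy_iff hm hb.nonneg hlam hs1]
      exact ⟨y, fun j k => toTemperedDistribution_partialPair hb.nonneg hs1 hU (j, k)⟩
  · rintro ⟨U, V, hU, hV, hfin⟩
    -- `U` itself is represented with order zero. Its coefficients, computed at that order, are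
    -- matched with those that finite energy provides at order `s`.
    have h0 : (0 : ℝ) ≤ 1 + 0 / 2 := by norm_num
    have hU0 : spT (prodBasis φ φ) U =ᵐ[(volume : Measure R2).prod Measure.count]
        fun p => ((wtI nu p ^ (-((0 : ℝ) / 2)) : ℝ) : ℂ) * spT (prodBasis φ φ) U p :=
      Eventually.of_forall fun p => by simp
    have hVU : ∀ j k, V j k = partialPair volume (prodBasis φ φ (j, k)) U := fun j k => by
      refine Lp.ext ?_
      filter_upwards [hV j k, coeFn_partialPair_of_ae (hb.conj_eq (j, k))
        (prodBasis_ae φ (j, k)) U] with z h1 h2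
      rw [h1, h2]
    obtain ⟨y, hy⟩ := (finiteEnergy_iff hm hb.nonneg hlam hs1 _).1 hfin
    refine ⟨y, form_eq_of_isPairing hh hb hs1 (prodBasis_ae φ) fun jk => ?_⟩
    rw [← hy jk.1 jk.2, hVU, toTemperedDistribution_partialPair hb.nonneg h0 hU0]
    exact isPairing_coef hh hb h0
      (fun g a => (hU g a).trans (pairM_eq_pairS_of_ae hh hb hU0 g a)) (prodBasis_ae φ jk)

/-- The spectral function `y` determines the coefficients, and coefficients of finite energy
reassemble to such a `y`; since they determine the distribution, both descriptions agree. -/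
theorem memH_iff_isPairing (hh : IsC11 h) (hm : 0 < m)
    (hb : IsEigenBasis h (prodBasis φ φ) nu)
    (hlam : ∀ i : ℕ × ℕ, nu i = lam i.1 ^ 2 - m + (lam i.2 ^ 2 - m)) {s : ℝ} (hs : -2 ≤ s)
    (hs' : s ≤ 2) (u : TemperedM S) :
    MemH h s u ↔ ∃ c : ℕ → ℕ → 𝓢'(R2, ℂ),
      (∀ j k, IsPairing h u (fun q => φ j q.1 * φ k q.2) (c j k)) ∧ FiniteEnergy lam s c := by
  have hs1 : 0 ≤ 1 + s / 2 := by linarith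
  rw [memH_iff hh hb hs hs']
  constructor
  · rintro ⟨y, hy⟩
    exact ⟨fun j k => coef hb.nonneg hs1 y (j, k),
      fun j k => isPairing_coef hh hb hs1 hy (prodBasis_ae φ (j, k)),
      (finiteEnergy_iff hm hb.nonneg hlam hs1 _).2 ⟨y, fun _ _ => rfl⟩⟩
  · rintro ⟨c, hc, hfin⟩
    obtain ⟨y, hy⟩ := (finiteEnergy_iff hm hb.nonneg hlam hs1 c).1 hfin
    refine ⟨y, form_eq_of_isPairing hh hb hs1 (prodBasis_ae φ) fun jk => ?_⟩
    rw [← hy jk.1 jk.2]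
    exact hc jk.1 jk.2

/-- Uniqueness of pairings replaces the given coefficients by the spectral ones, for which the
series is the absolutely convergent pairing taken index by index. -/
theorem hasSum_form (hh : IsC11 h) (hb : IsEigenBasis h (prodBasis φ φ) nu) {s : ℝ}
    (hs : -2 ≤ s) (hs' : s ≤ 2) {u : TemperedM S} (hu : MemH h s u) {c : ℕ → ℕ → 𝓢'(R2, ℂ)}
    (hc : ∀ j k, IsPairing h u (fun q => φ j q.1 * φ k q.2) (c j k)) (g : 𝓢(R2, ℂ))
    (a : smooth2 S) : HasSum (fun jk : ℕ × ℕ => c jk.1 jk.2 g *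
      ∫ q : S × S, φ jk.1 q.1 * φ jk.2 q.2 * a.1 q ∂(vol2 h)) (u.form g a) := by
  have hs1 : 0 ≤ 1 + s / 2 := by linarith
  obtain ⟨y, hy⟩ := (memH_iff hh hb hs hs' u).1 hu
  rw [hy]
  refine (hasSum_pairS hb.nonneg hs1 y g (isDiag_cls hh hb a)).congr_fun fun jk => ?_
  rw [isPairing_unique hh hb (prodBasis_ae φ jk) (hc jk.1 jk.2)
    (isPairing_coef hh hb hs1 hy (prodBasis_ae φ jk)),
    inner_eq_integral_mul (hb.conj_eq jk) (coeFn_cls a)]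
  congr 1
  refine integral_congr_ae ?_
  filter_upwards [prodBasis_ae φ jk] with q k1
  rw [k1, mul_comm]

end EigenExpansions

end EigenSobolev

end

theorem proposition4p1 {S : Type*} [TopologicalSpace S] [T2Space S] [CompactSpace S]
    [ChartedSpace EigenSobolev.R3 S] [IsManifold (𝓡 3) ∞ S] [MeasurableSpace S] [BorelSpace S]
    (h : Bundle.RiemannianMetric (fun p : S => TangentSpace (𝓡 3) p))
    (hh : EigenSobolev.IsC11 h) (m : ℝ) (hm : 0 < m)
    (φ : HilbertBasis ℕ ℂ (Lp ℂ 2 (EigenSobolev.vol h)))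
    (hreal : ∀ j, ∀ᵐ x ∂(EigenSobolev.vol h), (φ j x).im = 0)
    (lam : ℕ → ℝ)
    (heig : ∀ j, (φ j, ((lam j : ℂ) ^ 2) • φ j) ∈ EigenSobolev.schrodingerGraph h m) :
    -- the expansion of square integrable functions, with square integrable coefficients
    (∀ U : Lp ℂ 2 (EigenSobolev.volM h),
      ∃ (V : ℕ → ℕ → Lp ℂ 2 (volume : Measure EigenSobolev.R2))
        (e : ℕ × ℕ → Lp ℂ 2 (EigenSobolev.volM h)),
        (∀ j k, ∀ᵐ z, V j k z =
          ∫ q : S × S, U (z, q) * (φ j q.1 * φ k q.2) ∂(EigenSobolev.vol2 h)) ∧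
        (∀ jk : ℕ × ℕ, e jk =ᵐ[EigenSobolev.volM h]
          fun p => V jk.1 jk.2 p.1 * (φ jk.1 p.2.1 * φ jk.2 p.2.2)) ∧
        HasSum e U) ∧
    -- the spaces of order between 0 and 2, through square integrable functions
    (∀ s : ℝ, 0 ≤ s → s ≤ 2 → ∀ u : EigenSobolev.TemperedM S,
      EigenSobolev.MemH h s u ↔
        ∃ (U : Lp ℂ 2 (EigenSobolev.volM h))
          (V : ℕ → ℕ → Lp ℂ 2 (volume : Measure EigenSobolev.R2)),
          (∀ g a, u.form g a = EigenSobolev.pairM h U g a) ∧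
          (∀ j k, ∀ᵐ z, V j k z =
            ∫ q : S × S, U (z, q) * (φ j q.1 * φ k q.2) ∂(EigenSobolev.vol2 h)) ∧
          EigenSobolev.FiniteEnergy lam s fun j k => Lp.toTemperedDistribution (V j k)) ∧
    -- the spaces of order between -2 and 2, among all tempered distributions
    (∀ s : ℝ, -2 ≤ s → s ≤ 2 → ∀ u : EigenSobolev.TemperedM S,
      (EigenSobolev.MemH h s u ↔
        ∃ c : ℕ → ℕ → 𝓢'(EigenSobolev.R2, ℂ),
          (∀ j k, EigenSobolev.IsPairing h u (fun q => φ j q.1 * φ k q.2) (c j k)) ∧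
          EigenSobolev.FiniteEnergy lam s c) ∧
      -- the expansion of `u`, convergent in the space of tempered distributions
      (EigenSobolev.MemH h s u → ∀ c : ℕ → ℕ → 𝓢'(EigenSobolev.R2, ℂ),
        (∀ j k, EigenSobolev.IsPairing h u (fun q => φ j q.1 * φ k q.2) (c j k)) →
        ∀ g a, HasSum (fun jk : ℕ × ℕ => c jk.1 jk.2 g *
          ∫ q : S × S, φ jk.1 q.1 * φ jk.2 q.2 * a.1 q ∂(EigenSobolev.vol2 h)) (u.form g a))) ∧
    -- duality
    (∀ s : ℝ, -2 ≤ s → s ≤ 0 → ∀ u : EigenSobolev.TemperedM S,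
      EigenSobolev.MemH h s u ↔ EigenSobolev.MemDualH h (-s) u) := by
  have := ChartedSpace.secondCountable_of_sigmaCompact EigenSobolev.R3 S
  have := EigenSobolev.isFiniteMeasure_vol hh
  have hb := EigenSobolev.isEigenBasis_prodBasis hh φ hreal lam heig
  exact ⟨EigenSobolev.exists_hasSum_expansion hb,
    fun s hs hs' => EigenSobolev.memH_iff_of_nonneg hh hm hb (fun _ => rfl) hs hs',
    fun s hs hs' u => ⟨EigenSobolev.memH_iff_isPairing hh hm hb (fun _ => rfl) hs hs' u,
      fun hu _ hc => EigenSobolev.hasSum_form hh hb hs hs' hu hc⟩,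
    fun s hs hs' => EigenSobolev.memH_iff_memDualH hh hb hs hs'⟩
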